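/- Let $\Lambda\subset\mathbb{C}$ be a lattice, $T^2=\mathbb{C}/\Lambda$ the corresponding oriented smooth torus, and $\varphi:T^2\to\mathbb{CP}^2$ a smooth minimal Lagrangian immersion (for the Fubini--Study metric; $\varphi$ is not assumed conformal for the complex structure of $\mathbb{C}/\Lambda$). Give $T^2$ and its coverings the complex structure $j$ induced by the metric $\varphi^*g_{FS}$ and the orientation. Let $FL_2=\{(w,W)\in S^5\times Gr_{\mathbb{C}}(2,\mathbb{C}^3): w\in W\}\cong SU_3/K_2$, the $SU_3$-orbit of $(e_1,\mathrm{Sp}_{\mathbb{C}}\{e_1,e_2\})$, $K_2=\{\mathrm{diag}(1,a,a^{-1})\}$. Let $\sigma=\mu\nu$ be the order six automorphism of $SU_3$ with $\nu(g)=SgS^{-1}$, $S=\mathrm{diag}(1,\epsilon,\epsilon^2)$, $\epsilon=e^{2\pi i/3}$, and $\mu(g)=T(g^{-1})^tT^{-1}$, $Te_1=e_1$, $Te_2=e_3$, $Te_3=e_2$; let $\mathfrak{g}_1\subset\mathfrak{sl}_3(\mathbb{C})$ be the eigenspace of $\sigma$ for the eigenvalue $-\epsilon$. A smooth immersion $\psi$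 of a Riemann surface in $FL_2$ is called primitive if at every point $d\psi^{1,0}$ takes values in $[\mathfrak{g}_1]$, the bundle whose fibre at $gK_2$ is $\mathrm{Ad}\,g\cdot\mathfrak{g}_1$. Then there are a sublattice $\Lambda'\subseteq\Lambda$ with $\Lambda/\Lambda'$ trivial or isomorphic to $\mathbb{Z}_3$ and, on the covering torus $\tilde T^2=\mathbb{C}/\Lambda'\to T^2$, a primitive map $\psi_2=(f,\ell_0\oplus\ell_1):\tilde T^2\to FL_2$ that lifts $\varphi$; here $f:\tilde T^2\to S^5$ lifts $\varphi$ through the Hopf map, $\ell_0=\mathbb{C}f$ and $\ell_1=\mathbb{C}\,df(Z)$ for $Z\neq0$ of type $(1,0)$. Moreover: 1. $f$ is a minimal Legendrian immersion, and every Legendrian immersion $\tilde T^2\to S^5$ that lifts $\varphi$ equals $cf$ for a constant $c$ with $|c|=1$. 2. The cone $(r,p)\mapsto rf(p)$ is, for $r>0$, a special Lagrangian immersion with phase $\pi/2$; hence $\kappa:C(\tilde T^2)\to\mathbb{C}^3$, $\kappa(r,p)=e^{-i\pi/6}rf(p)$, is an immersed special Lagrangian cone. (An oriented real $3$-plane is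 special Lagrangian with phase $\theta$ if it is $g(e_1\wedge e_2\wedge e_3)$ with $g\in U_3$, $\det g=e^{i\theta}$; phase $0$ is plain special Lagrangian.) 3. Suppose that $j$ is the standard complex structure of $\mathbb{C}/\Lambda$, as can always be arranged, by the uniformization theorem, by a suitable choice of $\Lambda$ and of the identification $T^2=\mathbb{C}/\Lambda$. Then there is a constant $c\neq0$ such that, in the coordinate $\zeta=cz$ on $\mathbb{C}$, the Hopf differential $Q=\langle f_{\zeta\zeta\zeta},f\rangle$ is identically $1$, the matrix $F=(f,\ f_\zeta/|f_\zeta|,\ -f_{\bar\zeta}/|f_{\bar\zeta}|)$ lies in $SU_3$ and is a frame of $\psi_2$ (that is, $\psi_2=F\cdot(e_1,\mathrm{Sp}_{\mathbb{C}}\{e_1,e_2\})$), and $F$ is a Toda frame: with $s_0=1$, $s_1=|f_\zeta|$, $s_2=1/|f_\zeta|$, which are smooth positive functions on $T^2$, $$F^{-1}\frac{\partial F}{\partial\zeta}=\begin{pmatrix}s_0^{-1}\partial_\zeta s_0&0&s_0s_2^{-1}\\ s_1s_0^{-1}&s_1^{-1}\partial_\zeta s_1&0\\0&s_2s_1^{-1}&s_2^{-1}\partial_\zeta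 s_2\end{pmatrix},\qquad \frac{\partial^2}{\partial\zeta\,\partial\bar\zeta}\log(s_j^2)=s_{j+1}^2s_j^{-2}-s_j^2s_{j-1}^{-2},\quad j\in\mathbb{Z}_3.$$ -/

import Mathlib

open scoped ContDiff

noncomputable section

/-! ### Ambient spaces -/

/-- `ℂ³` with its Hermitian inner product. -/
abbrev C3 : Type := EuclideanSpace ℂ (Fin 3)

/-- The unit sphere `S⁵ ⊂ ℂ³`. -/
abbrev S5 : Type := Metric.sphere (0 : C3) 1

/-- The complex projective plane. -/
abbrev CP2 : Type := Projectivization ℂ C3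

/-- The Hopf map `S⁵ → ℂP²`. -/
def hopf (v : S5) : CP2 :=
  Projectivization.mk ℂ (v : C3) (ne_zero_of_mem_unit_sphere v)

/-- The orthogonal projection of `ℂ³` onto the line `p`. The map `p ↦ projCP2 p` is the standard
embedding of `ℂP²`, as a smooth submanifold, in the space of Hermitian endomorphisms of `ℂ³`;
smoothness of maps into `ℂP²` is smoothness after this embedding. -/
def projCP2 (p : CP2) : C3 →L[ℂ] C3 := p.submodule.starProjection

/-- The real inner product `½ Re tr(A* B)` on endomorphisms of `ℂ³`. Restricted to `ℂP²` it is the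
Fubini-Study metric (normalised so that the Hopf map is a Riemannian submersion). -/
def innerEnd (A B : C3 →L[ℂ] C3) : ℝ :=
  (1 / 2) * (LinearMap.trace ℂ C3 ((ContinuousLinearMap.adjoint A ∘L B : C3 →L[ℂ] C3) :
    C3 →ₗ[ℂ] C3)).re

/-- At `P = projCP2 p`: the orthogonal projection of Hermitian endomorphisms to the tangent space
`{A | A = A*, A = P A (1 - P) + (1 - P) A P}` of `ℂP²`. -/
def tanCP2 (P A : C3 →L[ℂ] C3) : C3 →L[ℂ] C3 := P * A * (1 - P) + (1 - P) * A * P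

/-- The complex structure of `ℂP²` on the tangent space at `P`: a tangent vector `A` corresponds to
the homomorphism `(1 - P) A P` from the line to its orthogonal complement, which is multiplied
by `i`. -/
def complexStructCP2 (P A : C3 →L[ℂ] C3) : C3 →L[ℂ] C3 :=
  Complex.I • ((1 - P) * A * P - P * A * (1 - P))

/-- The Kähler form `ω(A, B) = g(JA, B)` of `ℂP²`. -/
def kahlerCP2 (P A B : C3 →L[ℂ] C3) : ℝ := innerEnd (complexStructCP2 P A) B

/-- The Euclidean metric of `ℂ³ = ℝ⁶`. -/
def innerC3 (v w : C3) : ℝ := (inner ℂ v w).re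

/-- At `x ∈ S⁵`: the orthogonal projection of `ℂ³` to the tangent space of `S⁵`. -/
def tanS5 (x v : C3) : C3 := v - innerC3 x v • x

/-! ### Surfaces parametrised by `ℂ = ℝ²` in a submanifold of a Euclidean space -/

section Surfaces

variable {V : Type*} [NormedAddCommGroup V] [NormedSpace ℝ V]

/-- The differential of `X` is injective everywhere. -/
def IsImmersed (X : ℂ → V) : Prop := ∀ z, Function.Injective (fderiv ℝ X z)

/-- `(u, v)` is a positively oriented conformal frame at `z` for the metric that `X` induces from
the inner product `b`: the vectors `u, v` are orthogonal of equal length. For immersed `X` this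
says `v = j u`, `u ≠ 0`, for the induced complex structure `j`, so that `½ (∂_u - i ∂_v)` spans the
tangent vectors of type `(1,0)` at `z`. -/
def IsConformalFrame (b : V → V → ℝ) (X : ℂ → V) (z u v : ℂ) : Prop :=
  b (fderiv ℝ X z u) (fderiv ℝ X z u) = b (fderiv ℝ X z v) (fderiv ℝ X z v) ∧
  b (fderiv ℝ X z u) (fderiv ℝ X z v) = 0 ∧
  0 < u.re * v.im - u.im * v.re

/-- Vanishing of the mean curvature of the immersed surface `X` in a submanifold `N` of the
Euclidean space `(V, b)`, where `τ x` is the orthogonal projection to `T_x N`. As `τ` of the second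
derivative is the covariant derivative of `N`, the mean curvature is, up to a positive factor,
the normal part of `∇_u dX(u) + ∇_v dX(v)` for any conformal frame `(u, v)`. -/
def IsMinimalImm (b : V → V → ℝ) (τ : V → V → V) (X : ℂ → V) : Prop :=
  ∀ z u v, IsConformalFrame b X z u v →
    τ (X z) (fderiv ℝ (fun y => fderiv ℝ X y u) z u + fderiv ℝ (fun y => fderiv ℝ X y v) z v) ∈
      Set.range (fderiv ℝ X z)

end Surfaces

/-! ### Tori `ℂ ⧸ Λ` and their maps

A map on `ℂ ⧸ Λ` is smooth, immersed, ... when its pull-back to the universal cover `ℂ` is. -/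

/-- The map `φ : ℂ ⧸ Λ → ℂP²`, pulled back to `ℂ` and composed with the embedding of `ℂP²`. -/
def pullCP2 {Λ : Submodule ℤ ℂ} (φ : ℂ ⧸ Λ → CP2) (z : ℂ) : C3 →L[ℂ] C3 :=
  projCP2 (φ (Submodule.Quotient.mk z))

/-- The map `f : ℂ ⧸ Λ → S⁵`, pulled back to `ℂ` and regarded as a map to `ℂ³`. -/
def pullS5 {Λ : Submodule ℤ ℂ} (f : ℂ ⧸ Λ → S5) (z : ℂ) : C3 :=
  (f (Submodule.Quotient.mk z) : C3)

/-- `φ` is a smooth minimal Lagrangian immersion of the torus `ℂ ⧸ Λ` in `ℂP²`. -/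
structure IsMinimalLagrangian {Λ : Submodule ℤ ℂ} (φ : ℂ ⧸ Λ → CP2) : Prop where
  smooth : ContDiff ℝ ∞ (pullCP2 φ)
  immersed : IsImmersed (pullCP2 φ)
  minimal : IsMinimalImm innerEnd tanCP2 (pullCP2 φ)
  lagrangian : ∀ z u v,
    kahlerCP2 (pullCP2 φ z) (fderiv ℝ (pullCP2 φ) z u) (fderiv ℝ (pullCP2 φ) z v) = 0

/-- `f` is a smooth Legendrian immersion of `ℂ ⧸ Λ` in `S⁵`: it is tangent to the contact
distribution `{v ∈ T_x S⁵ | Im ⟨x, v⟩ = 0}`. -/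
structure IsLegendrian {Λ : Submodule ℤ ℂ} (f : ℂ ⧸ Λ → S5) : Prop where
  smooth : ContDiff ℝ ∞ (pullS5 f)
  immersed : IsImmersed (pullS5 f)
  legendrian : ∀ z u, (inner ℂ (pullS5 f z) (fderiv ℝ (pullS5 f) z u)).im = 0

/-- `f` is a smooth minimal Legendrian immersion of `ℂ ⧸ Λ` in `S⁵`. -/
structure IsMinimalLegendrian {Λ : Submodule ℤ ℂ} (f : ℂ ⧸ Λ → S5) : Prop
    extends IsLegendrian f where
  minimal : IsMinimalImm innerC3 tanS5 (pullS5 f)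

/-! ### The `6`-symmetric space `FL₂ = SU₃ / S¹` -/

/-- `FL₂ = {(w, W) ∈ S⁵ × Gr_ℂ(2, ℂ³) | w ∈ W}`. -/
structure FL2 where
  w : S5
  W : Submodule ℂ C3
  finrank_W : Module.finrank ℂ W = 2
  w_mem : (w : C3) ∈ W

/-- The standard embedding of `FL₂` in a real vector space. -/
def FL2.emb (q : FL2) : C3 × (C3 →L[ℂ] C3) := ((q.w : C3), q.W.starProjection)

/-- The map `ψ : ℂ ⧸ Λ → FL₂`, pulled back to `ℂ` and composed with the embedding of `FL₂`. -/
def pullFL2 {Λ : Submodule ℤ ℂ} (ψ : ℂ ⧸ Λ → FL2) (z : ℂ) : C3 × (C3 →L[ℂ] C3) :=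
  (ψ (Submodule.Quotient.mk z)).emb

abbrev Mat3 : Type := Matrix (Fin 3) (Fin 3) ℂ

/-- The `j`-th column of `g`. -/
def colVec (g : Mat3) (j : Fin 3) : C3 := WithLp.toLp 2 (fun i => g i j)

/-- `g ∈ SU₃` carries the base point `(e₁, Sp{e₁, e₂})` of `FL₂` to `q`. -/
def IsFrameAt (g : Mat3) (q : FL2) : Prop :=
  g ∈ Matrix.specialUnitaryGroup (Fin 3) ℂ ∧
  colVec g 0 = (q.w : C3) ∧ Submodule.span ℂ {colVec g 0, colVec g 1} = q.W

/-- The Lie algebra `𝔰𝔲₃`. -/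
def IsSu3 (X : Mat3) : Prop := X.conjTranspose = -X ∧ X.trace = 0

/-- The tangent vector at `q ∈ FL₂` of the curve `t ↦ exp(tX) · q`, for `X ∈ 𝔰𝔲₃`. -/
def infAction (X : Mat3) (q : FL2) : C3 × (C3 →L[ℂ] C3) :=
  let L : C3 →L[ℂ] C3 := Matrix.toEuclideanCLM (n := Fin 3) (𝕜 := ℂ) X
  (L (q.w : C3), L * q.W.starProjection - q.W.starProjection * L)

/-- `ε = exp(2πi/3)`. -/
def eps : ℂ := Complex.exp (2 * Real.pi * Complex.I / 3)

def matS : Mat3 := Matrix.diagonal ![1, eps, eps ^ 2]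

/-- `T e₁ = e₁`, `T e₂ = e₃`, `T e₃ = e₂`. -/
def matT : Mat3 := !![1, 0, 0; 0, 0, 1; 0, 1, 0]

/-- The differential, on `𝔰𝔩₃(ℂ)`, of the Coxeter-Killing automorphism `ν(g) = S g S⁻¹`. -/
def nuLie (X : Mat3) : Mat3 := matS * X * matS⁻¹

/-- The differential, on `𝔰𝔩₃(ℂ)`, of the involution `μ(g) = T (g⁻¹)ᵗ T⁻¹`. -/
def muLie (X : Mat3) : Mat3 := -(matT * X.transpose * matT⁻¹)

/-- The eigenspace `𝔤₁ ⊂ 𝔰𝔩₃(ℂ)` of the order six automorphism `σ = μν` for the primitive sixth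
root of unity `-ε`. -/
def g1 : Set Mat3 := {X | X.trace = 0 ∧ muLie (nuLie X) = (-eps) • X}

/-- The smoothly immersed surface `ψ` in `FL₂` is primitive, for the complex structure of its
domain given by the conformal frames `conf z u v`, i.e. `dψ` maps the vectors
`½ (∂_u - i ∂_v)` of type `(1,0)` to `[𝔤₁]`. At `q = g · q₀` the fibre of `[𝔤₁]` is `Ad g · 𝔤₁`, and
`dψ(∂_u), dψ(∂_v)` are identified with elements of `𝔰𝔲₃` by the infinitesimal action
(elements `ξ, η ∈ 𝔰𝔲₃` with `½ (ξ - i η) ∈ Ad g · 𝔤₁` automatically are in the reductive complement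
`Ad g · 𝔭`, which meets the isotropy algebra in `0`). -/
structure IsPrimitive {Λ : Submodule ℤ ℂ} (conf : ℂ → ℂ → ℂ → Prop) (ψ : ℂ ⧸ Λ → FL2) :
    Prop where
  smooth : ContDiff ℝ ∞ (pullFL2 ψ)
  immersed : IsImmersed (pullFL2 ψ)
  primitive : ∀ z u v, conf z u v →
    ∃ g : Mat3, IsFrameAt g (ψ (Submodule.Quotient.mk z)) ∧
      ∃ ξ η : Mat3, IsSu3 ξ ∧ IsSu3 η ∧
        fderiv ℝ (pullFL2 ψ) z u = infAction ξ (ψ (Submodule.Quotient.mk z)) ∧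
        fderiv ℝ (pullFL2 ψ) z v = infAction η (ψ (Submodule.Quotient.mk z)) ∧
        ∃ Y ∈ g1, (1 / 2 : ℂ) • (ξ - Complex.I • η) = g * Y * g⁻¹

/-! ### Cones -/

/-- The cone map `C(ℂ ⧸ Λ) → ℂ³` over the link `f`, `(r, p) ↦ r f(p)`, `r ≥ 0`; the vertex is
`r = 0`. -/
def coneMap {Λ : Submodule ℤ ℂ} (f : ℂ ⧸ Λ → S5) (r : ℝ) (p : ℂ ⧸ Λ) : C3 := r • (f p : C3)

/-- The cone map `κ = κ(r, p)` is, away from the vertex, a smooth special Lagrangian immersion with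
phase `θ`: the oriented tangent `3`-plane, with oriented basis `∂_r κ, ∂_1 κ, ∂_i κ`, is
`g (e₁ ∧ e₂ ∧ e₃)` with `g ∈ U₃`, `det g = exp(iθ)`. -/
def IsSpecialLagrangianCone {Λ : Submodule ℤ ℂ} (θ : ℝ) (κ : ℝ → ℂ ⧸ Λ → C3) : Prop :=
  ContDiffOn ℝ ∞ (fun x : ℝ × ℂ => κ x.1 (Submodule.Quotient.mk x.2)) {x | 0 < x.1} ∧
  ∀ (r : ℝ) (z : ℂ), 0 < r →
    ∃ g ∈ Matrix.unitaryGroup (Fin 3) ℂ, g.det = Complex.exp (θ * Complex.I) ∧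
      ∃ A : Matrix (Fin 3) (Fin 3) ℝ, 0 < A.det ∧
        ∀ j : Fin 3,
          fderiv ℝ (fun x : ℝ × ℂ => κ x.1 (Submodule.Quotient.mk x.2)) (r, z)
            (![(1, 0), (0, 1), (0, Complex.I)] j) = colVec (g * A.map Complex.ofReal) j

/-! ### Toda frames -/

/-- `∂/∂z = ½ (∂/∂x - i ∂/∂y)`. -/
def dZ {V : Type*} [NormedAddCommGroup V] [NormedSpace ℂ V] [NormedSpace ℝ V] (F : ℂ → V)
    (z : ℂ) : V :=
  (1 / 2 : ℂ) • (fderiv ℝ F z 1 - Complex.I • fderiv ℝ F z Complex.I)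

/-- `∂/∂z̄ = ½ (∂/∂x + i ∂/∂y)`. -/
def dZbar {V : Type*} [NormedAddCommGroup V] [NormedSpace ℂ V] [NormedSpace ℝ V] (F : ℂ → V)
    (z : ℂ) : V :=
  (1 / 2 : ℂ) • (fderiv ℝ F z 1 + Complex.I • fderiv ℝ F z Complex.I)

/-- The Hopf differential `Q = ⟨f_zzz, f⟩` (complex linear in the first entry). -/
def hopfDiff (f : ℂ → C3) (z : ℂ) : ℂ := inner ℂ (f z) (dZ (dZ (dZ f)) z)

/-- The matrix with columns `f, f_z / |f_z|, - f_z̄ / |f_z̄|`. -/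
def lagFrame (f : ℂ → C3) (z : ℂ) : Mat3 :=
  Matrix.of fun i j =>
    (![f z, (‖dZ f z‖⁻¹ : ℂ) • dZ f z, -((‖dZbar f z‖⁻¹ : ℂ) • dZbar f z)] j) i

/-- `F : ℂ → SU₃` is a Toda frame, in the coordinate `z`, with the positive functions `s₀, s₁, s₂`,
which satisfy the affine `𝔞₂` Toda equations; indices are modulo `3`. -/
structure IsTodaFrame (F : ℂ → Mat3) (s : Fin 3 → ℂ → ℝ) : Prop where
  mem : ∀ z, F z ∈ Matrix.specialUnitaryGroup (Fin 3) ℂ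
  smooth : ∀ i j, ContDiff ℝ ∞ (fun z => F z i j)
  smooth_s : ∀ j, ContDiff ℝ ∞ (s j)
  pos : ∀ j z, 0 < s j z
  frame_eq : ∀ z,
    (F z)⁻¹ * (Matrix.of fun i j => dZ (fun y => F y i j) z) =
      !![(s 0 z : ℂ)⁻¹ * dZ (fun y => (s 0 y : ℂ)) z, 0, (s 0 z : ℂ) * (s 2 z : ℂ)⁻¹;
         (s 1 z : ℂ) * (s 0 z : ℂ)⁻¹, (s 1 z : ℂ)⁻¹ * dZ (fun y => (s 1 y : ℂ)) z, 0;
         0, (s 2 z : ℂ) * (s 1 z : ℂ)⁻¹, (s 2 z : ℂ)⁻¹ * dZ (fun y => (s 2 y : ℂ)) z]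
  toda_eq : ∀ (j : Fin 3) (z : ℂ),
    dZ (dZbar (fun y => (Real.log (s j y ^ 2) : ℂ))) z =
      ((s (j + 1) z ^ 2 / s j z ^ 2 - s j z ^ 2 / s (j - 1) z ^ 2 : ℝ) : ℂ)

end

/-! Write `P z` for the orthogonal projection onto the line φ(z), pulled back to the universal cover
ℂ. The equation df = (dP)f says that a section f of these lines is parallel. The curvature of this
connection is Im⟨P_u f, P_w f⟩, which is the Kähler form evaluated on dφ. Lagrangian therefore means
flat, and ℂ is simply connected, so there is a global parallel unit section f. It is Legendrian and
unique up to a unit constant. The Hopf map is a Riemannian submersion and f is horizontal, so f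
inherits minimality from φ (`isMinLegPlane_of_horizontal`).

For a minimal Legendrian f the form Im⟨f_a, f_bc⟩ is totally symmetric and trace free. Its trace is
the logarithmic derivative of the phase of det(f, f_1, f_i), so this phase is constant
(`phase_const`). Multiplying f by a constant b multiplies the determinant by b³, which allows the
phase i. A translation by l ∈ Λ carries f to another parallel section χ(l) f with the same phase.
Hence χ³ = 1, and Λ' = ker χ has index 1 or 3. The phase i is also what makes the cone special
Lagrangian after a rotation by -π/6, because 3 · π/6 = π/2.

The same phase puts the frame (f, f_Z/|f_Z|, -f_Z̄/|f_Z̄|) in SU₃. In the (1,0) direction the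
off-diagonal part of its Maurer-Cartan matrix lies in 𝔤₁. Isotropy of f_Z kills the entries (0,1)
and (2,0), the vanishing trace of the cubic form kills (1,2), and |f_Z| = |f_Z̄| equates (1,0) with
(0,2) (`offDiag_mem`). This is primitivity.

In a conformal coordinate Q = ⟨f_zzz, f⟩ is holomorphic and does not see unit factors of f, so it
descends to ℂ/Λ and is constant by Liouville. If Q vanished, log|f_z|² would satisfy ∂∂̄ log|f_z|² =
-|f_z|² < 0, which fails at its minimum. A linear change of coordinate makes Q = 1. The structure
equations then become the Toda form, with the Tzitzeica equation as integrability condition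
(`dZ_dZbar_log`). -/

noncomputable section

/-! ### Directional derivatives on `ℂ = ℝ²` -/

section DirDeriv

variable {V : Type*} [NormedAddCommGroup V] [NormedSpace ℝ V]

/-- The derivative of `f` in the direction `u`. -/
def dirDeriv (u : ℂ) (f : ℂ → V) (z : ℂ) : V := fderiv ℝ f z u

lemma ContDiff.differentiable_infty {f : ℂ → V} (hf : ContDiff ℝ ∞ f) : Differentiable ℝ f :=
  hf.differentiable (by simp)

lemma ContDiff.dirDeriv {f : ℂ → V} (hf : ContDiff ℝ ∞ f) (u : ℂ) :
    ContDiff ℝ ∞ (dirDeriv u f) :=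
  (hf.fderiv_right (m := ∞) (by simp)).clm_apply contDiff_const

lemma dirDeriv_add_dir (f : ℂ → V) (u v z : ℂ) :
    dirDeriv (u + v) f z = dirDeriv u f z + dirDeriv v f z := map_add _ _ _

lemma dirDeriv_smul_dir (f : ℂ → V) (a : ℝ) (u z : ℂ) :
    dirDeriv ((a : ℂ) * u) f z = a • dirDeriv u f z := by
  rw [← Complex.real_smul]; exact map_smul _ _ _

lemma dirDeriv_congr {f g : ℂ → V} (h : ∀ z, f z = g z) (u z : ℂ) :
    dirDeriv u f z = dirDeriv u g z := by
  rw [funext h]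

lemma dirDeriv_const (c : V) (u z : ℂ) : dirDeriv u (fun _ => c) z = 0 := by
  simp [dirDeriv]

lemma dirDeriv_add {f g : ℂ → V} (hf : Differentiable ℝ f) (hg : Differentiable ℝ g) (u z : ℂ) :
    dirDeriv u (fun y => f y + g y) z = dirDeriv u f z + dirDeriv u g z := by
  simp only [dirDeriv]
  rw [fderiv_fun_add (hf z) (hg z)]; rfl

lemma dirDeriv_sub {f g : ℂ → V} (hf : Differentiable ℝ f) (hg : Differentiable ℝ g) (u z : ℂ) :
    dirDeriv u (fun y => f y - g y) z = dirDeriv u f z - dirDeriv u g z := by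
  simp only [dirDeriv]
  rw [fderiv_fun_sub (hf z) (hg z)]; rfl

lemma dirDeriv_neg (f : ℂ → V) (u z : ℂ) :
    dirDeriv u (fun y => -f y) z = -dirDeriv u f z := by
  simp only [dirDeriv]
  rw [fderiv_fun_neg]; rfl

lemma dirDeriv_comm {f : ℂ → V} (hf : ContDiff ℝ ∞ f) (u v z : ℂ) :
    dirDeriv u (dirDeriv v f) z = dirDeriv v (dirDeriv u f) z := by
  have key : ∀ a b : ℂ, dirDeriv a (dirDeriv b f) z = fderiv ℝ (fderiv ℝ f) z a b := by
    intro a b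
    have h1 : DifferentiableAt ℝ (fderiv ℝ f) z :=
      ((hf.fderiv_right (m := ∞) (by simp)).differentiable (by simp)) z
    have := (h1.hasFDerivAt.clm_apply (hasFDerivAt_const b z)).fderiv
    simp only [dirDeriv]
    erw [this]
    simp
  rw [key, key]
  exact (hf.contDiffAt.isSymmSndFDerivAt (by
    simpa using WithTop.coe_le_coe.2 (le_top : (2 : ℕ∞) ≤ ⊤))).eq u v

lemma dirDeriv_clm {W : Type*} [NormedAddCommGroup W] [NormedSpace ℝ W] (L : V →L[ℝ] W)
    {f : ℂ → V} (hf : Differentiable ℝ f) (u z : ℂ) :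
    dirDeriv u (fun y => L (f y)) z = L (dirDeriv u f z) := by
  have := (L.hasFDerivAt.comp z (hf z).hasFDerivAt).fderiv
  simp only [dirDeriv]
  erw [this]; rfl

lemma dirDeriv_smul {V : Type*} [NormedAddCommGroup V] [NormedSpace ℂ V] [NormedSpace ℝ V]
    [IsScalarTower ℝ ℂ V]
    {c : ℂ → ℂ} {f : ℂ → V} (hc : Differentiable ℝ c) (hf : Differentiable ℝ f) (u z : ℂ) :
    dirDeriv u (fun y => c y • f y) z = c z • dirDeriv u f z + dirDeriv u c z • f z := by
  simp only [dirDeriv]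
  rw [fderiv_fun_smul (hc z) (hf z)]; simp

lemma dirDeriv_inner {f g : ℂ → C3} (hf : Differentiable ℝ f) (hg : Differentiable ℝ g)
    (u z : ℂ) :
    dirDeriv u (fun y => inner ℂ (f y) (g y)) z =
      inner ℂ (f z) (dirDeriv u g z) + inner ℂ (dirDeriv u f z) (g z) :=
  fderiv_inner_apply ℂ (hf z) (hg z) u

lemma contDiff_inner_C3 {f g : ℂ → C3} (hf : ContDiff ℝ ∞ f) (hg : ContDiff ℝ ∞ g) :
    ContDiff ℝ ∞ (fun y => inner ℂ (f y) (g y)) := hf.inner ℂ hg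

end DirDeriv

/-- Evaluation of complex linear endomorphisms of `ℂ³`, as a real bilinear map. -/
def evalReal : (C3 →L[ℂ] C3) →L[ℝ] C3 →L[ℝ] C3 :=
  ContinuousLinearMap.restrictScalarsL ℂ C3 C3 ℝ ℝ

/-- The endomorphisms are complex linear but only real differentiable in the point. Passing through
`evalReal` makes the product rule over ℝ available. -/
lemma hasFDerivAt_apply_complex {P : ℂ → C3 →L[ℂ] C3} {f : ℂ → C3} {z : ℂ}
    (hP : DifferentiableAt ℝ P z) (hf : DifferentiableAt ℝ f z) :
    HasFDerivAt (fun y => P y (f y))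
      ((evalReal (P z)).comp (fderiv ℝ f z) + (evalReal.comp (fderiv ℝ P z)).flip (f z)) z :=
  (evalReal.hasFDerivAt.comp z hP.hasFDerivAt).clm_apply hf.hasFDerivAt

lemma dirDeriv_apply_complex {P : ℂ → C3 →L[ℂ] C3} {f : ℂ → C3} {z : ℂ}
    (hP : DifferentiableAt ℝ P z) (hf : DifferentiableAt ℝ f z) (u : ℂ) :
    dirDeriv u (fun y => P y (f y)) z = P z (dirDeriv u f z) + dirDeriv u P z (f z) := by
  simp only [dirDeriv]
  rw [(hasFDerivAt_apply_complex hP hf).fderiv]; rfl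

lemma ContDiff.clm_apply_complex {n : WithTop ℕ∞} {P : ℂ → C3 →L[ℂ] C3} {f : ℂ → C3} (hP : ContDiff ℝ n P)
    (hf : ContDiff ℝ n f) : ContDiff ℝ n (fun y => P y (f y)) :=
  (evalReal.contDiff.comp hP).clm_apply hf

/-! ### Families of projections onto complex lines -/

/-- `P` is the orthogonal projection onto a complex line. -/
def IsLineProjection (P : C3 →L[ℂ] C3) : Prop :=
  ∃ v : C3, ‖v‖ = 1 ∧ ∀ x, P x = inner ℂ v x • v

lemma inner_self_of_norm_eq_one {v : C3} (hv : ‖v‖ = 1) : inner ℂ v v = 1 := by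
  rw [inner_self_eq_norm_sq_to_K, hv]; simp

lemma isLineProjection_projCP2 (p : CP2) : IsLineProjection (projCP2 p) := by
  induction p using Projectivization.ind with
  | h v hv =>
    have hn : (‖v‖ : ℂ) ≠ 0 := by simpa using hv
    refine ⟨(‖v‖⁻¹ : ℂ) • v, ?_, fun x => ?_⟩
    · rw [norm_smul]; simp [hv]
    · unfold projCP2
      simp only [Projectivization.submodule_mk]
      rw [Submodule.starProjection_singleton, inner_smul_left, smul_smul]
      congr 1
      simp only [map_inv₀, Complex.conj_ofReal]
      push_cast
      change _ / (‖v‖ : ℂ) ^ 2 = _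
      field_simp

namespace IsLineProjection

variable {P : C3 →L[ℂ] C3} (hP : IsLineProjection P)

include hP

lemma symm (x y : C3) : inner ℂ (P x) y = inner ℂ x (P y) := by
  obtain ⟨v, -, h⟩ := hP
  rw [h, h, inner_smul_left, inner_smul_right, inner_conj_symm, mul_comm]

lemma idem (x : C3) : P (P x) = P x := by
  obtain ⟨v, hv, h⟩ := hP
  rw [h, h, inner_smul_right, inner_self_of_norm_eq_one hv, mul_one]

/-- Kept free of division, so that f may vanish or fail to be normalised. -/
lemma apply_of_fixed {f : C3} (hf : P f = f) (x : C3) :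
    inner ℂ f f • P x = inner ℂ f x • f := by
  obtain ⟨v, hv, h⟩ := hP
  have : f = inner ℂ v f • v := by rw [← h, hf]
  generalize inner ℂ v f = c at this
  subst this
  rw [h, inner_smul_left, inner_smul_left, inner_smul_right, inner_self_of_norm_eq_one hv,
    smul_smul, smul_smul]
  congr 1; ring

lemma apply_of_unit {f : C3} (hf : P f = f) (h1 : ‖f‖ = 1) (x : C3) :
    P x = inner ℂ f x • f := by
  have := hP.apply_of_fixed hf x
  rwa [inner_self_of_norm_eq_one h1, one_smul] at this

end IsLineProjection

section Family

variable {P : ℂ → C3 →L[ℂ] C3} (hP : ∀ z, IsLineProjection (P z)) (hd : Differentiable ℝ P)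

include hP hd

lemma dirDeriv_proj_symm (u z : ℂ) (x y : C3) :
    inner ℂ (dirDeriv u P z x) y = inner ℂ x (dirDeriv u P z y) := by
  have hx : ∀ x : C3, Differentiable ℝ (fun y => P y x) := fun x w =>
    (hasFDerivAt_apply_complex (hd w) (differentiableAt_const x)).differentiableAt
  have hx' : ∀ x : C3, dirDeriv u (fun y => P y x) z = dirDeriv u P z x := fun x => by
    rw [dirDeriv_apply_complex (hd z) (differentiableAt_const x), dirDeriv_const]; simp
  have h := dirDeriv_congr (fun w => (hP w).symm x y) u z
  rw [dirDeriv_inner (hx x) (differentiable_const y),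
    dirDeriv_inner (differentiable_const x) (hx y), hx', hx', dirDeriv_const, dirDeriv_const] at h
  simpa using h

/-- The derivative of P² = P. -/
lemma dirDeriv_proj_idem (u z : ℂ) (x : C3) :
    dirDeriv u P z x = P z (dirDeriv u P z x) + dirDeriv u P z (P z x) := by
  have hx : Differentiable ℝ (fun y => P y x) := fun w =>
    (hasFDerivAt_apply_complex (hd w) (differentiableAt_const x)).differentiableAt
  have hx' : dirDeriv u (fun y => P y x) z = dirDeriv u P z x := by
    rw [dirDeriv_apply_complex (hd z) (differentiableAt_const x), dirDeriv_const]; simp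
  have h := dirDeriv_congr (fun w => (hP w).idem x) u z
  rw [dirDeriv_apply_complex (hd z) (hx z), hx'] at h
  exact h.symm

/-- P (dP) P = 0: to first order the line moves into its orthogonal complement. -/
lemma proj_dirDeriv_proj (u z : ℂ) (x : C3) : P z (dirDeriv u P z (P z x)) = 0 := by
  have h := dirDeriv_proj_idem hP hd u z (P z x)
  rw [(hP z).idem] at h
  simpa using h

end Family

/-! ### Horizontal lifts of a family of lines -/

/-- On `U`, the vector field `f` lies in the lines `P z` and is parallel: `d f = (d P) f`. -/
def IsHorizontalOn (P : ℂ → C3 →L[ℂ] C3) (U : Set ℂ) (f : ℂ → C3) : Prop :=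
  ∀ z ∈ U, P z (f z) = f z ∧ DifferentiableAt ℝ f z ∧
    ∀ u, dirDeriv u f z = dirDeriv u P z (f z)

lemma IsHorizontalOn.mono {P : ℂ → C3 →L[ℂ] C3} {U U' : Set ℂ} {f : ℂ → C3}
    (h : IsHorizontalOn P U f) (hU : U' ⊆ U) : IsHorizontalOn P U' f := fun z hz => h z (hU hz)

lemma IsHorizontalOn.const_smul {P : ℂ → C3 →L[ℂ] C3} {U : Set ℂ} {f : ℂ → C3}
    (h : IsHorizontalOn P U f) (c : ℂ) : IsHorizontalOn P U (fun z => c • f z) := by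
  intro z hz
  obtain ⟨h1, h2, h3⟩ := h z hz
  refine ⟨by rw [map_smul, h1], h2.const_smul c, fun u => ?_⟩
  rw [map_smul, ← h3 u]
  simp only [dirDeriv]
  rw [fderiv_fun_const_smul h2]; rfl

lemma IsHorizontalOn.congr {P : ℂ → C3 →L[ℂ] C3} {U : Set ℂ} {f f' : ℂ → C3} (hU : IsOpen U)
    (h : IsHorizontalOn P U f) (he : ∀ z ∈ U, f' z = f z) : IsHorizontalOn P U f' := by
  intro z hz
  obtain ⟨h1, h2, h3⟩ := h z hz
  have hev : f' =ᶠ[nhds z] f := Filter.eventuallyEq_of_mem (hU.mem_nhds hz) he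
  refine ⟨by rw [he z hz, h1], h2.congr_of_eventuallyEq hev, fun u => ?_⟩
  rw [he z hz, ← h3 u]
  simp only [dirDeriv]
  rw [hev.fderiv_eq]

lemma IsHorizontalOn.union {P : ℂ → C3 →L[ℂ] C3} {U U' : Set ℂ} {f : ℂ → C3}
    (h : IsHorizontalOn P U f) (h' : IsHorizontalOn P U' f) : IsHorizontalOn P (U ∪ U') f :=
  fun z hz => hz.elim (h z) (h' z)

section

variable {P : ℂ → C3 →L[ℂ] C3} (hP : ∀ z, IsLineProjection (P z)) (hs : ContDiff ℝ ∞ P)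

include hP hs

lemma inner_dirDeriv_proj_eq_zero {z : ℂ} {f g : C3} (hf : P z f = f) (hg : P z g = g) (u : ℂ) :
    inner ℂ f (dirDeriv u P z g) = 0 := by
  have := proj_dirDeriv_proj hP hs.differentiable_infty u z g
  rw [hg] at this
  rw [← hf, (hP z).symm, this, inner_zero_right]

/-- The derivative of ⟨f, f'⟩ is ⟨f, P_u f'⟩ + ⟨P_u f, f'⟩, and both terms vanish because P_u maps
the line to its complement. -/
lemma IsHorizontalOn.inner_const {U : Set ℂ} (hU : IsOpen U) (hU' : IsPreconnected U)
    {f f' : ℂ → C3} (h : IsHorizontalOn P U f) (h' : IsHorizontalOn P U f') :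
    ∃ c : ℂ, ∀ z ∈ U, inner ℂ (f z) (f' z) = c := by
  refine hU.exists_is_const_of_fderiv_eq_zero (𝕜 := ℝ) hU'
    (fun z hz => ((h z hz).2.1.inner ℂ (h' z hz).2.1).differentiableWithinAt) fun z hz => ?_
  obtain ⟨h1, h2, h3⟩ := h z hz
  obtain ⟨h1', h2', h3'⟩ := h' z hz
  ext1 u
  rw [fderiv_inner_apply ℂ h2 h2']
  change inner ℂ (f z) (dirDeriv u f' z) + inner ℂ (dirDeriv u f z) (f' z) = 0
  rw [h3, h3', dirDeriv_proj_symm hP hs.differentiable_infty,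
    inner_dirDeriv_proj_eq_zero hP hs h1 h1', add_zero]

/-- Rigidity of parallel sections. It serves three purposes: gluing local lifts, defining the
holonomy character, and uniqueness of the Legendrian lift. -/
lemma IsHorizontalOn.eq_const_smul {U : Set ℂ} (hU : IsOpen U) (hU' : IsPreconnected U)
    (hne : U.Nonempty)
    {f f' : ℂ → C3} (h : IsHorizontalOn P U f) (h' : IsHorizontalOn P U f')
    (h1 : ∀ z ∈ U, ‖f z‖ = 1) (h1' : ∀ z ∈ U, ‖f' z‖ = 1) :
    ∃ c : ℂ, ‖c‖ = 1 ∧ ∀ z ∈ U, f' z = c • f z := by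
  obtain ⟨c, hc⟩ := h.inner_const hP hs hU hU' h'
  have key : ∀ z ∈ U, f' z = c • f z := fun z hz => by
    rw [← hc z hz, ← (hP z).apply_of_unit (h z hz).1 (h1 z hz), (h' z hz).1]
  obtain ⟨z, hz⟩ := hne
  refine ⟨c, ?_, key⟩
  have := h1' z hz
  rwa [key z hz, norm_smul, h1 z hz, mul_one] at this

/-- Local existence: the section `z ↦ P z v` of the line bundle can be made parallel if the
curvature vanishes. -/
lemma exists_horizontal_of_section
    (hL : ∀ z u w f, P z f = f → (inner ℂ (dirDeriv u P z f) (dirDeriv w P z f)).im = 0)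
    {U : Set ℂ} (hU : IsOpen U) (hc : Convex ℝ U) (v : C3) (hv : ∀ z ∈ U, P z v ≠ 0) :
    ∃ f, IsHorizontalOn P U f ∧ ∀ z ∈ U, ‖f z‖ = 1 := by
  have hd := hs.differentiable_infty
  set p : ℂ → C3 := fun z => P z v with hp
  have hps : ContDiff ℝ ∞ p := hs.clm_apply_complex contDiff_const
  have hpd := hps.differentiable_infty
  have hpu : ∀ u z, dirDeriv u p z = dirDeriv u P z v := fun u z => by
    rw [hp, dirDeriv_apply_complex (hd z) (differentiableAt_const v), dirDeriv_const]; simp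
  have hfix : ∀ z, P z (p z) = p z := fun z => (hP z).idem v
  set D : ℂ → ℂ := fun z => inner ℂ (p z) (p z) with hD
  have hDs : ContDiff ℝ ∞ D := contDiff_inner_C3 hps hps
  have hD0 : ∀ z ∈ U, D z ≠ 0 := fun z hz => inner_self_ne_zero.2 (hv z hz)
  -- α is the connection form of the section p, that is, the component of dp along p. The section
  -- exp(-g) p is parallel as soon as dg = α.
  let α : ℂ → ℂ →L[ℝ] ℂ := fun z =>
    (D z)⁻¹ • (((innerSL ℂ (p z)).restrictScalars ℝ).comp (fderiv ℝ p z))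
  have hα : ∀ z u, α z u = (D z)⁻¹ * inner ℂ (p z) (dirDeriv u p z) := fun z u => rfl
  have hαs : ContDiffOn ℝ ∞ α U := by
    rw [contDiffOn_clm_apply]
    intro u
    simp only [hα]
    exact (hDs.contDiffOn.inv hD0).mul (contDiff_inner_C3 hps (hps.dirDeriv u)).contDiffOn
  have hαd : ∀ z ∈ U, DifferentiableAt ℝ α z := fun z hz =>
    (hαs.differentiableOn (by simp)).differentiableAt (hU.mem_nhds hz)
  have hperp : ∀ z u, dirDeriv u p z - P z (dirDeriv u p z) = dirDeriv u P z (p z) := by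
    intro z u
    rw [hpu, sub_eq_iff_eq_add', ← dirDeriv_proj_idem hP hd]
  have hproj : ∀ z u, D z • P z (dirDeriv u p z) = inner ℂ (p z) (dirDeriv u p z) • p z :=
    fun z u => (hP z).apply_of_fixed (hfix z) _
  -- the Gram matrix of the derivatives splits
  have hgram : ∀ z u w, D z * inner ℂ (dirDeriv w p z) (dirDeriv u p z) =
      inner ℂ (dirDeriv w p z) (p z) * inner ℂ (p z) (dirDeriv u p z) +
        D z * inner ℂ (dirDeriv w P z (p z)) (dirDeriv u P z (p z)) := by
    intro z u w
    have h1 : inner ℂ (dirDeriv w P z (p z)) (dirDeriv u P z (p z)) =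
        inner ℂ (dirDeriv w p z) (dirDeriv u P z (p z)) := by
      have : inner ℂ (P z (dirDeriv w p z)) (dirDeriv u P z (p z)) = 0 :=
        inner_dirDeriv_proj_eq_zero hP hs ((hP z).idem _) (hfix z) u
      rw [← hperp z w, inner_sub_left, this, sub_zero]
    rw [h1, ← hperp z u, inner_sub_right, mul_sub, ← inner_smul_right _ (P z _) (D z), hproj,
      inner_smul_right]
    ring
  -- α is closed. In D² dα the second derivatives of p cancel by symmetry. By `hgram` the rest is D
  -- times ⟨P_w p, P_u p⟩ minus its conjugate, which flatness annuls.
  have hsymm : ∀ z ∈ U, ∀ w u, fderiv ℝ α z w u = fderiv ℝ α z u w := by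
    intro z hz
    have e1 : ∀ w u, fderiv ℝ α z w u = dirDeriv w (fun y => α y u) z := by
      intro w u
      have := ((hαd z hz).hasFDerivAt.clm_apply (hasFDerivAt_const u z)).fderiv
      simp only [dirDeriv]
      erw [this]; simp
    -- The derivative of α(u) D = ⟨p, p_u⟩, which avoids differentiating a quotient.
    have e2 : ∀ w u, D z * fderiv ℝ α z w u = inner ℂ (p z) (dirDeriv w (dirDeriv u p) z) +
        inner ℂ (dirDeriv w p z) (dirDeriv u p z) - α z u * (inner ℂ (p z) (dirDeriv w p z) +
          inner ℂ (dirDeriv w p z) (p z)) := by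
      intro w u
      have hev : (fun y => α y u * D y) =ᶠ[nhds z] fun y => inner ℂ (p y) (dirDeriv u p y) :=
        Filter.eventuallyEq_of_mem (hU.mem_nhds hz) fun y hy => by
          have := hD0 y hy
          simp only [hα]; field_simp
      have h := congrArg (fun L : ℂ →L[ℝ] ℂ => L w) hev.fderiv_eq
      have hq : DifferentiableAt ℝ (fun y => α y u) z :=
        (hαd z hz).clm_apply (differentiableAt_const u)
      rw [fderiv_fun_mul hq (hDs.differentiable_infty z)] at h
      change α z u * dirDeriv w D z + D z * dirDeriv w (fun y => α y u) z =
        dirDeriv w (fun y => inner ℂ (p y) (dirDeriv u p y)) z at h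
      rw [dirDeriv_inner hpd (hps.dirDeriv u).differentiable_infty, hD,
        dirDeriv_inner hpd hpd] at h
      rw [e1]
      linear_combination h
    intro w u
    have hDz := hD0 z hz
    refine mul_left_cancel₀ (mul_ne_zero hDz hDz) ?_
    rw [mul_assoc, mul_assoc, e2, e2, hα, hα, dirDeriv_comm hps w u]
    have g1 := hgram z u w
    have g2 := hgram z w u
    have hreal : inner ℂ (dirDeriv w P z (p z)) (dirDeriv u P z (p z)) =
        inner ℂ (dirDeriv u P z (p z)) (dirDeriv w P z (p z)) := by
      rw [← inner_conj_symm, Complex.conj_eq_iff_im.2 (hL z u w _ (hfix z))]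
    rw [hreal] at g1
    have c1 : D z * (D z)⁻¹ = 1 := mul_inv_cancel₀ hDz
    linear_combination g1 - g2 + (inner ℂ (p z) (dirDeriv w p z) *
      inner ℂ (dirDeriv u p z) (p z) - inner ℂ (p z) (dirDeriv u p z) *
      inner ℂ (dirDeriv w p z) (p z)) * c1
  -- Poincaré lemma on the convex set U.
  obtain ⟨g, hg⟩ := hc.exists_forall_hasFDerivAt_of_fderiv_symmetric hU
    (hαs.differentiableOn (by simp)) hsymm
  set f : ℂ → C3 := fun z => Complex.exp (-g z) • p z with hf
  have hfh : IsHorizontalOn P U f := by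
    intro z hz
    have hgz : HasFDerivAt (fun y => Complex.exp (-g y)) _ z := (hg z hz).neg.cexp
    have hfz := hgz.smul (hpd z).hasFDerivAt
    refine ⟨by rw [hf]; simp only [map_smul, hfix], hfz.differentiableAt, fun u => ?_⟩
    have : dirDeriv u f z = Complex.exp (-g z) • dirDeriv u p z +
        (Complex.exp (-g z) * (-α z u)) • p z := by
      simp only [dirDeriv]
      rw [hf]
      erw [hfz.fderiv]
      simp
    rw [this, hf]
    simp only [map_smul]
    rw [← hperp, smul_sub, sub_eq_add_neg, mul_smul, ← smul_neg, hα]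
    congr 2
    rw [neg_smul, mul_smul, ← hproj, inv_smul_smul₀ (hD0 z hz)]
  rcases U.eq_empty_or_nonempty with rfl | ⟨z0, hz0⟩
  · exact ⟨f, hfh, by simp⟩
  -- The norm of a parallel section is constant, so a constant rescaling makes it a unit section.
  obtain ⟨c, hc'⟩ := hfh.inner_const hP hs hU hc.isPreconnected hfh
  have hn : ∀ z ∈ U, ‖f z‖ = ‖f z0‖ := by
    intro z hz
    have := (hc' z hz).trans (hc' z0 hz0).symm
    rw [inner_self_eq_norm_sq_to_K, inner_self_eq_norm_sq_to_K] at this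
    have h2 : ‖f z‖ ^ 2 = ‖f z0‖ ^ 2 := by exact_mod_cast this
    exact (pow_left_inj₀ (norm_nonneg _) (norm_nonneg _) two_ne_zero).1 h2
  have h0 : ‖f z0‖ ≠ 0 := by
    rw [norm_ne_zero_iff, hf]
    exact smul_ne_zero (Complex.exp_ne_zero _) (hv z0 hz0)
  refine ⟨_, hfh.const_smul (‖f z0‖⁻¹ : ℂ), fun z hz => ?_⟩
  rw [norm_smul, hn z hz]
  simp [h0]

end

/-! ### Gluing local parallel sections to a global one -/

/-- Intervals of radius δ centred at -R + kδ overlap their neighbours in length δ and are joined one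
at a time. The parts sticking out of [-R, R] are cut off by monotonicity at the end. -/
lemma glue_intervals {Q : ℝ → ℝ → Prop} {δ R : ℝ} (hδ : 0 < δ) (hR : 0 ≤ R)
    (hmono : ∀ a b a' b', a ≤ a' → b' ≤ b → Q a b → Q a' b')
    (hloc : ∀ x ∈ Set.Icc (-R) R, Q (x - δ) (x + δ))
    (hglue : ∀ a a' b b', a ≤ a' → a' < b → b ≤ b' → Q a b → Q a' b' → Q a b') : Q (-R) R := by
  have key : ∀ k : ℕ, -R + k * δ ≤ R → Q (-R - δ) (-R + k * δ + δ) := by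
    intro k
    induction k with
    | zero => intro h; simpa using hloc (-R) ⟨le_rfl, by linarith⟩
    | succ k ih =>
      intro h
      push_cast at h ⊢
      have hk : (0 : ℝ) ≤ k * δ := by positivity
      refine hglue _ (-R + (k + 1) * δ - δ) (-R + k * δ + δ) _ (by nlinarith) (by nlinarith)
        (by nlinarith) (ih (by nlinarith)) (hloc _ ⟨by nlinarith, h⟩)
  have hfl := Nat.floor_le (a := 2 * R / δ) (by positivity)
  have hlt := Nat.lt_floor_add_one (2 * R / δ)
  rw [le_div_iff₀ hδ] at hfl
  rw [div_lt_iff₀ hδ] at hlt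
  exact hmono _ _ _ _ (by linarith) (by linarith) (key _ (by linarith))

lemma convex_reProdIm_Ioo (a b c d : ℝ) : Convex ℝ (Set.Ioo a b ×ℂ Set.Ioo c d) :=
  ((convex_Ioo a b).linear_preimage Complex.reLm).inter
    ((convex_Ioo c d).linear_preimage Complex.imLm)

section

variable {P : ℂ → C3 →L[ℂ] C3}

/-- There is a horizontal unit vector field over `U`. -/
def HasUnitLift (P : ℂ → C3 →L[ℂ] C3) (U : Set ℂ) : Prop :=
  ∃ f, IsHorizontalOn P U f ∧ ∀ z ∈ U, ‖f z‖ = 1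

lemma HasUnitLift.mono {U U' : Set ℂ} (h : HasUnitLift P U) (hU : U' ⊆ U) : HasUnitLift P U' := by
  obtain ⟨f, h1, h2⟩ := h
  exact ⟨f, h1.mono hU, fun z hz => h2 z (hU hz)⟩

variable (hP : ∀ z, IsLineProjection (P z)) (hs : ContDiff ℝ ∞ P)

include hP hs

/-- On the connected overlap the two lifts differ by a unit constant, which is absorbed into the
second one. -/
lemma HasUnitLift.union {U U' : Set ℂ} (hU : IsOpen U) (hU' : IsOpen U')
    (hc : IsPreconnected (U ∩ U')) (hne : (U ∩ U').Nonempty)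
    (h : HasUnitLift P U) (h' : HasUnitLift P U') : HasUnitLift P (U ∪ U') := by
  classical
  obtain ⟨f, h1, h2⟩ := h
  obtain ⟨f', h1', h2'⟩ := h'
  obtain ⟨c, hc1, hcf⟩ := (h1'.mono Set.inter_subset_right).eq_const_smul hP hs (hU.inter hU') hc
    hne (h1.mono Set.inter_subset_left) (fun z hz => h2' z hz.2) (fun z hz => h2 z hz.1)
  let F : ℂ → C3 := fun z => if z ∈ U then f z else c • f' z
  have e1 : ∀ z ∈ U, F z = f z := fun z hz => if_pos hz
  have e2 : ∀ z ∈ U', F z = c • f' z := fun z hz => by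
    by_cases hzU : z ∈ U
    · rw [e1 z hzU, hcf z ⟨hzU, hz⟩]
    · exact if_neg hzU
  refine ⟨F, (h1.congr hU e1).union ((h1'.const_smul c).congr hU' e2), fun z hz => ?_⟩
  rcases hz with hz | hz
  · rw [e1 z hz, h2 z hz]
  · rw [e2 z hz, norm_smul, hc1, h2' z hz, one_mul]

lemma hasUnitLift_rect
    (hL : ∀ z u w f, P z f = f → (inner ℂ (dirDeriv u P z f) (dirDeriv w P z f)).im = 0)
    (R : ℝ) (hR : 0 ≤ R) : HasUnitLift P (Set.Ioo (-R) R ×ℂ Set.Ioo (-R) R) := by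
  have hopen : ∀ a b c d : ℝ, IsOpen (Set.Ioo a b ×ℂ Set.Ioo c d) := fun a b c d =>
    isOpen_Ioo.reProdIm isOpen_Ioo
  have hconv := convex_reProdIm_Ioo
  obtain ⟨δ, hδ, hcov⟩ : ∃ δ > 0, ∀ z ∈ Set.Icc (-R) R ×ℂ Set.Icc (-R) R,
      HasUnitLift P (Set.Ioo (z.re - δ) (z.re + δ) ×ℂ Set.Ioo (z.im - δ) (z.im + δ)) := by
    have hK : IsCompact (Set.Icc (-R) R ×ℂ Set.Icc (-R) R) := isCompact_Icc.reProdIm isCompact_Icc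
    -- The sets where `P z v` does not vanish cover the compact square, since `P z` is never zero. A
    -- Lebesgue number gives a uniform size on which one vector v yields a nonvanishing section.
    obtain ⟨δ, hδ, h⟩ := lebesgue_number_lemma_of_metric (c := fun v : C3 => {z | P z v ≠ 0}) hK
      (fun v => isOpen_ne_fun
        (hs.clm_apply_complex contDiff_const).continuous continuous_const)
      (fun z _ => by
        obtain ⟨v, hv, h⟩ := hP z
        refine Set.mem_iUnion.2 ⟨v, ?_⟩
        simp only [Set.mem_ofPred_eq]
        rw [h, inner_self_of_norm_eq_one hv, one_smul]
        rintro rfl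
        simp at hv)
    -- Half the Lebesgue number, because the norm is bounded by |re| + |im|.
    refine ⟨δ / 2, by positivity, fun z hz => ?_⟩
    obtain ⟨v, hv⟩ := h z hz
    refine exists_horizontal_of_section hP hs hL (hopen _ _ _ _) (hconv _ _ _ _) v fun y hy => ?_
    refine hv ?_
    rw [Metric.mem_ball, dist_eq_norm]
    obtain ⟨⟨h1, h2⟩, h3, h4⟩ := hy
    refine (Complex.norm_le_abs_re_add_abs_im _).trans_lt ?_
    rw [Complex.sub_re, Complex.sub_im]
    have := abs_lt.2 (⟨by linarith, by linarith⟩ : -(δ / 2) < y.re - z.re ∧ y.re - z.re < δ / 2)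
    have := abs_lt.2 (⟨by linarith, by linarith⟩ : -(δ / 2) < y.im - z.im ∧ y.im - z.im < δ / 2)
    linarith
  have hmono : ∀ a b c d a' b' c' d' : ℝ, a ≤ a' → b' ≤ b → c ≤ c' → d' ≤ d →
      HasUnitLift P (Set.Ioo a b ×ℂ Set.Ioo c d) →
      HasUnitLift P (Set.Ioo a' b' ×ℂ Set.Ioo c' d') := by
    intro a b c d a' b' c' d' h1 h2 h3 h4 h
    refine h.mono fun z hz => ?_
    exact ⟨Set.Ioo_subset_Ioo h1 h2 hz.1, Set.Ioo_subset_Ioo h3 h4 hz.2⟩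
  -- Small squares are first stacked into vertical strips, and the strips are then joined
  -- horizontally.
  have hcol : ∀ x ∈ Set.Icc (-R) R,
      HasUnitLift P (Set.Ioo (x - δ) (x + δ) ×ℂ Set.Ioo (-R) R) := by
    intro x hx
    refine glue_intervals (Q := fun c d => HasUnitLift P (Set.Ioo (x - δ) (x + δ) ×ℂ Set.Ioo c d))
      hδ hR (fun a b a' b' h1 h2 h => hmono _ _ _ _ _ _ _ _ le_rfl le_rfl h1 h2 h)
      (fun y hy => by simpa using hcov ⟨x, y⟩ ⟨hx, hy⟩) fun a a' b b' h1 h2 h3 h h' => ?_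
    refine (HasUnitLift.union hP hs (hopen _ _ _ _) (hopen _ _ _ _)
      ((hconv _ _ _ _).inter (hconv _ _ _ _)).isPreconnected ?_ h h').mono ?_
    · refine ⟨⟨x, (a' + b) / 2⟩, ⟨⟨?_, ?_⟩, ?_, ?_⟩, ⟨?_, ?_⟩, ?_, ?_⟩ <;> dsimp <;> linarith
    · rintro z ⟨hz1, hz2, hz3⟩
      rcases lt_or_ge z.im b with hb | hb
      · exact Or.inl ⟨hz1, hz2, hb⟩
      · exact Or.inr ⟨hz1, lt_of_lt_of_le h2 hb, hz3⟩
  refine glue_intervals (Q := fun a b => HasUnitLift P (Set.Ioo a b ×ℂ Set.Ioo (-R) R))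
      hδ hR (fun a b a' b' h1 h2 h => hmono _ _ _ _ _ _ _ _ h1 h2 le_rfl le_rfl h)
      hcol fun a a' b b' h1 h2 h3 h h' => ?_
  -- For R = 0 the strip is empty. Otherwise the overlap of two strips contains a point with
  -- imaginary part 0.
  rcases hR.eq_or_lt with rfl | hR'
  · exact ⟨fun _ => 0, by rintro z ⟨-, hz⟩; simp at hz, by rintro z ⟨-, hz⟩; simp at hz⟩
  refine (HasUnitLift.union hP hs (hopen _ _ _ _) (hopen _ _ _ _)
    ((hconv _ _ _ _).inter (hconv _ _ _ _)).isPreconnected ?_ h h').mono ?_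
  · refine ⟨⟨(a' + b) / 2, 0⟩, ⟨⟨?_, ?_⟩, ?_, ?_⟩, ⟨?_, ?_⟩, ?_, ?_⟩ <;> dsimp <;> linarith
  · rintro z ⟨⟨hz2, hz3⟩, hz1⟩
    rcases lt_or_ge z.re b with hb | hb
    · exact Or.inl ⟨⟨hz2, hb⟩, hz1⟩
    · exact Or.inr ⟨⟨lt_of_lt_of_le h2 hb, hz3⟩, hz1⟩

/-- A flat family of complex lines over `ℂ` has a global horizontal unit vector field. -/
theorem exists_global_unit_lift
    (hL : ∀ z u w f, P z f = f → (inner ℂ (dirDeriv u P z f) (dirDeriv w P z f)).im = 0) :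
    ∃ f, IsHorizontalOn P Set.univ f ∧ ∀ z, ‖f z‖ = 1 := by
  -- The summand 1 keeps z inside the open square number ⌈‖z‖⌉, and 0 inside all of them.
  let U : ℕ → Set ℂ := fun n => Set.Ioo (-((n : ℝ) + 1)) (n + 1) ×ℂ Set.Ioo (-((n : ℝ) + 1)) (n + 1)
  have hU : ∀ n, IsOpen (U n) := fun n => isOpen_Ioo.reProdIm isOpen_Ioo
  have hUc : ∀ n, IsPreconnected (U n) := fun n =>
    (convex_reProdIm_Ioo _ _ _ _).isPreconnected
  have h0 : ∀ n, (0 : ℂ) ∈ U n := fun n => by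
    have : (0 : ℝ) < n + 1 := by positivity
    refine ⟨⟨?_, ?_⟩, ?_, ?_⟩ <;> simp <;> linarith
  have hmono : ∀ n m, n ≤ m → U n ⊆ U m := fun n m hnm z hz => by
    have : (n : ℝ) ≤ m := by exact_mod_cast hnm
    obtain ⟨⟨h1, h2⟩, h3, h4⟩ := hz
    refine ⟨⟨?_, ?_⟩, ?_, ?_⟩ <;> linarith
  have hmem : ∀ z, z ∈ U ⌈‖z‖⌉₊ := fun z => by
    have h1 := (Complex.abs_re_le_norm z).trans (Nat.le_ceil ‖z‖)
    have h2 := (Complex.abs_im_le_norm z).trans (Nat.le_ceil ‖z‖)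
    rw [abs_le] at h1 h2
    refine ⟨⟨?_, ?_⟩, ?_, ?_⟩ <;> linarith
  obtain ⟨v, hv, hPv⟩ := hP 0
  have hfix : P 0 v = v := by rw [hPv, inner_self_of_norm_eq_one hv, one_smul]
  -- Prescribing the value v at 0 removes the unit constant, so lifts on nested squares agree and
  -- define one lift on ℂ.
  have hex : ∀ n, ∃ f, IsHorizontalOn P (U n) f ∧ (∀ z ∈ U n, ‖f z‖ = 1) ∧ f 0 = v := by
    intro n
    obtain ⟨f, h1, h2⟩ := hasUnitLift_rect hP hs hL ((n : ℝ) + 1) (by positivity)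
    have hv' : inner ℂ (f 0) v • f 0 = v := by
      rw [← (hP 0).apply_of_unit (h1 0 (h0 n)).1 (h2 0 (h0 n)), hfix]
    have hn : ‖inner ℂ (f 0) v‖ = 1 := by
      have := congrArg norm hv'
      rwa [norm_smul, h2 0 (h0 n), mul_one, hv] at this
    refine ⟨_, h1.const_smul (inner ℂ (f 0) v), fun z hz => ?_, hv'⟩
    rw [norm_smul, hn, one_mul, h2 z hz]
  choose f h1 h2 h3 using hex
  have heq : ∀ n m, n ≤ m → ∀ z ∈ U n, f m z = f n z := by
    intro n m hnm z hz
    obtain ⟨c, hc, h⟩ := (h1 n).eq_const_smul hP hs (hU n) (hUc n) ⟨0, h0 n⟩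
      ((h1 m).mono (hmono n m hnm)) (h2 n) (fun z hz => h2 m z (hmono n m hnm hz))
    have hc1 := h 0 (h0 n)
    rw [h3, h3] at hc1
    have hc2 : c = 1 := by
      have : (c - 1) • v = 0 := by rw [sub_smul, ← hc1, one_smul, sub_self]
      rcases smul_eq_zero.1 this with h | h
      · exact sub_eq_zero.1 h
      · rw [h] at hv; simp at hv
    rw [h z hz, hc2, one_smul]
  have hF : ∀ n, ∀ z ∈ U n, f ⌈‖z‖⌉₊ z = f n z := by
    intro n z hz
    rcases le_total n ⌈‖z‖⌉₊ with h | h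
    · exact heq _ _ h z hz
    · exact (heq _ _ h z (hmem z)).symm
  refine ⟨fun z => f ⌈‖z‖⌉₊ z, fun z _ => ?_, fun z => h2 _ z (hmem z)⟩
  exact (h1 ⌈‖z‖⌉₊).congr (hU _) (hF _) z (hmem z)

end

/-- Bootstrap: df = (dP)f is as regular as f, so each order of differentiability gives the next. -/
lemma IsHorizontalOn.contDiff {P : ℂ → C3 →L[ℂ] C3} (hs : ContDiff ℝ ∞ P) {f : ℂ → C3}
    (h : IsHorizontalOn P Set.univ f) :
    ContDiff ℝ ∞ f := by
  have hd : Differentiable ℝ f := fun z => (h z trivial).2.1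
  rw [contDiff_infty]
  intro n
  induction n with
  | zero => exact contDiff_zero.2 hd.continuous
  | succ n ih =>
    have : ((n + 1 : ℕ) : WithTop ℕ∞) = (n : WithTop ℕ∞) + 1 := by push_cast; rfl
    rw [this, contDiff_succ_iff_fderiv]
    refine ⟨hd, by simp, ?_⟩
    refine contDiff_clm_apply_iff.2 fun u => ?_
    have e : (fun z => fderiv ℝ f z u) = fun z => dirDeriv u P z (f z) :=
      funext fun z => (h z trivial).2.2 u
    rw [e]
    exact ((hs.dirDeriv u).of_le (by exact_mod_cast le_top)).clm_apply_complex ih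

/-! ### The geometry of `ℂP²` in terms of horizontal lifts -/

open InnerProductSpace in
/-- The tangent vector of `ℂP²` at the line `ℂ v` with horizontal lift `h` at the unit vector `v`. -/
def horTangent (v h : C3) : C3 →L[ℂ] C3 := rankOne ℂ h v + rankOne ℂ v h

lemma horTangent_apply (v h x : C3) :
    horTangent v h x = inner ℂ v x • h + inner ℂ h x • v := rfl

lemma complexStructCP2_apply (P A : C3 →L[ℂ] C3) (x : C3) :
    complexStructCP2 P A x = Complex.I • (A (P x) - P (A (P x)) - P (A (x - P x))) := rfl

lemma tanCP2_apply (P A : C3 →L[ℂ] C3) (x : C3) :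
    tanCP2 P A x = P (A (x - P x)) + (A (P x) - P (A (P x))) := rfl

/-- The two rank one parts contribute ⟨h, k⟩ and its conjugate to the trace, which explains the
factor ½ in the metric. Horizontal lifting is thus an isometry. -/
lemma innerEnd_horTangent {v h k : C3} (hv : ‖v‖ = 1) (hk : inner ℂ v k = 0) :
    innerEnd (horTangent v h) (horTangent v k) = innerC3 h k := by
  have hvv := inner_self_of_norm_eq_one hv
  have hadj : ContinuousLinearMap.adjoint (horTangent v h) = horTangent v h := by
    unfold horTangent
    rw [map_add, InnerProductSpace.adjoint_rankOne, InnerProductSpace.adjoint_rankOne, add_comm]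
  have hcomp : horTangent v h ∘L horTangent v k =
      InnerProductSpace.rankOne ℂ (horTangent v h k) v +
        InnerProductSpace.rankOne ℂ (horTangent v h v) k := by
    ext1 x
    change horTangent v h (horTangent v k x) =
      inner ℂ v x • horTangent v h k + inner ℂ k x • horTangent v h v
    rw [horTangent_apply v k, map_add, map_smul, map_smul]
  have hk' : inner ℂ k v = 0 := by rw [← inner_conj_symm, hk, map_zero]
  have e : (inner ℂ k h).re = (inner ℂ h k).re := by
    rw [← inner_conj_symm, Complex.conj_re]
  rw [innerEnd, hadj, hcomp, ContinuousLinearMap.toLinearMap_add, map_add,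
    InnerProductSpace.trace_rankOne, InnerProductSpace.trace_rankOne, innerC3]
  simp only [horTangent_apply, hk, hvv, inner_add_right, inner_smul_right, hk', zero_smul, zero_add,
    mul_one, one_smul, mul_zero, add_zero, Complex.add_re, e]
  ring

/-- J multiplies the horizontal lift by i, and Re⟨ih, k⟩ = Im⟨h, k⟩ as the product is conjugate
linear on the left. -/
lemma kahlerCP2_horTangent {P : C3 →L[ℂ] C3} {v h k : C3} (hv : ‖v‖ = 1)
    (hP : ∀ x, P x = inner ℂ v x • v) (hh : inner ℂ v h = 0) (hk : inner ℂ v k = 0) :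
    kahlerCP2 P (horTangent v h) (horTangent v k) = (inner ℂ h k).im := by
  have hvv := inner_self_of_norm_eq_one hv
  have hh' : inner ℂ h v = 0 := by rw [← inner_conj_symm, hh, map_zero]
  have hJ : complexStructCP2 P (horTangent v h) = horTangent v (Complex.I • h) := by
    ext1 x
    simp only [complexStructCP2_apply, hP, horTangent_apply, map_sub, map_smul,
      inner_smul_right, inner_add_right, inner_sub_right, hh, hh', hvv, inner_smul_left,
      Complex.conj_I]
    module
  rw [kahlerCP2, hJ, innerEnd_horTangent hv hk, innerC3, inner_smul_left, Complex.conj_I]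
  simp

/-! ### Minimal Legendrian maps of the plane -/

/-- `f : ℂ → S⁵` is a smooth minimal Legendrian immersion. -/
structure IsMinLegPlane (f : ℂ → C3) : Prop where
  smooth : ContDiff ℝ ∞ f
  norm_eq : ∀ z, ‖f z‖ = 1
  leg : ∀ z u, inner ℂ (f z) (dirDeriv u f z) = 0
  immersed : IsImmersed f
  minimal : IsMinimalImm innerC3 tanS5 f

section

variable {P : ℂ → C3 →L[ℂ] C3} (hP : ∀ z, IsLineProjection (P z)) (hs : ContDiff ℝ ∞ P)

include hP hs

/-- Self-adjointness and P² = P determine dP from its value on a unit vector of the line. -/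
lemma dirDeriv_proj_eq_horTangent {z : ℂ} {v : C3} (hv : ‖v‖ = 1) (hf : P z v = v) (u : ℂ) :
    dirDeriv u P z = horTangent v (dirDeriv u P z v) := by
  ext1 x
  rw [dirDeriv_proj_idem hP hs.differentiable_infty, (hP z).apply_of_unit hf hv,
    (hP z).apply_of_unit hf hv, map_smul, horTangent_apply,
    dirDeriv_proj_symm hP hs.differentiable_infty, add_comm]

/-- Curvature equals the Kähler form: clear for a unit vector of the line, and in general both
derivatives scale with f by a real factor. -/
lemma flat_of_lagrangian
    (hL : ∀ z u v, kahlerCP2 (P z) (fderiv ℝ P z u) (fderiv ℝ P z v) = 0)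
    (z u w : ℂ) (f : C3) (hf : P z f = f) :
    (inner ℂ (dirDeriv u P z f) (dirDeriv w P z f)).im = 0 := by
  by_cases hf0 : f = 0
  · simp [hf0]
  have hn : ‖f‖ ≠ 0 := norm_ne_zero_iff.2 hf0
  set v : C3 := (‖f‖⁻¹ : ℂ) • f with hv
  have hv1 : ‖v‖ = 1 := by rw [hv, norm_smul]; simp [hn]
  have hPv : P z v = v := by rw [hv, map_smul, hf]
  have h := hL z u w
  change kahlerCP2 (P z) (dirDeriv u P z) (dirDeriv w P z) = 0 at h
  rw [dirDeriv_proj_eq_horTangent hP hs hv1 hPv u, dirDeriv_proj_eq_horTangent hP hs hv1 hPv w,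
    kahlerCP2_horTangent hv1 ((hP z).apply_of_unit hPv hv1)
      (inner_dirDeriv_proj_eq_zero hP hs hPv hPv u)
      (inner_dirDeriv_proj_eq_zero hP hs hPv hPv w), hv, map_smul, map_smul, inner_smul_left,
    inner_smul_right, ← mul_assoc] at h
  have e : (starRingEnd ℂ) (‖f‖⁻¹ : ℂ) * (‖f‖⁻¹ : ℂ) = ((‖f‖⁻¹ * ‖f‖⁻¹ : ℝ) : ℂ) := by
    push_cast; simp
  rw [e, Complex.im_ofReal_mul] at h
  exact (mul_eq_zero.1 h).resolve_left (by positivity)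

variable {f : ℂ → C3} (hf : IsHorizontalOn P Set.univ f) (h1 : ∀ z, ‖f z‖ = 1)

include hf h1

lemma dirDeriv_proj_of_horizontal (u z : ℂ) :
    dirDeriv u P z = horTangent (f z) (dirDeriv u f z) := by
  rw [dirDeriv_proj_eq_horTangent hP hs (h1 z) (hf z trivial).1, (hf z trivial).2.2]

omit h1 in
lemma horizontal_legendrian (z u : ℂ) : inner ℂ (f z) (dirDeriv u f z) = 0 := by
  obtain ⟨e1, -, e3⟩ := hf z trivial
  rw [e3]
  exact inner_dirDeriv_proj_eq_zero hP hs e1 e1 u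

lemma innerEnd_dirDeriv (z u v : ℂ) :
    innerEnd (fderiv ℝ P z u) (fderiv ℝ P z v) = innerC3 (fderiv ℝ f z u) (fderiv ℝ f z v) := by
  change innerEnd (dirDeriv u P z) (dirDeriv v P z) = _
  rw [dirDeriv_proj_of_horizontal hP hs hf h1, dirDeriv_proj_of_horizontal hP hs hf h1,
    innerEnd_horTangent (h1 z) (horizontal_legendrian hP hs hf z v)]
  rfl

lemma isConformalFrame_horizontal (z u v : ℂ) :
    IsConformalFrame innerEnd P z u v ↔ IsConformalFrame innerC3 f z u v := by
  simp only [IsConformalFrame, innerEnd_dirDeriv hP hs hf h1]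

/-- The minimality equation of ℂP², an identity of endomorphisms, becomes that of S⁵ when it is
evaluated on the vector f(z). -/
lemma isMinLegPlane_of_horizontal (hi : IsImmersed P) (hm : IsMinimalImm innerEnd tanCP2 P) :
    IsMinLegPlane f := by
  have hfs : ContDiff ℝ ∞ f := hf.contDiff hs
  have hleg := horizontal_legendrian hP hs hf
  refine ⟨hfs, h1, hleg, fun z u v huv => ?_, fun z u v huv => ?_⟩
  · refine hi z ?_
    change dirDeriv u P z = dirDeriv v P z
    rw [dirDeriv_proj_of_horizontal hP hs hf h1, dirDeriv_proj_of_horizontal hP hs hf h1]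
    congr 1
  · obtain ⟨w, hw⟩ := hm z u v ((isConformalFrame_horizontal hP hs hf h1 z u v).2 huv)
    refine ⟨w, ?_⟩
    have hPf := (hf z trivial).1
    -- From f_u = P_u f one gets f_uu = P_uu f + P_u f_u, and P_u f_u = ⟨f_u, f_u⟩ f.
    have hu : ∀ u, dirDeriv u (dirDeriv u P) z (f z) = dirDeriv u (dirDeriv u f) z -
        inner ℂ (dirDeriv u f z) (dirDeriv u f z) • f z := by
      intro u
      have h := dirDeriv_congr (fun z => (hf z trivial).2.2 u) u z
      rw [dirDeriv_apply_complex ((hs.dirDeriv u).differentiable_infty z)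
        (hfs.differentiable_infty z), dirDeriv_proj_of_horizontal hP hs hf h1, horTangent_apply,
        hleg, zero_smul, zero_add] at h
      rw [h, add_sub_cancel_left]
    -- The component of f_uu along f is real, so removing its projection to ℂf or only to ℝf gives
    -- the same vector.
    have hin : ∀ u, inner ℂ (f z) (dirDeriv u (dirDeriv u f) z) =
        -inner ℂ (dirDeriv u f z) (dirDeriv u f z) := by
      intro u
      have h := dirDeriv_congr (fun z => hleg z u) u z
      rw [dirDeriv_inner hfs.differentiable_infty (hfs.dirDeriv u).differentiable_infty,
        dirDeriv_const] at h
      exact eq_neg_of_add_eq_zero_left h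
    have hw' := congrArg (fun A : C3 →L[ℂ] C3 => A (f z)) hw
    change dirDeriv w P z (f z) = tanCP2 (P z)
      (dirDeriv u (dirDeriv u P) z + dirDeriv v (dirDeriv v P) z) (f z) at hw'
    rw [← (hf z trivial).2.2 w] at hw'
    change dirDeriv w f z = tanS5 (f z) (dirDeriv u (dirDeriv u f) z + dirDeriv v (dirDeriv v f) z)
    rw [hw']
    have hre : ∀ x : C3, ((inner ℂ x x).re : ℂ) = inner ℂ x x := fun x => inner_self_ofReal_re x
    have h11 := inner_self_of_norm_eq_one (h1 z)
    rw [tanCP2_apply, hPf, sub_self, map_zero, map_zero, zero_add]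
    change dirDeriv u (dirDeriv u P) z (f z) + dirDeriv v (dirDeriv v P) z (f z) -
      P z (dirDeriv u (dirDeriv u P) z (f z) + dirDeriv v (dirDeriv v P) z (f z)) = _
    simp only [tanS5, innerC3, hu,
      (hP z).apply_of_unit hPf (h1 z), inner_add_right, inner_sub_right, inner_smul_right, hin,
      h11, Complex.add_re, Complex.neg_re]
    rw [← Complex.coe_smul]
    push_cast
    rw [hre, hre]
    module

end

/-! ### Determinants and unitary matrices in terms of columns -/

/-- The matrix with columns `a, b, c`. -/
def colMat (a b c : C3) : Mat3 := Matrix.of fun i j => (![a, b, c] j) i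

lemma colVec_colMat (a b c : C3) :
    colVec (colMat a b c) 0 = a ∧ colVec (colMat a b c) 1 = b ∧ colVec (colMat a b c) 2 = c :=
  ⟨rfl, rfl, rfl⟩

lemma C3.inner_eq (x y : C3) :
    inner ℂ x y = (starRingEnd ℂ) (x 0) * y 0 + (starRingEnd ℂ) (x 1) * y 1 +
      (starRingEnd ℂ) (x 2) * y 2 := by
  rw [PiLp.inner_apply, Fin.sum_univ_three]
  simp [mul_comm]

lemma conjTranspose_mul_apply (g k : Mat3) (i j : Fin 3) :
    (g.conjTranspose * k) i j = inner ℂ (colVec g i) (colVec k j) := by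
  rw [C3.inner_eq, Matrix.mul_apply, Fin.sum_univ_three]
  rfl

/-- The determinant of three vectors of `ℂ³`. -/
def det3 (a b c : C3) : ℂ := (colMat a b c).det

lemma det3_eq (a b c : C3) : det3 a b c =
    a 0 * (b 1 * c 2 - c 1 * b 2) - b 0 * (a 1 * c 2 - c 1 * a 2) +
      c 0 * (a 1 * b 2 - b 1 * a 2) := by
  rw [det3, Matrix.det_fin_three]
  simp [colMat]
  ring

/-- From det(A*) det(A') = det(A*A'): products of determinants are computed from Hermitian products,
which the geometry supplies. -/
lemma conj_det3_mul_det3 (a b c a' b' c' : C3) :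
    (starRingEnd ℂ) (det3 a b c) * det3 a' b' c' =
      Matrix.det !![inner ℂ a a', inner ℂ a b', inner ℂ a c';
        inner ℂ b a', inner ℂ b b', inner ℂ b c';
        inner ℂ c a', inner ℂ c b', inner ℂ c c'] := by
  rw [det3, det3, starRingEnd_apply, ← Matrix.det_conjTranspose, ← Matrix.det_mul]
  congr 1
  ext i j
  rw [conjTranspose_mul_apply]
  fin_cases i <;> fin_cases j <;> rfl

lemma dirDeriv_mul {c d : ℂ → ℂ} (hc : Differentiable ℝ c) (hd : Differentiable ℝ d) (u z : ℂ) :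
    dirDeriv u (fun y => c y * d y) z = c z * dirDeriv u d z + dirDeriv u c z * d z :=
  dirDeriv_smul hc hd u z

lemma dirDeriv_coord {a : ℂ → C3} (ha : Differentiable ℝ a) (i : Fin 3) (u z : ℂ) :
    dirDeriv u (fun y => a y i) z = dirDeriv u a z i :=
  dirDeriv_clm (((EuclideanSpace.proj i : C3 →L[ℂ] ℂ)).restrictScalars ℝ) ha u z

lemma Differentiable.coord {a : ℂ → C3} (ha : Differentiable ℝ a) (i : Fin 3) :
    Differentiable ℝ fun y => a y i :=
  ((EuclideanSpace.proj i : C3 →L[ℂ] ℂ).restrictScalars ℝ).differentiable.comp ha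

lemma ContDiff.coord {a : ℂ → C3} {n : WithTop ℕ∞} (ha : ContDiff ℝ n a) (i : Fin 3) :
    ContDiff ℝ n fun y => a y i :=
  ((EuclideanSpace.proj i : C3 →L[ℂ] ℂ).restrictScalars ℝ).contDiff.comp ha

lemma Differentiable.det3 {a b c : ℂ → C3} (ha : Differentiable ℝ a) (hb : Differentiable ℝ b)
    (hc : Differentiable ℝ c) : Differentiable ℝ fun y => det3 (a y) (b y) (c y) := by
  have := ha.coord
  have := hb.coord
  have := hc.coord
  simp only [det3_eq]
  fun_prop

lemma dirDeriv_det3 {a b c : ℂ → C3} (ha : Differentiable ℝ a) (hb : Differentiable ℝ b)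
    (hc : Differentiable ℝ c) (u z : ℂ) :
    dirDeriv u (fun y => det3 (a y) (b y) (c y)) z = det3 (dirDeriv u a z) (b z) (c z) +
      det3 (a z) (dirDeriv u b z) (c z) + det3 (a z) (b z) (dirDeriv u c z) := by
  have ha' := ha.coord
  have hb' := hb.coord
  have hc' := hc.coord
  simp only [det3_eq]
  rw [dirDeriv_add (by fun_prop) (by fun_prop), dirDeriv_sub (by fun_prop) (by fun_prop),
    dirDeriv_mul (by fun_prop) (by fun_prop), dirDeriv_mul (by fun_prop) (by fun_prop),
    dirDeriv_mul (by fun_prop) (by fun_prop), dirDeriv_sub (by fun_prop) (by fun_prop),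
    dirDeriv_sub (by fun_prop) (by fun_prop), dirDeriv_sub (by fun_prop) (by fun_prop)]
  rw [dirDeriv_mul (hb' 1) (hc' 2), dirDeriv_mul (hc' 1) (hb' 2), dirDeriv_mul (ha' 1) (hc' 2),
    dirDeriv_mul (hc' 1) (ha' 2), dirDeriv_mul (ha' 1) (hb' 2), dirDeriv_mul (hb' 1) (ha' 2)]
  simp only [dirDeriv_coord ha, dirDeriv_coord hb, dirDeriv_coord hc]
  ring

lemma dirDeriv_eq_coord (f : ℂ → C3) (u z : ℂ) :
    dirDeriv u f z = (u.re : ℂ) • dirDeriv 1 f z + (u.im : ℂ) • dirDeriv Complex.I f z := by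
  conv_lhs => rw [← Complex.re_add_im u]
  rw [dirDeriv_add_dir, ← mul_one (u.re : ℂ), dirDeriv_smul_dir, dirDeriv_smul_dir,
    Complex.coe_smul, mul_one, Complex.coe_smul]

lemma innerC3_comm (x y : C3) : innerC3 x y = innerC3 y x := by
  rw [innerC3, innerC3, ← inner_conj_symm, Complex.conj_re]

/-! ### First and second order geometry of minimal Legendrian maps -/

/-- The determinant of `f` and two directional derivatives. -/
lemma det3_dirDeriv (f : ℂ → C3) (z u v : ℂ) : det3 (f z) (dirDeriv u f z) (dirDeriv v f z) =
    ((u.re * v.im - u.im * v.re : ℝ) : ℂ) *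
      det3 (f z) (dirDeriv 1 f z) (dirDeriv Complex.I f z) := by
  rw [dirDeriv_eq_coord f u, dirDeriv_eq_coord f v]
  simp only [det3_eq, PiLp.add_apply, PiLp.smul_apply, smul_eq_mul]
  push_cast
  ring

lemma IsConformalFrame.ne_zero {f : ℂ → C3} {z u v : ℂ} (hc : IsConformalFrame innerC3 f z u v) :
    u ≠ 0 := by
  rintro rfl
  have := hc.2.2
  simp at this

/-- The cubic form `Im ⟨f_a, f_bc⟩`. -/
def cubicForm (f : ℂ → C3) (z a b c : ℂ) : ℝ :=
  (inner ℂ (dirDeriv a f z) (dirDeriv c (dirDeriv b f) z)).im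

namespace IsMinLegPlane

variable {f : ℂ → C3} (h : IsMinLegPlane f)

include h

lemma diff : Differentiable ℝ f := h.smooth.differentiable_infty

lemma diff_dir (u : ℂ) : Differentiable ℝ (dirDeriv u f) :=
  (h.smooth.dirDeriv u).differentiable_infty

lemma inner_self (z : ℂ) : inner ℂ (f z) (f z) = 1 := inner_self_of_norm_eq_one (h.norm_eq z)

lemma leg' (z u : ℂ) : inner ℂ (dirDeriv u f z) (f z) = 0 := by
  rw [← inner_conj_symm, h.leg, map_zero]

lemma inner_second (z u w : ℂ) : inner ℂ (f z) (dirDeriv w (dirDeriv u f) z) =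
    -inner ℂ (dirDeriv w f z) (dirDeriv u f z) := by
  have e := dirDeriv_congr (fun z => h.leg z u) w z
  rw [dirDeriv_inner h.diff (h.diff_dir u), dirDeriv_const] at e
  exact eq_neg_of_add_eq_zero_left e

/-- ⟨f_v, f_u⟩ = -⟨f, f_uv⟩ is symmetric in u and v, hence real: contact planes integrate only to
Lagrangian tangent planes. -/
lemma inner_tangent_im (z u v : ℂ) : (inner ℂ (dirDeriv u f z) (dirDeriv v f z)).im = 0 := by
  have e1 := h.inner_second z u v
  rw [dirDeriv_comm h.smooth, h.inner_second z v u, neg_inj] at e1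
  rw [← Complex.conj_eq_iff_im, inner_conj_symm, e1]

lemma inner_tangent (z u v : ℂ) : inner ℂ (dirDeriv u f z) (dirDeriv v f z) =
    (innerC3 (dirDeriv u f z) (dirDeriv v f z) : ℂ) :=
  Complex.ext rfl (by rw [h.inner_tangent_im, Complex.ofReal_im])

lemma cubic_comm_right (z a b c : ℂ) : cubicForm f z a b c = cubicForm f z a c b := by
  rw [cubicForm, cubicForm, dirDeriv_comm h.smooth]

/-- The derivative of Im⟨f_a, f_b⟩ = 0 in the direction c. With equality of mixed derivatives it
makes the cubic form totally symmetric. -/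
lemma cubic_comm_left (z a b c : ℂ) : cubicForm f z a b c = cubicForm f z b a c := by
  have hd : Differentiable ℝ fun y => inner ℂ (dirDeriv a f y) (dirDeriv b f y) :=
    (contDiff_inner_C3 (h.smooth.dirDeriv a) (h.smooth.dirDeriv b)).differentiable_infty
  have e := dirDeriv_congr (fun z => h.inner_tangent_im z a b) c z
  have e2 := dirDeriv_clm Complex.imCLM hd c z
  simp only [Complex.imCLM_apply] at e2
  rw [e2, dirDeriv_inner (h.diff_dir a) (h.diff_dir b), dirDeriv_const, Complex.add_im] at e
  have e3 : (inner ℂ (dirDeriv c (dirDeriv a f) z) (dirDeriv b f z)).im = -cubicForm f z b a c := by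
    rw [cubicForm, ← inner_conj_symm, Complex.conj_im]
  rw [e3] at e
  rw [cubicForm]
  linarith

/-- The definition of minimality leaves a tangential term f_w free. The radial part is forced by |f|
= 1. -/
lemma mean_curvature {z u v : ℂ} (hc : IsConformalFrame innerC3 f z u v) :
    ∃ w, dirDeriv u (dirDeriv u f) z + dirDeriv v (dirDeriv v f) z = dirDeriv w f z -
      (2 * innerC3 (dirDeriv u f z) (dirDeriv u f z) : ℂ) • f z := by
  obtain ⟨w, hw⟩ := h.minimal z u v hc
  refine ⟨w, ?_⟩
  change dirDeriv w f z = tanS5 (f z) (dirDeriv u (dirDeriv u f) z + dirDeriv v (dirDeriv v f) z)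
    at hw
  have h2 : innerC3 (dirDeriv u f z) (dirDeriv u f z) = innerC3 (dirDeriv v f z) (dirDeriv v f z) :=
    hc.1
  rw [hw, tanS5, innerC3, inner_add_right, h.inner_second, h.inner_second, h.inner_tangent,
    h.inner_tangent, ← h2, ← Complex.coe_smul]
  simp only [Complex.add_re, Complex.neg_re, Complex.ofReal_re]
  push_cast
  module

/-- f_uu + f_vv is a real tangent vector plus a multiple of f, so its product with f_x has no
imaginary part. -/
lemma cubic_trace {z u v : ℂ} (hc : IsConformalFrame innerC3 f z u v) (x : ℂ) :
    cubicForm f z x u u + cubicForm f z x v v = 0 := by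
  obtain ⟨w, hw⟩ := h.mean_curvature hc
  rw [cubicForm, cubicForm, ← Complex.add_im, ← inner_add_right, hw, inner_sub_right,
    inner_smul_right, h.leg', mul_zero, sub_zero, h.inner_tangent_im]

lemma inner_pos {z u : ℂ} (hu : u ≠ 0) : 0 < innerC3 (dirDeriv u f z) (dirDeriv u f z) := by
  have hne : dirDeriv u f z ≠ 0 := fun h0 => hu (h.immersed z (h0.trans (map_zero _).symm))
  have : innerC3 (dirDeriv u f z) (dirDeriv u f z) = ‖dirDeriv u f z‖ ^ 2 := by
    have e := inner_self_eq_norm_sq (𝕜 := ℂ) (dirDeriv u f z)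
    exact e
  rw [this]
  have := norm_pos_iff.2 hne
  positivity

lemma gram_of_conformal {z u v : ℂ} (hc : IsConformalFrame innerC3 f z u v) :
    inner ℂ (dirDeriv v f z) (dirDeriv v f z) = inner ℂ (dirDeriv u f z) (dirDeriv u f z) ∧
    inner ℂ (dirDeriv u f z) (dirDeriv v f z) = 0 ∧
    inner ℂ (dirDeriv v f z) (dirDeriv u f z) = 0 := by
  have h2 : innerC3 (dirDeriv u f z) (dirDeriv u f z) = innerC3 (dirDeriv v f z) (dirDeriv v f z) :=
    hc.1
  have h3 : innerC3 (dirDeriv u f z) (dirDeriv v f z) = 0 := hc.2.1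
  rw [h.inner_tangent, h.inner_tangent, h.inner_tangent, h.inner_tangent, h2, h3,
    innerC3_comm (dirDeriv v f z) (dirDeriv u f z), h3]
  simp

/-- In a conformal frame the derivative of the phase is, up to a real factor, the trace of the cubic
form, i.e. the mean curvature one-form. -/
lemma phase_deriv {z u v : ℂ} (hc : IsConformalFrame innerC3 f z u v) (w : ℂ) :
    ((starRingEnd ℂ) (det3 (f z) (dirDeriv 1 f z) (dirDeriv Complex.I f z)) *
      dirDeriv w (fun y => det3 (f y) (dirDeriv 1 f y) (dirDeriv Complex.I f y)) z).im = 0 := by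
  set k : ℝ := u.re * v.im - u.im * v.re with hk
  have hk0 : 0 < k := hc.2.2
  set D := fun y => det3 (f y) (dirDeriv 1 f y) (dirDeriv Complex.I f y) with hD
  have hDd : Differentiable ℝ D := h.diff.det3 (h.diff_dir _) (h.diff_dir _)
  obtain ⟨g1, g2, g3⟩ := h.gram_of_conformal hc
  -- The directions u, v are held fixed while differentiating. Conformality is needed at the point z
  -- only.
  have e1 : dirDeriv w (fun y => det3 (f y) (dirDeriv u f y) (dirDeriv v f y)) z =
      k * dirDeriv w D z := by
    rw [dirDeriv_congr (fun y => det3_dirDeriv f y u v) w z,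
      dirDeriv_mul (differentiable_const _) hDd, dirDeriv_const, zero_mul, add_zero]
  have e2 : ((starRingEnd ℂ) (det3 (f z) (dirDeriv u f z) (dirDeriv v f z)) *
      dirDeriv w (fun y => det3 (f y) (dirDeriv u f y) (dirDeriv v f y)) z).im = 0 := by
    rw [dirDeriv_det3 h.diff (h.diff_dir _) (h.diff_dir _), mul_add, mul_add, conj_det3_mul_det3,
      conj_det3_mul_det3, conj_det3_mul_det3]
    simp only [Matrix.det_fin_three, Matrix.of_apply, Matrix.cons_val', Matrix.cons_val_zero,
      Matrix.cons_val_one, Matrix.cons_val, g1, g2, g3, h.leg, h.leg', h.inner_self]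
    simp only [h.inner_tangent z u u]
    have t := h.cubic_trace hc w
    rw [h.cubic_comm_left z w u u, h.cubic_comm_left z w v v, h.cubic_comm_right z u w u,
      h.cubic_comm_right z v w v, cubicForm, cubicForm] at t
    set ρ := innerC3 (dirDeriv u f z) (dirDeriv u f z)
    rw [← Complex.add_im] at t
    have : ∀ a b : ℂ, (a + b).im = 0 → ((a + b) * (ρ : ℂ)).im = 0 := fun a b hab => by
      rw [Complex.im_mul_ofReal, hab, zero_mul]
    rw [← this _ _ t]
    congr 1
    ring
  rw [e1, det3_dirDeriv, map_mul, Complex.conj_ofReal] at e2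
  have e3 : (k : ℂ) * (starRingEnd ℂ) (D z) * (k * dirDeriv w D z) =
      ((k * k : ℝ) : ℂ) * ((starRingEnd ℂ) (D z) * dirDeriv w D z) := by push_cast; ring
  erw [e3] at e2
  rw [Complex.im_ofReal_mul] at e2
  exact (mul_eq_zero.1 e2).resolve_left (by positivity)

end IsMinLegPlane

/-! ### The conformal structure of the induced metric -/

/-- The direction which makes up, with the direction `1`, a conformal frame for the metric induced
by `f`. -/
def confDir (f : ℂ → C3) (z : ℂ) : ℂ :=
  let E := innerC3 (dirDeriv 1 f z) (dirDeriv 1 f z)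
  let F := innerC3 (dirDeriv 1 f z) (dirDeriv Complex.I f z)
  let G := innerC3 (dirDeriv Complex.I f z) (dirDeriv Complex.I f z)
  ((-F / √(E * G - F ^ 2) : ℝ) : ℂ) + ((E / √(E * G - F ^ 2) : ℝ) : ℂ) * Complex.I

lemma innerC3_add_right (x y z : C3) : innerC3 x (y + z) = innerC3 x y + innerC3 x z := by
  simp [innerC3]

lemma innerC3_smul_right (x y : C3) (a : ℝ) : innerC3 x ((a : ℂ) • y) = a * innerC3 x y := by
  simp [innerC3]

lemma innerC3_add_left (x y z : C3) : innerC3 (x + y) z = innerC3 x z + innerC3 y z := by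
  simp [innerC3]

lemma innerC3_smul_left (x y : C3) (a : ℝ) : innerC3 ((a : ℂ) • x) y = a * innerC3 x y := by
  simp [innerC3]

lemma dirDeriv_comb (f : ℂ → C3) (a b : ℝ) (u v z : ℂ) :
    dirDeriv (a * u + b * v) f z = (a : ℂ) • dirDeriv u f z + (b : ℂ) • dirDeriv v f z := by
  rw [dirDeriv_add_dir, dirDeriv_smul_dir, dirDeriv_smul_dir, Complex.coe_smul, Complex.coe_smul]

namespace IsMinLegPlane

variable {f : ℂ → C3} (h : IsMinLegPlane f)

include h

lemma gram_pos (z : ℂ) : 0 < innerC3 (dirDeriv 1 f z) (dirDeriv 1 f z) *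
    innerC3 (dirDeriv Complex.I f z) (dirDeriv Complex.I f z) -
      innerC3 (dirDeriv 1 f z) (dirDeriv Complex.I f z) ^ 2 := by
  have hE := h.inner_pos (z := z) one_ne_zero
  set E := innerC3 (dirDeriv 1 f z) (dirDeriv 1 f z) with hEdef
  set F := innerC3 (dirDeriv 1 f z) (dirDeriv Complex.I f z) with hF
  set G := innerC3 (dirDeriv Complex.I f z) (dirDeriv Complex.I f z) with hG
  -- In the direction -F · 1 + E · i the metric takes the value E (EG - F²).
  have hu : ((-F : ℝ) : ℂ) * 1 + (E : ℂ) * Complex.I ≠ 0 := fun h0 => by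
    have := congrArg Complex.im h0
    simp at this
    exact hE.ne' this
  have hp := h.inner_pos (z := z) hu
  rw [dirDeriv_comb] at hp
  simp only [innerC3_add_right, innerC3_add_left, innerC3_smul_left, innerC3_smul_right,
    innerC3_comm (dirDeriv Complex.I f z) (dirDeriv 1 f z)] at hp
  rw [← hEdef, ← hF, ← hG] at hp
  have : 0 < E * (E * G - F ^ 2) := by nlinarith
  exact (mul_pos_iff_of_pos_left hE).1 this

lemma isConformalFrame_confDir (z : ℂ) : IsConformalFrame innerC3 f z 1 (confDir f z) := by
  have hE := h.inner_pos (z := z) one_ne_zero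
  have hg := h.gram_pos z
  change innerC3 (dirDeriv 1 f z) (dirDeriv 1 f z) =
    innerC3 (dirDeriv (confDir f z) f z) (dirDeriv (confDir f z) f z) ∧
    innerC3 (dirDeriv 1 f z) (dirDeriv (confDir f z) f z) = 0 ∧ _
  rw [dirDeriv_eq_coord f (confDir f z)]
  simp only [innerC3_add_right, innerC3_add_left, innerC3_smul_left, innerC3_smul_right,
    innerC3_comm (dirDeriv Complex.I f z) (dirDeriv 1 f z), confDir]
  set E := innerC3 (dirDeriv 1 f z) (dirDeriv 1 f z)
  set F := innerC3 (dirDeriv 1 f z) (dirDeriv Complex.I f z)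
  set G := innerC3 (dirDeriv Complex.I f z) (dirDeriv Complex.I f z)
  have hΔ : 0 < √(E * G - F ^ 2) := Real.sqrt_pos.2 hg
  have hΔ2 : √(E * G - F ^ 2) ^ 2 = E * G - F ^ 2 := Real.sq_sqrt hg.le
  set Δ := √(E * G - F ^ 2)
  simp only [Complex.add_re, Complex.add_im, Complex.ofReal_re, Complex.ofReal_im,
    Complex.re_ofReal_mul, Complex.im_ofReal_mul, Complex.I_re, Complex.I_im, Complex.one_re,
    Complex.one_im, mul_zero, mul_one, add_zero, zero_add, zero_mul, sub_zero, one_mul]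
  refine ⟨?_, ?_, by positivity⟩
  · field_simp
    rw [hΔ2]; ring
  · ring

lemma contDiff_inner_dir (u v : ℂ) :
    ContDiff ℝ ∞ fun z => innerC3 (dirDeriv u f z) (dirDeriv v f z) :=
  Complex.reCLM.contDiff.comp (contDiff_inner_C3 (h.smooth.dirDeriv u) (h.smooth.dirDeriv v))

lemma contDiff_confDir : ContDiff ℝ ∞ (confDir f) := by
  have hE := h.contDiff_inner_dir 1 1
  have hF := h.contDiff_inner_dir 1 Complex.I
  have hG := h.contDiff_inner_dir Complex.I Complex.I
  have hΔ := ((hE.mul hG).sub (hF.pow 2)).sqrt fun z => (h.gram_pos z).ne'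
  have hΔ0 := fun z => (Real.sqrt_pos.2 (h.gram_pos z)).ne'
  exact (Complex.ofRealCLM.contDiff.comp (hF.neg.div hΔ hΔ0)).add
    ((Complex.ofRealCLM.contDiff.comp (hE.div hΔ hΔ0)).mul contDiff_const)

/-- Two bases that are orthogonal with equal lengths and have the same orientation differ by a
rotation and a scaling. -/
lemma conformal_rotation {z u v u' v' : ℂ} (hc : IsConformalFrame innerC3 f z u v)
    (hc' : IsConformalFrame innerC3 f z u' v') :
    ∃ a b : ℝ, u' = a * u + b * v ∧ v' = ((-b : ℝ) : ℂ) * u + a * v := by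
  obtain ⟨h1, h2, h3⟩ := hc
  obtain ⟨h1', h2', h3'⟩ := hc'
  have hcoord : ∀ x : ℂ, ∃ a b : ℝ, x = a * u + b * v := by
    intro x
    set k := u.re * v.im - u.im * v.re with hk
    refine ⟨(x.re * v.im - x.im * v.re) / k, (u.re * x.im - u.im * x.re) / k, ?_⟩
    apply Complex.ext
    · rw [Complex.add_re, Complex.re_ofReal_mul, Complex.re_ofReal_mul]
      field_simp
      rw [hk]; ring
    · rw [Complex.add_im, Complex.im_ofReal_mul, Complex.im_ofReal_mul]
      field_simp
      rw [hk]; ring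
  obtain ⟨a, b, rfl⟩ := hcoord u'
  obtain ⟨c, d, rfl⟩ := hcoord v'
  have hu : u ≠ 0 := by
    rintro rfl
    simp at h3
  have hρ := h.inner_pos (z := z) hu
  change innerC3 (dirDeriv u f z) (dirDeriv u f z) = innerC3 (dirDeriv v f z) (dirDeriv v f z)
    at h1
  change innerC3 (dirDeriv u f z) (dirDeriv v f z) = 0 at h2
  change innerC3 (dirDeriv _ f z) (dirDeriv _ f z) = innerC3 (dirDeriv _ f z) (dirDeriv _ f z)
    at h1'
  change innerC3 (dirDeriv _ f z) (dirDeriv _ f z) = 0 at h2'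
  rw [dirDeriv_comb, dirDeriv_comb] at h1' h2'
  simp only [innerC3_add_right, innerC3_add_left, innerC3_smul_left, innerC3_smul_right,
    innerC3_comm (dirDeriv v f z) (dirDeriv u f z), h2, ← h1] at h1' h2'
  simp only [Complex.add_re, Complex.add_im, Complex.re_ofReal_mul, Complex.im_ofReal_mul] at h3'
  set ρ := innerC3 (dirDeriv u f z) (dirDeriv u f z)
  have e1 : a ^ 2 + b ^ 2 = c ^ 2 + d ^ 2 := by
    refine mul_left_cancel₀ hρ.ne' ?_
    linear_combination h1'
  have e2 : a * c + b * d = 0 := by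
    refine (mul_eq_zero.1 ?_ : ρ = 0 ∨ _).resolve_left hρ.ne'
    linear_combination h2'
  have e3 : 0 < a * d - b * c := by
    have : 0 < (a * d - b * c) * (u.re * v.im - u.im * v.re) := by
      convert h3' using 1; ring
    exact (mul_pos_iff_of_pos_right h3).1 this
  -- Lagrange's identity (ad - bc)² + (ac + bd)² = (a² + b²)(c² + d²).
  have e4 : (a * d - b * c) ^ 2 = (a ^ 2 + b ^ 2) ^ 2 := by
    linear_combination (a ^ 2 + b ^ 2) * (-e1) - (a * c + b * d) * e2
  have e5 : a * d - b * c = a ^ 2 + b ^ 2 :=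
    (pow_left_inj₀ e3.le (by positivity) two_ne_zero).1 e4
  have e6 : (a - d) ^ 2 + (b + c) ^ 2 = 0 := by linear_combination -e1 - 2 * e5
  have e7 : a - d = 0 := by nlinarith [sq_nonneg (a - d), sq_nonneg (b + c)]
  have e8 : b + c = 0 := by nlinarith [sq_nonneg (a - d), sq_nonneg (b + c)]
  refine ⟨a, b, rfl, ?_⟩
  rw [show c = -b by linarith, show d = a by linarith]

lemma normSq_det3 {z u v : ℂ} (hc : IsConformalFrame innerC3 f z u v) :
    (starRingEnd ℂ) (det3 (f z) (dirDeriv u f z) (dirDeriv v f z)) *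
      det3 (f z) (dirDeriv u f z) (dirDeriv v f z) =
        ((innerC3 (dirDeriv u f z) (dirDeriv u f z) ^ 2 : ℝ) : ℂ) := by
  obtain ⟨g1, g2, g3⟩ := h.gram_of_conformal hc
  rw [conj_det3_mul_det3, Matrix.det_fin_three]
  simp only [Matrix.of_apply, Matrix.cons_val', Matrix.cons_val_zero, Matrix.cons_val_one,
    Matrix.cons_val, g1, g2, g3, h.leg, h.leg', h.inner_self, h.inner_tangent z u u]
  push_cast
  ring

lemma det3_ne_zero (z : ℂ) : det3 (f z) (dirDeriv 1 f z) (dirDeriv Complex.I f z) ≠ 0 := by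
  intro h0
  have hc := h.isConformalFrame_confDir z
  have e := h.normSq_det3 hc
  rw [det3_dirDeriv, h0, mul_zero, mul_zero] at e
  have := (h.inner_pos (z := z) one_ne_zero).ne'
  have e2 := Complex.ofReal_eq_zero.1 e.symm
  exact this (pow_eq_zero_iff two_ne_zero |>.1 e2)

/-- The Lagrangian angle is constant. -/
lemma phase_const : ∃ c : ℂ, ‖c‖ = 1 ∧ ∀ z, ∃ r : ℝ, 0 < r ∧
    det3 (f z) (dirDeriv 1 f z) (dirDeriv Complex.I f z) = r * c := by
  set D := fun y => det3 (f y) (dirDeriv 1 f y) (dirDeriv Complex.I f y) with hD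
  have hD0 : ∀ z, D z ≠ 0 := h.det3_ne_zero
  have hDd : Differentiable ℝ D := h.diff.det3 (h.diff_dir _) (h.diff_dir _)
  have hD0' : ∀ z, (starRingEnd ℂ) (D z) ≠ 0 := fun z => (map_ne_zero _).2 (hD0 z)
  -- q is the square of the phase. It is single valued, so no argument of D has to be chosen.
  let q := fun y => D y / (starRingEnd ℂ) (D y)
  have hcd : Differentiable ℝ fun y => (starRingEnd ℂ) (D y) :=
    Complex.conjCLE.differentiable.comp hDd
  have hqd : Differentiable ℝ q := fun z => by
    have := (hDd z).mul ((hcd z).fun_inv (hD0' z))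
    exact this.congr_of_eventuallyEq (Filter.Eventually.of_forall fun y => div_eq_mul_inv _ _)
  have hq : ∀ z, fderiv ℝ q z = 0 := by
    intro z
    ext1 w
    have e := dirDeriv_congr (f := fun y => q y * (starRingEnd ℂ) (D y)) (g := D)
      (fun y => div_mul_cancel₀ _ (hD0' y)) w z
    rw [dirDeriv_mul hqd hcd] at e
    have e2 : dirDeriv w (fun y => (starRingEnd ℂ) (D y)) z = (starRingEnd ℂ) (dirDeriv w D z) :=
      dirDeriv_clm (Complex.conjCLE : ℂ →L[ℝ] ℂ) hDd w z
    have e3 := h.phase_deriv (h.isConformalFrame_confDir z) w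
    rw [← Complex.conj_eq_iff_im, map_mul, Complex.conj_conj] at e3
    change D z * (starRingEnd ℂ) (dirDeriv w D z) = (starRingEnd ℂ) (D z) * dirDeriv w D z at e3
    rw [e2] at e
    have hqz : q z * (starRingEnd ℂ) (D z) = D z := div_mul_cancel₀ _ (hD0' z)
    change dirDeriv w q z = 0
    have : dirDeriv w q z * ((starRingEnd ℂ) (D z) * (starRingEnd ℂ) (D z)) = 0 := by
      linear_combination (starRingEnd ℂ) (D z) * e - e3 - hqz * (starRingEnd ℂ) (dirDeriv w D z)
    exact (mul_eq_zero.1 this).resolve_right (mul_ne_zero (hD0' z) (hD0' z))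
  have hconst : ∀ z, q z = q 0 := fun z => is_const_of_fderiv_eq_zero hqd hq z 0
  have hreal : ∀ z, ((starRingEnd ℂ) (D 0) * D z).im = 0 := by
    intro z
    have e := hconst z
    rw [← Complex.conj_eq_iff_im, map_mul, Complex.conj_conj]
    rw [div_eq_div_iff (hD0' z) (hD0' 0)] at e
    linear_combination -e
  have hne : ∀ z, ((starRingEnd ℂ) (D 0) * D z).re ≠ 0 := fun z h0 =>
    mul_ne_zero (hD0' 0) (hD0 z) (Complex.ext h0 (hreal z))
  -- D is now known to be a real multiple of D 0. The sign cannot change, as the factor is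
  -- continuous, never zero, and positive at 0.
  have hpos : ∀ z, 0 < ((starRingEnd ℂ) (D 0) * D z).re := by
    intro z
    by_contra hz
    have h0 : 0 < ((starRingEnd ℂ) (D 0) * D 0).re := by
      rw [← Complex.normSq_eq_conj_mul_self, Complex.ofReal_re]
      exact Complex.normSq_pos.2 (hD0 0)
    have hcont : Continuous fun z => ((starRingEnd ℂ) (D 0) * D z).re :=
      Complex.continuous_re.comp (continuous_const.mul hDd.continuous)
    obtain ⟨y, hy⟩ := mem_range_of_exists_le_of_exists_ge hcont ⟨z, not_lt.1 hz⟩ ⟨0, h0.le⟩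
    exact hne y hy
  have hn : 0 < ‖D 0‖ := norm_pos_iff.2 (hD0 0)
  refine ⟨D 0 / ‖D 0‖, ?_, fun z => ⟨((starRingEnd ℂ) (D 0) * D z).re / ‖D 0‖,
    div_pos (hpos z) hn, ?_⟩⟩
  · rw [norm_div, Complex.norm_real, norm_norm, div_self hn.ne']
  · change D z = _
    have e : (((starRingEnd ℂ) (D 0) * D z).re : ℂ) = (starRingEnd ℂ) (D 0) * D z :=
      Complex.ext rfl (by rw [hreal z, Complex.ofReal_im])
    have hn' : (‖D 0‖ : ℂ) ≠ 0 := Complex.ofReal_ne_zero.2 hn.ne'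
    have e2 : (starRingEnd ℂ) (D 0) * D 0 = (‖D 0‖ : ℂ) * ‖D 0‖ := by
      rw [← Complex.normSq_eq_conj_mul_self, Complex.normSq_eq_norm_sq]
      push_cast; ring
    rw [Complex.ofReal_div, e]
    field_simp
    linear_combination -(D z) * e2

end IsMinLegPlane

/-! ### Normalisation of the Lagrangian angle -/

lemma dirDeriv_const_smul {f : ℂ → C3} (hf : Differentiable ℝ f) (c u z : ℂ) :
    dirDeriv u (fun y => c • f y) z = c • dirDeriv u f z := by
  rw [dirDeriv_smul (differentiable_const c) hf, dirDeriv_const, zero_smul, add_zero]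

/-- A minimal Legendrian immersion of the plane whose Lagrangian angle is `π / 2`. -/
structure IsNormMinLeg (f : ℂ → C3) : Prop extends IsMinLegPlane f where
  phase : ∀ z, ∃ r : ℝ, 0 < r ∧ det3 (f z) (dirDeriv 1 f z) (dirDeriv Complex.I f z) = r * Complex.I

lemma det3_smul (b : ℂ) (x y w : C3) : det3 (b • x) (b • y) (b • w) = b ^ 3 * det3 x y w := by
  simp only [det3_eq, PiLp.smul_apply, smul_eq_mul]
  ring

/-- A minimal Lagrangian immersion of the plane has a horizontal lift with Lagrangian angle
`π / 2`. -/
theorem exists_normalized_lift {P : ℂ → C3 →L[ℂ] C3} (hP : ∀ z, IsLineProjection (P z))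
    (hs : ContDiff ℝ ∞ P) (hi : IsImmersed P) (hm : IsMinimalImm innerEnd tanCP2 P)
    (hL : ∀ z u v, kahlerCP2 (P z) (fderiv ℝ P z u) (fderiv ℝ P z v) = 0) :
    ∃ f, IsHorizontalOn P Set.univ f ∧ IsNormMinLeg f := by
  obtain ⟨f, hf, h1⟩ := exists_global_unit_lift hP hs (flat_of_lagrangian hP hs hL)
  have hmin := isMinLegPlane_of_horizontal hP hs hf h1 hi hm
  obtain ⟨c, hc, hph⟩ := hmin.phase_const
  have hc0 : c ≠ 0 := by rintro rfl; simp at hc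
  -- All three columns are scaled by b, so the determinant acquires b³, which has to equal i/c.
  obtain ⟨b, hb⟩ := IsAlgClosed.exists_pow_nat_eq (Complex.I / c) (n := 3) (by norm_num)
  have hb1 : ‖b‖ = 1 := by
    have := congrArg norm hb
    rw [norm_pow, norm_div, hc, Complex.norm_I, div_one] at this
    exact (pow_eq_one_iff_of_nonneg (norm_nonneg _) (by norm_num)).1 this
  have h1' : ∀ z, ‖b • f z‖ = 1 := fun z => by rw [norm_smul, hb1, h1, one_mul]
  have hf' := hf.const_smul b
  refine ⟨_, hf', isMinLegPlane_of_horizontal hP hs hf' h1' hi hm, fun z => ?_⟩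
  obtain ⟨r, hr, e⟩ := hph z
  refine ⟨r, hr, ?_⟩
  rw [dirDeriv_const_smul hmin.diff, dirDeriv_const_smul hmin.diff, det3_smul, e, hb]
  field_simp

/-! ### Special unitary frames from conformal frames -/

lemma mem_unitaryGroup_of_columns {a b c : C3} (haa : inner ℂ a a = 1) (hbb : inner ℂ b b = 1)
    (hcc : inner ℂ c c = 1) (hab : inner ℂ a b = 0) (hac : inner ℂ a c = 0)
    (hbc : inner ℂ b c = 0) : colMat a b c ∈ Matrix.unitaryGroup (Fin 3) ℂ := by
  have flip : ∀ {x y : C3}, inner ℂ x y = 0 → inner ℂ y x = 0 := fun h => inner_eq_zero_symm.1 h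
  rw [Matrix.mem_unitaryGroup_iff']
  ext i j
  rw [Matrix.star_eq_conjTranspose, conjTranspose_mul_apply]
  obtain ⟨e0, e1, e2⟩ := colVec_colMat a b c
  fin_cases i <;> fin_cases j <;>
    simp only [Fin.zero_eta, Fin.mk_one, Fin.reduceFinMk, e0, e1, e2] <;>
    first
      | rw [haa]; rfl
      | rw [hbb]; rfl
      | rw [hcc]; rfl
      | rw [hab]; rfl
      | rw [hac]; rfl
      | rw [hbc]; rfl
      | rw [flip hab]; rfl
      | rw [flip hac]; rfl
      | rw [flip hbc]; rfl

/-- The unit vector in the direction of `½ (f_u - i f_v)`. -/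
def unitM (f : ℂ → C3) (u v z : ℂ) : C3 :=
  ((√(2 * innerC3 (dirDeriv u f z) (dirDeriv u f z)))⁻¹ : ℂ) •
    (dirDeriv u f z - Complex.I • dirDeriv v f z)

/-- The unit vector in the direction of `-½ (f_u + i f_v)`. -/
def unitN (f : ℂ → C3) (u v z : ℂ) : C3 :=
  -(((√(2 * innerC3 (dirDeriv u f z) (dirDeriv u f z)))⁻¹ : ℂ) •
    (dirDeriv u f z + Complex.I • dirDeriv v f z))

namespace IsMinLegPlane

variable {f : ℂ → C3} (h : IsMinLegPlane f) {z u v : ℂ} (hc : IsConformalFrame innerC3 f z u v)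

include h hc

lemma sqrt_conformal_ne_zero :
    ((√(2 * innerC3 (dirDeriv u f z) (dirDeriv u f z)) : ℝ) : ℂ) ≠ 0 := by
  have := h.inner_pos (z := z) hc.ne_zero
  exact Complex.ofReal_ne_zero.2 (Real.sqrt_pos.2 (by positivity)).ne'

lemma sq_sqrt_conformal :
    ((√(2 * innerC3 (dirDeriv u f z) (dirDeriv u f z)) : ℝ) : ℂ) ^ 2 =
      2 * inner ℂ (dirDeriv u f z) (dirDeriv u f z) := by
  have := h.inner_pos (z := z) hc.ne_zero
  rw [← Complex.ofReal_pow, Real.sq_sqrt (by positivity), h.inner_tangent]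
  push_cast; rfl

lemma gram_isotropic :
    inner ℂ (dirDeriv u f z - Complex.I • dirDeriv v f z)
      (dirDeriv u f z - Complex.I • dirDeriv v f z) =
        2 * inner ℂ (dirDeriv u f z) (dirDeriv u f z) ∧
    inner ℂ (dirDeriv u f z + Complex.I • dirDeriv v f z)
      (dirDeriv u f z + Complex.I • dirDeriv v f z) =
        2 * inner ℂ (dirDeriv u f z) (dirDeriv u f z) ∧
    inner ℂ (dirDeriv u f z - Complex.I • dirDeriv v f z)
      (dirDeriv u f z + Complex.I • dirDeriv v f z) = 0 := by
  obtain ⟨g1, g2, g3⟩ := h.gram_of_conformal hc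
  simp only [inner_add_left, inner_add_right, inner_sub_left, inner_sub_right, inner_smul_left,
    inner_smul_right, g1, g2, g3, Complex.conj_I]
  refine ⟨?_, ?_, ?_⟩ <;> ring_nf <;> rw [Complex.I_sq] <;> ring

lemma unit_orthonormal :
    inner ℂ (unitM f u v z) (unitM f u v z) = 1 ∧ inner ℂ (unitN f u v z) (unitN f u v z) = 1 ∧
    inner ℂ (f z) (unitM f u v z) = 0 ∧ inner ℂ (f z) (unitN f u v z) = 0 ∧
    inner ℂ (unitM f u v z) (unitN f u v z) = 0 := by
  obtain ⟨g1, g2, g3⟩ := h.gram_isotropic hc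
  have k0 := h.sqrt_conformal_ne_zero hc
  have k1 := h.sq_sqrt_conformal hc
  refine ⟨?_, ?_, ?_, ?_, ?_⟩
  · rw [unitM, inner_smul_left, inner_smul_right, g1, map_inv₀, Complex.conj_ofReal, ← k1]
    field_simp
  · rw [unitN, inner_neg_neg, inner_smul_left, inner_smul_right, g2, map_inv₀, Complex.conj_ofReal,
      ← k1]
    field_simp
  · rw [unitM, inner_smul_right, inner_sub_right, inner_smul_right, h.leg, h.leg]; simp
  · rw [unitN, inner_neg_right, inner_smul_right, inner_add_right, inner_smul_right, h.leg, h.leg]; simp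
  · rw [unitM, unitN, inner_neg_right, inner_smul_left, inner_smul_right, g3]; simp

/-- Rotating the frame by (a, b) multiplies ∂_u - i∂_v by a + ib. The factor depends on the frames
only, so one c serves f and the columns of its moving frame alike. -/
lemma span_conformal {u' v' : ℂ} (hc' : IsConformalFrame innerC3 f z u' v') :
    ∃ c : ℂ, c ≠ 0 ∧ ∀ k : ℂ → C3, dirDeriv u' k z - Complex.I • dirDeriv v' k z =
      c • (dirDeriv u k z - Complex.I • dirDeriv v k z) := by
  obtain ⟨a, b, rfl, rfl⟩ := h.conformal_rotation hc hc'
  refine ⟨a + b * Complex.I, fun h0 => ?_, fun k => ?_⟩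
  · have h1 : a = 0 := by simpa using congrArg Complex.re h0
    have h2 : b = 0 := by simpa using congrArg Complex.im h0
    refine hc'.ne_zero ?_
    simp [h1, h2]
  · rw [dirDeriv_comb, dirDeriv_comb, Complex.ofReal_neg]
    simp only [smul_sub, smul_add, add_smul, neg_smul, smul_neg, smul_smul]
    match_scalars
    · ring
    · linear_combination (b : ℂ) * Complex.I_mul_I

end IsMinLegPlane

namespace IsNormMinLeg

variable {f : ℂ → C3} (h : IsNormMinLeg f) {z u v : ℂ} (hc : IsConformalFrame innerC3 f z u v)

include h hc

/-- The phase is i by normalisation, and the Gram determinant gives the modulus. -/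
lemma det3_conformal : det3 (f z) (dirDeriv u f z) (dirDeriv v f z) =
    innerC3 (dirDeriv u f z) (dirDeriv u f z) * Complex.I := by
  obtain ⟨r, hr, e⟩ := h.phase z
  have e2 := h.normSq_det3 hc
  have hρ := h.inner_pos (z := z) hc.ne_zero
  have hk := hc.2.2
  have e3 : det3 (f z) (dirDeriv u f z) (dirDeriv v f z) =
      (((u.re * v.im - u.im * v.re) * r : ℝ) : ℂ) * Complex.I := by
    rw [det3_dirDeriv, e]; push_cast; ring
  rw [e3] at e2 ⊢
  rw [map_mul, Complex.conj_ofReal, Complex.conj_I, mul_mul_mul_comm, neg_mul, Complex.I_mul_I,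
    neg_neg, mul_one, ← Complex.ofReal_mul, Complex.ofReal_inj, ← sq] at e2
  rw [(pow_left_inj₀ (by positivity) hρ.le two_ne_zero).1 e2]

/-- Here ρ = |f_u|². The passage from f_u, f_v to f_u - if_v, -(f_u + if_v) multiplies the
determinant iρ by -2i. The result 2ρ cancels the two normalising factors. This is the reason for the
phase π/2 and for the minus sign in the last column. -/
lemma frame_mem : colMat (f z) (unitM f u v z) (unitN f u v z) ∈
    Matrix.specialUnitaryGroup (Fin 3) ℂ := by
  obtain ⟨hM, hN, hfM, hfN, hMN⟩ := h.unit_orthonormal hc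
  refine Matrix.mem_specialUnitaryGroup_iff.2
    ⟨mem_unitaryGroup_of_columns (h.inner_self z) hM hN hfM hfN hMN, ?_⟩
  change det3 _ _ _ = 1
  have k0 := h.sqrt_conformal_ne_zero hc
  have k1 := h.sq_sqrt_conformal hc
  rw [h.inner_tangent] at k1
  have e : det3 (f z) (unitM f u v z) (unitN f u v z) =
      (((√(2 * innerC3 (dirDeriv u f z) (dirDeriv u f z)) : ℝ) : ℂ) ^ 2)⁻¹ *
        (-2 * Complex.I * det3 (f z) (dirDeriv u f z) (dirDeriv v f z)) := by
    simp only [unitM, unitN, det3_eq, PiLp.smul_apply, PiLp.neg_apply, PiLp.add_apply, PiLp.sub_apply, smul_eq_mul]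
    ring
  rw [e, h.det3_conformal hc]
  have e2 : -2 * Complex.I * (innerC3 (dirDeriv u f z) (dirDeriv u f z) * Complex.I) =
      ((√(2 * innerC3 (dirDeriv u f z) (dirDeriv u f z)) : ℝ) : ℂ) ^ 2 := by
    rw [k1]
    linear_combination (-2 * (innerC3 (dirDeriv u f z) (dirDeriv u f z) : ℂ)) * Complex.I_mul_I
  rw [e2, inv_mul_cancel₀ (pow_ne_zero 2 k0)]

end IsNormMinLeg

/-! ### The moving frame of a minimal Legendrian map -/

/-- The endomorphism `v ↦ ⟨y, v⟩ x`. -/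
def outer (x y : C3) : C3 →L[ℂ] C3 := (innerSL ℂ y).smulRight x

/-- An endomorphism depends smoothly on its values at the three basis vectors. -/
lemma contDiff_of_apply {R : ℂ → C3 →L[ℂ] C3} (h : ∀ x, ContDiff ℝ ∞ fun y => R y x) :
    ContDiff ℝ ∞ R := by
  have e : R = fun y => ∑ i : Fin 3, (ContinuousLinearMap.smulRightL ℂ C3 C3
      (EuclideanSpace.proj i : C3 →L[ℂ] ℂ)).restrictScalars ℝ
        (R y (EuclideanSpace.single i 1)) := by
    ext1 y
    ext1 x
    rw [sum_apply]
    change R y x = ∑ i : Fin 3, x i • R y (EuclideanSpace.single i 1)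
    simp only [← map_smul, ← map_sum]
    congr 1
    ext j
    fin_cases j <;> simp [Fin.sum_univ_three]
  rw [e]
  exact ContDiff.sum fun i _ => (ContinuousLinearMap.contDiff _).comp (h _)

lemma contDiff_outer {a b : ℂ → C3} (ha : ContDiff ℝ ∞ a) (hb : ContDiff ℝ ∞ b) :
    ContDiff ℝ ∞ fun y => outer (a y) (b y) :=
  contDiff_of_apply fun _ => (contDiff_inner_C3 hb contDiff_const).smul ha

lemma dirDeriv_outer {a b : ℂ → C3} (ha : ContDiff ℝ ∞ a) (hb : ContDiff ℝ ∞ b)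
    (u z : ℂ) : dirDeriv u (fun y => outer (a y) (b y)) z =
      outer (a z) (dirDeriv u b z) + outer (dirDeriv u a z) (b z) := by
  ext1 x
  have e := dirDeriv_apply_complex ((contDiff_outer ha hb).differentiable_infty z)
    (differentiableAt_const (c := x) (x := z)) u
  rw [dirDeriv_const, map_zero, zero_add] at e
  rw [← e]
  change dirDeriv u (fun y => inner ℂ (b y) x • a y) z = inner ℂ (dirDeriv u b z) x • a z +
    inner ℂ (b z) x • dirDeriv u a z
  rw [dirDeriv_smul (contDiff_inner_C3 hb contDiff_const).differentiable_infty
    ha.differentiable_infty, dirDeriv_inner hb.differentiable_infty (differentiable_const x),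
    dirDeriv_const, inner_zero_right, zero_add, add_comm]

lemma colVec_mul (g k : Mat3) (j : Fin 3) : colVec (g * k) j = ∑ i, k i j • colVec g i := by
  ext l
  simp [colVec, Matrix.mul_apply, Fin.sum_univ_three, mul_comm]

lemma toEuclideanCLM_colVec (g k : Mat3) (j : Fin 3) :
    Matrix.toEuclideanCLM (n := Fin 3) (𝕜 := ℂ) g (colVec k j) = colVec (g * k) j := by
  ext l
  simp [colVec, Matrix.mul_apply, Matrix.mulVec, dotProduct]

lemma unitary_expand {g : Mat3} (hg : g ∈ Matrix.unitaryGroup (Fin 3) ℂ) (x : C3) :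
    x = ∑ i, inner ℂ (colVec g i) x • colVec g i := by
  have h := Matrix.mem_unitaryGroup_iff.1 hg
  ext l
  have e : x l = ((g * star g).mulVec x.ofLp) l := by rw [h, Matrix.one_mulVec]
  rw [e, ← Matrix.mulVec_mulVec]
  simp only [Fin.sum_univ_three, C3.inner_eq, Matrix.mulVec, dotProduct, PiLp.add_apply,
    PiLp.smul_apply, smul_eq_mul, colVec, Matrix.star_apply]
  simp only [← starRingEnd_apply]
  ring

lemma unitary_columns {g : Mat3} (hg : g ∈ Matrix.unitaryGroup (Fin 3) ℂ) (i j : Fin 3) :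
    inner ℂ (colVec g i) (colVec g j) = if i = j then 1 else 0 := by
  rw [← conjTranspose_mul_apply, ← Matrix.star_eq_conjTranspose,
    Matrix.mem_unitaryGroup_iff'.1 hg, Matrix.one_apply]

/-- The off-diagonal part of the matrix of the vectors `d j` in the basis `c`. -/
def offDiag (c d : Fin 3 → C3) : Mat3 :=
  Matrix.of fun i j => if i = j then 0 else inner ℂ (c i) (d j)

section OffDiag

variable {g : Mat3} (hg : g ∈ Matrix.unitaryGroup (Fin 3) ℂ) {d : Fin 3 → C3}
  (hd : ∀ i j, inner ℂ (colVec g i) (d j) + inner ℂ (d i) (colVec g j) = 0)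

include hd in
lemma offDiag_skew : (offDiag (colVec g) d).conjTranspose = -offDiag (colVec g) d := by
  ext i j
  simp only [offDiag, Matrix.conjTranspose_apply, Matrix.of_apply, Matrix.neg_apply]
  by_cases h : i = j
  · simp [h]
  · rw [if_neg h, if_neg (Ne.symm h), ← starRingEnd_apply, inner_conj_symm]
    exact eq_neg_of_add_eq_zero_right (hd i j)

include hg hd

lemma isSu3_offDiag : IsSu3 (g * offDiag (colVec g) d * g.conjTranspose) := by
  constructor
  · rw [Matrix.conjTranspose_mul, Matrix.conjTranspose_mul, Matrix.conjTranspose_conjTranspose,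
      offDiag_skew hd]
    simp [Matrix.mul_assoc]
  · rw [Matrix.trace_mul_comm, ← Matrix.mul_assoc, ← Matrix.star_eq_conjTranspose,
      Matrix.mem_unitaryGroup_iff'.1 hg, Matrix.one_mul]
    simp [Matrix.trace, offDiag]

omit hd in
lemma offDiag_action (j : Fin 3) :
    Matrix.toEuclideanCLM (n := Fin 3) (𝕜 := ℂ)
      (g * offDiag (colVec g) d * g.conjTranspose) (colVec g j) =
        d j - inner ℂ (colVec g j) (d j) • colVec g j := by
  rw [toEuclideanCLM_colVec, Matrix.mul_assoc, ← Matrix.star_eq_conjTranspose,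
    Matrix.mem_unitaryGroup_iff'.1 hg, Matrix.mul_one, colVec_mul]
  have e : ∀ i, inner ℂ (colVec g i) (d j) • colVec g i = offDiag (colVec g) d i j • colVec g i +
      if i = j then inner ℂ (colVec g j) (d j) • colVec g j else 0 := by
    intro i
    by_cases h : i = j
    · simp [offDiag, h]
    · simp [offDiag, h]
  have hx := unitary_expand hg (d j)
  rw [Finset.sum_congr rfl fun i _ => e i, Finset.sum_add_distrib,
    Finset.sum_ite_eq' Finset.univ j, if_pos (Finset.mem_univ j)] at hx
  exact eq_sub_of_add_eq hx.symm

/-- Diagonal entries only turn each column inside its own line. They do not move W, and they move w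
through the entry (0,0) alone, which `h0` makes zero. The off-diagonal part therefore represents the
whole tangent vector. -/
lemma infAction_offDiag (q : FL2) (hw : (q.w : C3) = colVec g 0)
    (hW : q.W.starProjection = outer (colVec g 0) (colVec g 0) +
      outer (colVec g 1) (colVec g 1)) (h0 : inner ℂ (colVec g 0) (d 0) = 0) :
    infAction (g * offDiag (colVec g) d * g.conjTranspose) q =
      (d 0, (outer (colVec g 0) (d 0) + outer (d 0) (colVec g 0)) +
        (outer (colVec g 1) (d 1) + outer (d 1) (colVec g 1))) := by
  have hsk := (isSu3_offDiag hg hd).1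
  have hact := offDiag_action hg (d := d)
  set ξ := g * offDiag (colVec g) d * g.conjTranspose with hξ
  unfold infAction
  simp only
  set L := Matrix.toEuclideanCLM (n := Fin 3) (𝕜 := ℂ) ξ with hL
  have hadj : ∀ x y, inner ℂ x (L y) = -inner ℂ (L x) y := by
    intro x y
    have : ContinuousLinearMap.adjoint L = -L := by
      rw [← ContinuousLinearMap.star_eq_adjoint, hL, ← map_star, Matrix.star_eq_conjTranspose,
        hsk, map_neg]
    rw [← ContinuousLinearMap.adjoint_inner_left, this, neg_apply, inner_neg_left]
  refine Prod.ext ?_ ?_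
  · rw [hw, hact, h0, zero_smul, sub_zero]
  · ext1 x
    have e1 : inner ℂ (d 1) (colVec g 1) = -inner ℂ (colVec g 1) (d 1) :=
      eq_neg_of_add_eq_zero_right (hd 1 1)
    change L (q.W.starProjection x) - q.W.starProjection (L x) =
      (inner ℂ (d 0) x • colVec g 0 + inner ℂ (colVec g 0) x • d 0) +
        (inner ℂ (d 1) x • colVec g 1 + inner ℂ (colVec g 1) x • d 1)
    rw [hW]
    change L (inner ℂ (colVec g 0) x • colVec g 0 + inner ℂ (colVec g 1) x • colVec g 1) -
      (inner ℂ (colVec g 0) (L x) • colVec g 0 + inner ℂ (colVec g 1) (L x) • colVec g 1) = _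
    rw [map_add, map_smul, map_smul, hadj, hadj, hact, hact, h0, zero_smul, sub_zero,
      inner_sub_left, inner_smul_left, inner_conj_symm, e1]
    module

end OffDiag

/-! ### The eigenspace `𝔤₁` -/

lemma eps_pow_three : eps ^ 3 = 1 := by
  rw [eps, ← Complex.exp_nat_mul]
  rw [show ((3 : ℕ) : ℂ) * (2 * Real.pi * Complex.I / 3) = 2 * Real.pi * Complex.I by
    push_cast; ring]
  exact Complex.exp_two_pi_mul_I

lemma matS_inv : matS⁻¹ = Matrix.diagonal ![1, eps ^ 2, eps] := by
  refine Matrix.inv_eq_right_inv ?_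
  rw [matS, Matrix.diagonal_mul_diagonal, ← Matrix.diagonal_one]
  congr 1
  funext i
  fin_cases i
  · simp
  · simpa using by linear_combination eps_pow_three
  · simpa using by linear_combination eps_pow_three

lemma matT_inv : matT⁻¹ = matT := by
  refine Matrix.inv_eq_right_inv ?_
  ext i j
  fin_cases i <;> fin_cases j <;> simp [matT, Matrix.mul_apply, Fin.sum_univ_three]

/-- ν multiplies the entry (i, j) by ε^(i-j), which is ε at the three positions used. Up to sign, μ
exchanges (0,2) with (1,0) and preserves (2,1), whence the repeated a and the free b. -/
lemma mem_g1 (a b : ℂ) : (!![0, 0, a; a, 0, 0; 0, b, 0] : Mat3) ∈ g1 := by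
  have h3 := eps_pow_three
  refine ⟨by simp [Matrix.trace, Fin.sum_univ_three], ?_⟩
  have hZ : nuLie !![0, 0, a; a, 0, 0; 0, b, 0] =
      !![0, 0, a * eps; eps * a, 0, 0; 0, eps ^ 2 * b * eps ^ 2, 0] := by
    rw [nuLie, matS_inv, matS]
    ext i j
    rw [Matrix.mul_diagonal, Matrix.diagonal_mul]
    fin_cases i <;> fin_cases j <;> simp
  rw [hZ, muLie, matT_inv]
  have h4 : eps ^ 2 * b * eps ^ 2 = eps * b := by linear_combination b * eps * h3
  rw [h4]
  ext i j
  simp only [Matrix.neg_apply, Matrix.mul_apply, Fin.sum_univ_three, Matrix.transpose_apply,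
    Matrix.smul_apply, matT]
  fin_cases i <;> fin_cases j <;> simp [mul_comm]

/-! ### Derivatives along a varying conformal direction -/

/-- The correction for the varying direction is again a real tangent vector, so it does not affect
the imaginary parts that make up the cubic form. -/
lemma dirDeriv_moving {f : ℂ → C3} (hf : ContDiff ℝ ∞ f) {c : ℂ → ℂ} (hc : ContDiff ℝ ∞ c)
    (w z : ℂ) : dirDeriv w (fun y => dirDeriv (c y) f y) z =
      dirDeriv w (dirDeriv (c z) f) z + dirDeriv (dirDeriv w c z) f z := by
  have hre : Differentiable ℝ fun y => ((c y).re : ℂ) :=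
    (Complex.ofRealCLM.comp Complex.reCLM).differentiable.comp hc.differentiable_infty
  have him : Differentiable ℝ fun y => ((c y).im : ℂ) :=
    (Complex.ofRealCLM.comp Complex.imCLM).differentiable.comp hc.differentiable_infty
  have ere : dirDeriv w (fun y => ((c y).re : ℂ)) z = ((dirDeriv w c z).re : ℂ) :=
    dirDeriv_clm (Complex.ofRealCLM.comp Complex.reCLM) hc.differentiable_infty w z
  have eim : dirDeriv w (fun y => ((c y).im : ℂ)) z = ((dirDeriv w c z).im : ℂ) :=
    dirDeriv_clm (Complex.ofRealCLM.comp Complex.imCLM) hc.differentiable_infty w z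
  have h1 := (hf.dirDeriv 1).differentiable_infty
  have h2 := (hf.dirDeriv Complex.I).differentiable_infty
  rw [dirDeriv_congr (fun y => dirDeriv_eq_coord f (c y) y) w z,
    dirDeriv_add (hre.fun_smul h1) (him.fun_smul h2), dirDeriv_smul hre h1, dirDeriv_smul him h2, ere, eim,
    dirDeriv_congr (fun y => dirDeriv_eq_coord f (c z) y) w z,
    dirDeriv_add ((differentiable_const _).fun_smul h1) ((differentiable_const _).fun_smul h2),
    dirDeriv_smul (differentiable_const _) h1, dirDeriv_smul (differentiable_const _) h2,
    dirDeriv_const, dirDeriv_const, dirDeriv_eq_coord f (dirDeriv w c z)]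
  module

/-- The frame `f, f_Z / |f_Z|, -f_Z̄ / |f_Z̄|` for the complex structure induced by `f`. -/
def movingFrame (f : ℂ → C3) (z : ℂ) : Mat3 :=
  colMat (f z) (unitM f 1 (confDir f z) z) (unitN f 1 (confDir f z) z)

namespace IsMinLegPlane

variable {f : ℂ → C3} (h : IsMinLegPlane f)

include h

lemma contDiff_dir_moving : ContDiff ℝ ∞ fun y => dirDeriv (confDir f y) f y := by
  have hre : ContDiff ℝ ∞ fun y => ((confDir f y).re : ℂ) :=
    (Complex.ofRealCLM.comp Complex.reCLM).contDiff.comp h.contDiff_confDir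
  have him : ContDiff ℝ ∞ fun y => ((confDir f y).im : ℂ) :=
    (Complex.ofRealCLM.comp Complex.imCLM).contDiff.comp h.contDiff_confDir
  rw [funext fun y => dirDeriv_eq_coord f (confDir f y) y]
  exact (hre.smul (h.smooth.dirDeriv 1)).add (him.smul (h.smooth.dirDeriv Complex.I))

lemma contDiff_normalization : ContDiff ℝ ∞ fun y =>
    ((√(2 * innerC3 (dirDeriv 1 f y) (dirDeriv 1 f y)) : ℝ) : ℂ)⁻¹ := by
  have hpos : ∀ y, 0 < 2 * innerC3 (dirDeriv 1 f y) (dirDeriv 1 f y) := fun y => by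
    have := h.inner_pos (z := y) one_ne_zero
    positivity
  have h1 : ContDiff ℝ ∞ fun y => √(2 * innerC3 (dirDeriv 1 f y) (dirDeriv 1 f y)) :=
    (contDiff_const.mul (h.contDiff_inner_dir 1 1)).sqrt fun y => (hpos y).ne'
  exact (Complex.ofRealCLM.contDiff.comp h1).inv fun y =>
    Complex.ofReal_ne_zero.2 (Real.sqrt_pos.2 (hpos y)).ne'

lemma contDiff_unitM : ContDiff ℝ ∞ fun y => unitM f 1 (confDir f y) y :=
  h.contDiff_normalization.fun_smul
    ((h.smooth.dirDeriv 1).sub (contDiff_const.fun_smul h.contDiff_dir_moving))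

lemma contDiff_unitN : ContDiff ℝ ∞ fun y => unitN f 1 (confDir f y) y :=
  (h.contDiff_normalization.fun_smul
    ((h.smooth.dirDeriv 1).add (contDiff_const.fun_smul h.contDiff_dir_moving))).neg

lemma contDiff_colVec_movingFrame (i : Fin 3) :
    ContDiff ℝ ∞ fun y => colVec (movingFrame f y) i := by
  fin_cases i
  · exact h.smooth
  · exact h.contDiff_unitM
  · exact h.contDiff_unitN

/-- The trace freeness of the cubic form, in terms of the moving conformal frame. -/
lemma inner_isotropic_deriv (z : ℂ) :
    inner ℂ (dirDeriv 1 f z - Complex.I • dirDeriv (confDir f z) f z)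
      (dirDeriv 1 (fun y => dirDeriv 1 f y + Complex.I • dirDeriv (confDir f y) f y) z -
        Complex.I • dirDeriv (confDir f z)
          (fun y => dirDeriv 1 f y + Complex.I • dirDeriv (confDir f y) f y) z) = 0 := by
  have hX := h.contDiff_dir_moving.differentiable_infty
  have h1 := h.diff_dir 1
  have hc := h.isConformalFrame_confDir
  set v := confDir f z with hv
  -- The derivatives of |f_1| = |f_v| and ⟨f_1, f_v⟩ = 0 cancel the real parts of the Hermitian
  -- products, and the imaginary parts are values of the cubic form.
  have key : ∀ w, inner ℂ (dirDeriv 1 f z - Complex.I • dirDeriv v f z)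
      (dirDeriv w (fun y => dirDeriv 1 f y + Complex.I • dirDeriv (confDir f y) f y) z) =
        -2 * cubicForm f z 1 v w + Complex.I * (cubicForm f z 1 1 w - cubicForm f z v v w) := by
    intro w
    have e1 : inner ℂ (dirDeriv 1 f z) (dirDeriv w (dirDeriv 1 f) z) +
        inner ℂ (dirDeriv w (dirDeriv 1 f) z) (dirDeriv 1 f z) =
        inner ℂ (dirDeriv v f z) (dirDeriv w (fun y => dirDeriv (confDir f y) f y) z) +
        inner ℂ (dirDeriv w (fun y => dirDeriv (confDir f y) f y) z) (dirDeriv v f z) := by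
      rw [hv, ← dirDeriv_inner h1 h1, ← dirDeriv_inner hX hX]
      exact dirDeriv_congr (fun y => (h.gram_of_conformal (hc y)).1.symm) w z
    have e2 : inner ℂ (dirDeriv 1 f z) (dirDeriv w (fun y => dirDeriv (confDir f y) f y) z) +
        inner ℂ (dirDeriv w (dirDeriv 1 f) z) (dirDeriv v f z) = 0 := by
      rw [hv, ← dirDeriv_inner h1 hX, ← dirDeriv_const (0 : ℂ) w z]
      exact dirDeriv_congr (fun y => (h.gram_of_conformal (hc y)).2.1) w z
    have e3 : ∀ x, (inner ℂ (dirDeriv x f z)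
        (dirDeriv w (fun y => dirDeriv (confDir f y) f y) z)).im = cubicForm f z x v w := by
      intro x
      rw [dirDeriv_moving h.smooth h.contDiff_confDir, inner_add_right, Complex.add_im,
        h.inner_tangent_im, add_zero, cubicForm]
    have e4 : ∀ x y : C3, (inner ℂ x y).re = (inner ℂ y x).re := innerC3_comm
    have e5 := congrArg Complex.re e1
    have e6 := congrArg Complex.re e2
    rw [Complex.add_re, Complex.add_re, e4 (dirDeriv w (dirDeriv 1 f) z),
      e4 (dirDeriv w _ z) (dirDeriv v f z)] at e5
    rw [Complex.add_re, e4 (dirDeriv w (dirDeriv 1 f) z), Complex.zero_re] at e6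
    have c1 : (inner ℂ (dirDeriv 1 f z) (dirDeriv w (dirDeriv 1 f) z)).im =
      cubicForm f z 1 1 w := rfl
    have c2 : (inner ℂ (dirDeriv v f z) (dirDeriv w (dirDeriv 1 f) z)).im =
      cubicForm f z 1 v w := h.cubic_comm_left z v 1 w
    have c3 := e3 1
    have c4 := e3 v
    rw [dirDeriv_add h1 ((differentiable_const _).fun_smul hX), dirDeriv_const_smul hX]
    simp only [inner_sub_left, inner_add_right, inner_smul_left, inner_smul_right, Complex.conj_I]
    apply Complex.ext
    · simp
      linarith
    · simp
      linarith
  have hcz := hc z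
  have t1 := h.cubic_trace hcz 1
  have t2 := h.cubic_trace hcz v
  rw [← hv] at t1 t2
  rw [inner_sub_right, inner_smul_right, key, key]
  rw [h.cubic_comm_left z v 1 1] at t2
  rw [h.cubic_comm_right z v v 1, h.cubic_comm_left z v 1 v, h.cubic_comm_right z 1 1 v]
  have t1' : (cubicForm f z 1 1 1 : ℂ) + cubicForm f z 1 v v = 0 := by exact_mod_cast t1
  have t2' : (cubicForm f z 1 v 1 : ℂ) + cubicForm f z v v v = 0 := by exact_mod_cast t2
  -- Combining w = 1 with -i times w = v leaves multiples of the two traces.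
  linear_combination Complex.I * t1' - t2' +
    (cubicForm f z v v v - cubicForm f z 1 v 1 : ℂ) * Complex.I_mul_I

end IsMinLegPlane

/-! ### The primitive lift to FL₂ -/

lemma starProjection_span_pair {a b : C3} (ha : inner ℂ a a = 1) (hb : inner ℂ b b = 1)
    (hab : inner ℂ a b = 0) :
    (Submodule.span ℂ {a, b}).starProjection = outer a a + outer b b := by
  have hba : inner ℂ b a = 0 := inner_eq_zero_symm.1 hab
  ext1 x
  symm
  change inner ℂ a x • a + inner ℂ b x • b = _
  refine (Submodule.eq_starProjection_of_mem_of_inner_eq_zero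
    (Submodule.mem_span_pair.2 ⟨_, _, rfl⟩) fun w hw => ?_).symm
  obtain ⟨s, t, rfl⟩ := Submodule.mem_span_pair.1 hw
  simp only [inner_sub_left, inner_add_left, inner_add_right, inner_smul_left, inner_smul_right,
    ha, hb, hab, hba, inner_conj_symm]
  ring

lemma finrank_span_pair_of_orthonormal {a b : C3} (ha : inner ℂ a a = 1) (hb : inner ℂ b b = 1)
    (hab : inner ℂ a b = 0) : Module.finrank ℂ (Submodule.span ℂ {a, b}) = 2 := by
  have hli : LinearIndependent ℂ ![a, b] := by
    rw [LinearIndependent.pair_iff]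
    intro s t hst
    have h1 := congrArg (inner ℂ a) hst
    have h2 := congrArg (inner ℂ b) hst
    simp only [inner_add_right, inner_smul_right, ha, hb, hab, inner_eq_zero_symm.1 hab,
      inner_zero_right] at h1 h2
    exact ⟨by simpa using h1, by simpa using h2⟩
  have := finrank_span_eq_card hli
  rwa [Matrix.range_cons_cons_empty, Fintype.card_fin] at this

namespace IsNormMinLeg

variable {f : ℂ → C3} (h : IsNormMinLeg f)

/-- The point of `FL₂` over `f z`. -/
def flPoint (z : ℂ) : FL2 where
  w := ⟨f z, by simpa using h.norm_eq z⟩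
  W := Submodule.span ℂ {f z, unitM f 1 (confDir f z) z}
  finrank_W := by
    obtain ⟨h1, -, h2, -⟩ := h.unit_orthonormal (h.isConformalFrame_confDir z)
    exact finrank_span_pair_of_orthonormal (h.inner_self z) h1 h2
  w_mem := Submodule.subset_span (by simp)

include h

lemma movingFrame_mem (z : ℂ) : movingFrame f z ∈ Matrix.specialUnitaryGroup (Fin 3) ℂ :=
  h.frame_mem (h.isConformalFrame_confDir z)

lemma movingFrame_unitary (z : ℂ) : movingFrame f z ∈ Matrix.unitaryGroup (Fin 3) ℂ :=
  (Matrix.mem_specialUnitaryGroup_iff.1 (h.movingFrame_mem z)).1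

/-- The line of f_Z does not depend on the conformal frame, by `span_conformal`. -/
lemma flPoint_W {z u v : ℂ} (hc : IsConformalFrame innerC3 f z u v) : (h.flPoint z).W =
    Submodule.span ℂ {f z, dirDeriv u f z - Complex.I • dirDeriv v f z} := by
  obtain ⟨c, hc0, hcc⟩ := h.span_conformal (h.isConformalFrame_confDir z) hc
  have k0 := h.sqrt_conformal_ne_zero (h.isConformalFrame_confDir z)
  rw [hcc f]
  change Submodule.span ℂ {f z, unitM f 1 (confDir f z) z} = _
  rw [unitM, Submodule.span_insert, Submodule.span_insert,
    Submodule.span_singleton_smul_eq (IsUnit.mk0 _ (inv_ne_zero k0)),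
    Submodule.span_singleton_smul_eq (IsUnit.mk0 _ hc0)]

lemma flPoint_starProjection (z : ℂ) : (h.flPoint z).W.starProjection =
    outer (f z) (f z) + outer (unitM f 1 (confDir f z) z) (unitM f 1 (confDir f z) z) := by
  obtain ⟨h1, -, h2, -⟩ := h.unit_orthonormal (h.isConformalFrame_confDir z)
  exact starProjection_span_pair (h.inner_self z) h1 h2

lemma flPoint_emb : (fun z => (h.flPoint z).emb) = fun z => (f z,
    outer (f z) (f z) + outer (unitM f 1 (confDir f z) z) (unitM f 1 (confDir f z) z)) :=
  funext fun z => Prod.ext rfl (h.flPoint_starProjection z)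

lemma contDiff_proj_W : ContDiff ℝ ∞ fun z => outer (f z) (f z) +
    outer (unitM f 1 (confDir f z) z) (unitM f 1 (confDir f z) z) :=
  (contDiff_outer h.smooth h.smooth).add (contDiff_outer h.contDiff_unitM h.contDiff_unitM)

lemma contDiff_flPoint : ContDiff ℝ ∞ fun z => (h.flPoint z).emb := by
  rw [h.flPoint_emb]
  exact h.smooth.prodMk h.contDiff_proj_W

/-- The derivatives of the columns of the moving frame. -/
lemma fderiv_flPoint (z u : ℂ) : fderiv ℝ (fun z => (h.flPoint z).emb) z u =
    (dirDeriv u f z, (outer (f z) (dirDeriv u f z) + outer (dirDeriv u f z) (f z)) +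
      (outer (unitM f 1 (confDir f z) z) (dirDeriv u (fun y => unitM f 1 (confDir f y) y) z) +
        outer (dirDeriv u (fun y => unitM f 1 (confDir f y) y) z)
          (unitM f 1 (confDir f z) z))) := by
  rw [h.flPoint_emb, (h.diff z).fderiv_prodMk (h.contDiff_proj_W.differentiable_infty z)]
  refine Prod.ext rfl ?_
  change dirDeriv u _ z = _
  rw [dirDeriv_add (contDiff_outer h.smooth h.smooth).differentiable_infty
    (contDiff_outer h.contDiff_unitM h.contDiff_unitM).differentiable_infty,
    dirDeriv_outer h.smooth h.smooth, dirDeriv_outer h.contDiff_unitM h.contDiff_unitM]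

lemma immersed_flPoint : IsImmersed fun z => (h.flPoint z).emb := by
  intro z u v huv
  have e := congrArg Prod.fst huv
  rw [h.fderiv_flPoint, h.fderiv_flPoint] at e
  exact h.immersed z e

lemma movingFrame_skew (z w : ℂ) (i j : Fin 3) :
    inner ℂ (colVec (movingFrame f z) i) (dirDeriv w (fun y => colVec (movingFrame f y) j) z) +
      inner ℂ (dirDeriv w (fun y => colVec (movingFrame f y) i) z)
        (colVec (movingFrame f z) j) = 0 := by
  rw [← dirDeriv_inner (h.contDiff_colVec_movingFrame i).differentiable_infty
    (h.contDiff_colVec_movingFrame j).differentiable_infty,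
    dirDeriv_congr (fun y => unitary_columns (h.movingFrame_unitary y) i j), dirDeriv_const]

lemma isFrameAt_movingFrame (z : ℂ) : IsFrameAt (movingFrame f z) (h.flPoint z) :=
  ⟨h.movingFrame_mem z, rfl, rfl⟩

/-- The Maurer-Cartan form of the moving frame is of type `𝔤₁` off the diagonal. -/
lemma offDiag_mem (z : ℂ) (c : ℂ) : (c • offDiag (colVec (movingFrame f z)) fun j =>
    dirDeriv 1 (fun y => colVec (movingFrame f y) j) z -
      Complex.I • dirDeriv (confDir f z) (fun y => colVec (movingFrame f y) j) z) ∈ g1 := by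
  have hc := h.isConformalFrame_confDir z
  have hcA := h.isConformalFrame_confDir
  set v := confDir f z with hv
  obtain ⟨gA, gB, gAB⟩ := h.gram_isotropic hc
  set κ : ℂ := ((√(2 * innerC3 (dirDeriv 1 f z) (dirDeriv 1 f z)) : ℝ) : ℂ)⁻¹ with hκ
  set A := dirDeriv 1 f z - Complex.I • dirDeriv v f z with hA
  set B := dirDeriv 1 f z + Complex.I • dirDeriv v f z with hB
  set d : Fin 3 → C3 := fun j => dirDeriv 1 (fun y => colVec (movingFrame f y) j) z -
      Complex.I • dirDeriv v (fun y => colVec (movingFrame f y) j) z with hd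
  have c0 : colVec (movingFrame f z) 0 = f z := rfl
  have c1 : colVec (movingFrame f z) 1 = κ • A := rfl
  have c2 : colVec (movingFrame f z) 2 = -(κ • B) := rfl
  have d0 : d 0 = A := rfl
  have hκr : (starRingEnd ℂ) κ = κ := by rw [hκ, map_inv₀, Complex.conj_ofReal]
  have gBA : inner ℂ B A = 0 := inner_eq_zero_symm.1 gAB
  -- Skewness of the Maurer-Cartan form moves the derivative to f, so the first row is known from
  -- first derivatives of f.
  have hfd : ∀ j, j ≠ 0 → inner ℂ (f z) (d j) = -inner ℂ B (colVec (movingFrame f z) j) := by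
    intro j hj
    have e1 := h.movingFrame_skew z 1 0 j
    have e2 := h.movingFrame_skew z v 0 j
    change inner ℂ (f z) _ + inner ℂ (dirDeriv 1 f z) _ = 0 at e1
    change inner ℂ (f z) _ + inner ℂ (dirDeriv v f z) _ = 0 at e2
    rw [hd, hB]
    simp only
    rw [inner_sub_right, inner_smul_right, inner_add_left, inner_smul_left, Complex.conj_I]
    linear_combination e1 - Complex.I * e2
  have h01 : inner ℂ (f z) (d 1) = 0 := by
    rw [hfd 1 (by decide), c1, inner_smul_right, gBA, mul_zero, neg_zero]
  have h02 : inner ℂ (f z) (d 2) = κ * (2 * inner ℂ (dirDeriv 1 f z) (dirDeriv 1 f z)) := by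
    rw [hfd 2 (by decide), c2, inner_neg_right, inner_smul_right, gB, neg_neg]
  have h10 : inner ℂ (κ • A) (d 0) = κ * (2 * inner ℂ (dirDeriv 1 f z) (dirDeriv 1 f z)) := by
    rw [d0, inner_smul_left, hκr, gA]
  have h20 : inner ℂ (-(κ • B)) (d 0) = 0 := by
    rw [d0, inner_neg_left, inner_smul_left, gBA, mul_zero, neg_zero]
  -- The one entry that needs minimality. The derivative of the normalising factor only contributes
  -- a multiple of ⟨A, B⟩ = 0.
  have h12 : inner ℂ (κ • A) (d 2) = 0 := by
    have hBd : Differentiable ℝ fun y => dirDeriv 1 f y + Complex.I • dirDeriv (confDir f y) f y :=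
      (h.diff_dir 1).add ((differentiable_const _).fun_smul
        h.contDiff_dir_moving.differentiable_infty)
    have e : ∀ w, inner ℂ A (dirDeriv w (fun y => colVec (movingFrame f y) 2) z) = -(κ * inner ℂ A
        (dirDeriv w (fun y => dirDeriv 1 f y + Complex.I • dirDeriv (confDir f y) f y) z)) := by
      intro w
      change inner ℂ A (dirDeriv w (fun y => -(((√(2 * innerC3 (dirDeriv 1 f y) (dirDeriv 1 f y)) :
        ℝ) : ℂ)⁻¹ • (dirDeriv 1 f y + Complex.I • dirDeriv (confDir f y) f y))) z) = _
      rw [dirDeriv_neg, dirDeriv_smul h.contDiff_normalization.differentiable_infty hBd,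
        inner_neg_right, inner_add_right, inner_smul_right, inner_smul_right]
      change -(κ * _ + _ * inner ℂ A B) = _
      rw [gAB, mul_zero, add_zero]
    have e2 := h.inner_isotropic_deriv z
    rw [inner_sub_right, inner_smul_right] at e2
    rw [inner_smul_left, hd]
    simp only
    rw [inner_sub_right, inner_smul_right, e, e]
    linear_combination -(starRingEnd ℂ) κ * κ * e2
  have e : offDiag (colVec (movingFrame f z)) d =
      !![0, 0, κ * (2 * inner ℂ (dirDeriv 1 f z) (dirDeriv 1 f z));
        κ * (2 * inner ℂ (dirDeriv 1 f z) (dirDeriv 1 f z)), 0, 0;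
        0, inner ℂ (-(κ • B)) (d 1), 0] := by
    ext i j
    fin_cases i <;> fin_cases j
    · rfl
    · exact h01
    · exact h02
    · exact h10
    · rfl
    · exact h12
    · exact h20
    · rfl
    · rfl
  rw [e]
  convert mem_g1 (c * (κ * (2 * inner ℂ (dirDeriv 1 f z) (dirDeriv 1 f z))))
    (c * inner ℂ (-(κ • B)) (d 1)) using 1
  ext i j
  fin_cases i <;> fin_cases j <;> simp

/-- The ξ, η required are the off-diagonal Maurer-Cartan matrices, conjugated back by g. Another
conformal frame only rescales their (1,0) combination, which `offDiag_mem` permits. -/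
lemma primitive_flPoint {z u v : ℂ} (hc : IsConformalFrame innerC3 f z u v) :
    ∃ g : Mat3, IsFrameAt g (h.flPoint z) ∧
      ∃ ξ η : Mat3, IsSu3 ξ ∧ IsSu3 η ∧
        fderiv ℝ (fun z => (h.flPoint z).emb) z u = infAction ξ (h.flPoint z) ∧
        fderiv ℝ (fun z => (h.flPoint z).emb) z v = infAction η (h.flPoint z) ∧
        ∃ Y ∈ g1, (1 / 2 : ℂ) • (ξ - Complex.I • η) = g * Y * g⁻¹ := by
  have hu := h.movingFrame_unitary z
  set g := movingFrame f z with hg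
  have hinv : g⁻¹ = g.conjTranspose :=
    Matrix.inv_eq_right_inv (Matrix.mem_unitaryGroup_iff.1 hu)
  set d : ℂ → Fin 3 → C3 := fun w j => dirDeriv w (fun y => colVec (movingFrame f y) j) z with hd
  have hact : ∀ w, fderiv ℝ (fun z => (h.flPoint z).emb) z w =
      infAction (g * offDiag (colVec g) (d w) * g.conjTranspose) (h.flPoint z) := by
    intro w
    rw [infAction_offDiag hu (h.movingFrame_skew z w) _ rfl (h.flPoint_starProjection z)
      (h.leg z w), h.fderiv_flPoint]
    rfl
  obtain ⟨c, -, hcc⟩ := h.span_conformal (h.isConformalFrame_confDir z) hc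
  refine ⟨g, h.isFrameAt_movingFrame z, g * offDiag (colVec g) (d u) * g.conjTranspose,
    g * offDiag (colVec g) (d v) * g.conjTranspose, isSu3_offDiag hu (h.movingFrame_skew z u),
    isSu3_offDiag hu (h.movingFrame_skew z v), hact u, hact v, _,
    h.offDiag_mem z ((1 / 2 : ℂ) * c), ?_⟩
  have e : (1 / 2 : ℂ) • (offDiag (colVec g) (d u) - Complex.I • offDiag (colVec g) (d v)) =
      ((1 / 2 : ℂ) * c) • offDiag (colVec g) fun j =>
        dirDeriv 1 (fun y => colVec (movingFrame f y) j) z -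
          Complex.I • dirDeriv (confDir f z) (fun y => colVec (movingFrame f y) j) z := by
    ext i j
    have e1 := congrArg (inner ℂ (colVec g i)) (hcc fun y => colVec (movingFrame f y) j)
    rw [inner_sub_right, inner_smul_right, inner_smul_right] at e1
    simp only [offDiag, Matrix.smul_apply, Matrix.sub_apply, Matrix.of_apply, smul_eq_mul]
    split_ifs
    · ring
    · linear_combination (1 / 2 : ℂ) * e1
  rw [hinv, ← e]
  simp only [Matrix.mul_smul, Matrix.smul_mul, Matrix.mul_sub, Matrix.sub_mul]

end IsNormMinLeg

/-! ### The special Lagrangian cone -/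

lemma fderiv_cone {f : ℂ → C3} (hf : Differentiable ℝ f) (r s : ℝ) (z u : ℂ) :
    fderiv ℝ (fun x : ℝ × ℂ => x.1 • f x.2) (r, z) (s, u) = s • f z + r • dirDeriv u f z := by
  have h1 : HasFDerivAt (fun x : ℝ × ℂ => x.1) (ContinuousLinearMap.fst ℝ ℝ ℂ) (r, z) :=
    hasFDerivAt_fst
  have h2 : HasFDerivAt (fun x : ℝ × ℂ => f x.2)
      ((fderiv ℝ f z).comp (ContinuousLinearMap.snd ℝ ℝ ℂ)) (r, z) :=
    (hf z).hasFDerivAt.comp (r, z) hasFDerivAt_snd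
  have h3 := (h1.fun_smul h2).fderiv
  rw [h3]
  simp [dirDeriv, add_comm]

/-- Multiplication by exp(iα) on ℂ³ has determinant exp(3iα). -/
lemma IsSpecialLagrangianCone.rotate {Λ : Submodule ℤ ℂ} {θ : ℝ} {κ : ℝ → ℂ ⧸ Λ → C3}
    (h : IsSpecialLagrangianCone θ κ) (α : ℝ) :
    IsSpecialLagrangianCone (θ + 3 * α) fun r p => Complex.exp (α * Complex.I) • κ r p := by
  obtain ⟨h1, h2⟩ := h
  refine ⟨contDiffOn_const.fun_smul h1, fun r z hr => ?_⟩
  obtain ⟨g, hg, hdet, A, hA, hA'⟩ := h2 r z hr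
  set e := Complex.exp (α * Complex.I) with he
  refine ⟨e • g, ?_, ?_, A, hA, fun j => ?_⟩
  · rw [Matrix.mem_unitaryGroup_iff] at hg ⊢
    have : e * star e = 1 := by
      rw [← starRingEnd_apply, Complex.mul_conj, Complex.normSq_eq_norm_sq,
        Complex.norm_exp_ofReal_mul_I]
      simp
    rw [star_smul, Matrix.smul_mul, Matrix.mul_smul, smul_smul, hg, this, one_smul]
  · rw [Matrix.det_smul, hdet, he, Fintype.card_fin, ← Complex.exp_nat_mul, ← Complex.exp_add]
    congr 1
    push_cast
    ring
  · have hopen : {x : ℝ × ℂ | 0 < x.1} ∈ nhds (r, z) :=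
      (isOpen_lt continuous_const continuous_fst).mem_nhds hr
    have hd : DifferentiableAt ℝ (fun x : ℝ × ℂ => κ x.1 (Submodule.Quotient.mk x.2)) (r, z) :=
      (h1.differentiableOn (by simp)).differentiableAt hopen
    rw [fderiv_fun_const_smul hd, smul_apply, hA' j, Matrix.smul_mul]
    rfl

/-- The position vector and an orthonormal tangent frame of f form a unitary matrix of determinant
i. -/
lemma IsNormMinLeg.isSpecialLagrangianCone {f : ℂ → C3} (h : IsNormMinLeg f)
    {Λ : Submodule ℤ ℂ} {F : ℂ ⧸ Λ → S5} (hF : ∀ z, pullS5 F z = f z) :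
    IsSpecialLagrangianCone (Real.pi / 2) (coneMap F) := by
  have e : (fun x : ℝ × ℂ => coneMap F x.1 (Submodule.Quotient.mk x.2)) =
      fun x => x.1 • f x.2 := funext fun x => by
    rw [coneMap, ← hF]; rfl
  unfold IsSpecialLagrangianCone
  rw [e]
  refine ⟨(contDiff_fst.smul (h.smooth.comp contDiff_snd)).contDiffOn, fun r z hr => ?_⟩
  have hc := h.isConformalFrame_confDir z
  have hρ := h.inner_pos (z := z) one_ne_zero
  obtain ⟨g1, g2, g3⟩ := h.gram_of_conformal hc
  have hdet := h.det3_conformal hc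
  have hvim : 0 < (confDir f z).im := by simpa using hc.2.2
  have hv := dirDeriv_eq_coord f (confDir f z) z
  have g0 := h.inner_tangent z 1 1
  set v := confDir f z
  set ρ := innerC3 (dirDeriv 1 f z) (dirDeriv 1 f z)
  set s := √ρ with hs
  have hs0 : 0 < s := Real.sqrt_pos.2 hρ
  have hs2 : (s : ℂ) ^ 2 = ρ := by rw [← Complex.ofReal_pow, Real.sq_sqrt hρ.le]
  have hs0' : (s : ℂ) ≠ 0 := Complex.ofReal_ne_zero.2 hs0.ne'
  have hn : ∀ x : C3, inner ℂ x x = (ρ : ℂ) →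
      inner ℂ ((s : ℂ)⁻¹ • x) ((s : ℂ)⁻¹ • x) = (1 : ℂ) := by
    intro x hx
    rw [inner_smul_left, inner_smul_right, hx, map_inv₀, Complex.conj_ofReal, ← hs2]
    field_simp
  -- With v = `confDir f z`, the real matrix expresses ∂_r, ∂_1, ∂_i in the unitary columns. Its
  -- last column solves v = Re v + i Im v for the direction i.
  refine ⟨colMat (f z) ((s : ℂ)⁻¹ • dirDeriv 1 f z) ((s : ℂ)⁻¹ • dirDeriv v f z),
    mem_unitaryGroup_of_columns (h.inner_self z) (hn _ g0) (hn _ (g1.trans g0)) ?_ ?_ ?_, ?_,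
    !![1, 0, 0; 0, r * s, -(r * s * v.re / v.im); 0, 0, r * s / v.im], ?_, ?_⟩
  · rw [inner_smul_right, h.leg, mul_zero]
  · rw [inner_smul_right, h.leg, mul_zero]
  · rw [inner_smul_left, inner_smul_right, g2, mul_zero, mul_zero]
  · change det3 _ _ _ = _
    have e1 : det3 (f z) ((s : ℂ)⁻¹ • dirDeriv 1 f z) ((s : ℂ)⁻¹ • dirDeriv v f z) =
        ((s : ℂ) ^ 2)⁻¹ * det3 (f z) (dirDeriv 1 f z) (dirDeriv v f z) := by
      simp only [det3_eq, PiLp.smul_apply, smul_eq_mul]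
      ring
    rw [e1, hdet, hs2, ← mul_assoc, inv_mul_cancel₀ (Complex.ofReal_ne_zero.2 hρ.ne'), one_mul]
    push_cast
    exact Complex.exp_pi_div_two_mul_I.symm
  · rw [Matrix.det_fin_three]
    simp
    positivity
  · have hvim' : (v.im : ℂ) ≠ 0 := Complex.ofReal_ne_zero.2 hvim.ne'
    obtain ⟨c0, c1, c2⟩ := colVec_colMat (f z) ((s : ℂ)⁻¹ • dirDeriv 1 f z)
      ((s : ℂ)⁻¹ • dirDeriv v f z)
    intro j
    rw [colVec_mul, Fin.sum_univ_three, c0, c1, c2]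
    fin_cases j
    · change fderiv ℝ _ (r, z) ((1 : ℝ), (0 : ℂ)) = _
      rw [fderiv_cone h.diff]
      simp [dirDeriv]
    · change fderiv ℝ _ (r, z) ((0 : ℝ), (1 : ℂ)) = _
      rw [fderiv_cone h.diff]
      simp [smul_smul, hs0']
    · change fderiv ℝ _ (r, z) ((0 : ℝ), Complex.I) = _
      rw [fderiv_cone h.diff, hv, ← Complex.coe_smul]
      simp [smul_smul, smul_add]
      match_scalars <;> simp only [Complex.coe_algebraMap] <;> field_simp
      simp

/-! ### Wirtinger derivatives -/

section Wirtinger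

variable {V : Type*} [NormedAddCommGroup V] [NormedSpace ℂ V] [NormedSpace ℝ V]

lemma dZ_eq (F : ℂ → V) (z : ℂ) :
    dZ F z = (1 / 2 : ℂ) • (dirDeriv 1 F z - Complex.I • dirDeriv Complex.I F z) := rfl

lemma dZbar_eq (F : ℂ → V) (z : ℂ) :
    dZbar F z = (1 / 2 : ℂ) • (dirDeriv 1 F z + Complex.I • dirDeriv Complex.I F z) := rfl

lemma dZ_const (c : V) (z : ℂ) : dZ (fun _ => c) z = 0 := by
  simp [dZ_eq, dirDeriv_const]

lemma dZbar_const (c : V) (z : ℂ) : dZbar (fun _ => c) z = 0 := by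
  simp [dZbar_eq, dirDeriv_const]

lemma dZ_congr {F G : ℂ → V} (h : ∀ z, F z = G z) (z : ℂ) : dZ F z = dZ G z := by
  rw [funext h]

lemma dZbar_congr {F G : ℂ → V} (h : ∀ z, F z = G z) (z : ℂ) : dZbar F z = dZbar G z := by
  rw [funext h]

lemma dZ_neg (F : ℂ → V) (z : ℂ) : dZ (fun y => -F y) z = -dZ F z := by
  rw [dZ_eq, dZ_eq, dirDeriv_neg, dirDeriv_neg, ← smul_neg, neg_sub, smul_neg]
  congr 1
  abel

lemma dZbar_neg (F : ℂ → V) (z : ℂ) : dZbar (fun y => -F y) z = -dZbar F z := by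
  rw [dZbar_eq, dZbar_eq, dirDeriv_neg, dirDeriv_neg, ← smul_neg, smul_neg]
  congr 1
  abel

variable [IsScalarTower ℝ ℂ V]

lemma dZ_smul {a : ℂ → ℂ} {F : ℂ → V} (ha : Differentiable ℝ a) (hF : Differentiable ℝ F)
    (z : ℂ) : dZ (fun y => a y • F y) z = a z • dZ F z + dZ a z • F z := by
  rw [dZ_eq, dZ_eq, dZ_eq, dirDeriv_smul ha hF, dirDeriv_smul ha hF]
  simp only [smul_eq_mul]
  module

lemma dZ_const_smul {F : ℂ → V} (hF : Differentiable ℝ F) (c z : ℂ) :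
    dZ (fun y => c • F y) z = c • dZ F z := by
  rw [dZ_smul (differentiable_const c) hF, dZ_const, zero_smul, add_zero]

lemma ContDiff.dZ {F : ℂ → V} (hF : ContDiff ℝ ∞ F) : ContDiff ℝ ∞ (dZ F) :=
  contDiff_const.fun_smul ((hF.dirDeriv 1).sub
    (contDiff_const.fun_smul (hF.dirDeriv Complex.I)))

lemma ContDiff.dZbar {F : ℂ → V} (hF : ContDiff ℝ ∞ F) : ContDiff ℝ ∞ (dZbar F) :=
  contDiff_const.fun_smul ((hF.dirDeriv 1).add
    (contDiff_const.fun_smul (hF.dirDeriv Complex.I)))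

lemma dirDeriv_dZ {F : ℂ → V} (hF : ContDiff ℝ ∞ F) (u z : ℂ) :
    dirDeriv u (dZ F) z = dZ (dirDeriv u F) z := by
  have h1 := (hF.dirDeriv 1).differentiable_infty
  have h2 := (hF.dirDeriv Complex.I).differentiable_infty
  rw [dirDeriv_congr (dZ_eq F), dirDeriv_smul (differentiable_const _)
    (h1.fun_sub ((differentiable_const _).fun_smul h2)),
    dirDeriv_sub h1 ((differentiable_const _).fun_smul h2),
    dirDeriv_smul (differentiable_const _) h2, dirDeriv_const, dirDeriv_const, zero_smul,
    zero_smul, add_zero, add_zero, dZ_eq, dirDeriv_comm hF u, dirDeriv_comm hF u]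

lemma dirDeriv_dZbar {F : ℂ → V} (hF : ContDiff ℝ ∞ F) (u z : ℂ) :
    dirDeriv u (dZbar F) z = dZbar (dirDeriv u F) z := by
  have h1 := (hF.dirDeriv 1).differentiable_infty
  have h2 := (hF.dirDeriv Complex.I).differentiable_infty
  rw [dirDeriv_congr (dZbar_eq F), dirDeriv_smul (differentiable_const _)
    (h1.fun_add ((differentiable_const _).fun_smul h2)),
    dirDeriv_add h1 ((differentiable_const _).fun_smul h2),
    dirDeriv_smul (differentiable_const _) h2, dirDeriv_const, dirDeriv_const, zero_smul,
    zero_smul, add_zero, add_zero, dZbar_eq, dirDeriv_comm hF u, dirDeriv_comm hF u]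

lemma dZ_dZbar_eq {F : ℂ → V} (hF : ContDiff ℝ ∞ F) (z : ℂ) : dZ (dZbar F) z =
    (1 / 4 : ℂ) • (dirDeriv 1 (dirDeriv 1 F) z +
      dirDeriv Complex.I (dirDeriv Complex.I F) z) := by
  rw [dZ_eq, dirDeriv_dZbar hF, dirDeriv_dZbar hF, dZbar_eq, dZbar_eq,
    dirDeriv_comm hF Complex.I 1]
  match_scalars <;> simp <;> ring_nf <;> simp <;> ring

lemma dZbar_dZ {F : ℂ → V} (hF : ContDiff ℝ ∞ F) (z : ℂ) :
    dZbar (dZ F) z = dZ (dZbar F) z := by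
  rw [dZbar_eq, dirDeriv_dZ hF, dirDeriv_dZ hF, dZ_eq, dZ_eq, dZ_dZbar_eq hF,
    dirDeriv_comm hF Complex.I 1]
  match_scalars <;> simp <;> ring_nf <;> simp <;> ring

end Wirtinger

/-- Conjugate linearity on the left turns ∂ into ∂̄ in the first factor. -/
lemma dZ_inner {F G : ℂ → C3} (hF : Differentiable ℝ F) (hG : Differentiable ℝ G) (z : ℂ) :
    dZ (fun y => inner ℂ (F y) (G y)) z =
      inner ℂ (F z) (dZ G z) + inner ℂ (dZbar F z) (G z) := by
  rw [dZ_eq, dZ_eq, dZbar_eq, dirDeriv_inner hF hG, dirDeriv_inner hF hG]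
  simp only [inner_smul_left, inner_smul_right, inner_add_left, inner_sub_right, smul_eq_mul,
    Complex.conj_I, map_div₀, map_one, map_ofNat]
  ring

lemma dZbar_inner {F G : ℂ → C3} (hF : Differentiable ℝ F) (hG : Differentiable ℝ G) (z : ℂ) :
    dZbar (fun y => inner ℂ (F y) (G y)) z =
      inner ℂ (F z) (dZbar G z) + inner ℂ (dZ F z) (G z) := by
  rw [dZbar_eq, dZ_eq, dZbar_eq, dirDeriv_inner hF hG, dirDeriv_inner hF hG]
  simp only [inner_smul_left, inner_smul_right, inner_sub_left, inner_add_right, smul_eq_mul,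
    Complex.conj_I, map_div₀, map_one, map_ofNat]
  ring

lemma dZ_coord {F : ℂ → C3} (hF : Differentiable ℝ F) (i : Fin 3) (z : ℂ) :
    dZ (fun y => F y i) z = dZ F z i := by
  rw [dZ_eq, dZ_eq, dirDeriv_coord hF, dirDeriv_coord hF]
  rfl

/-- Directional derivatives after a complex linear change of the coordinate. -/
lemma dirDeriv_comp_mul {V : Type*} [NormedAddCommGroup V] [NormedSpace ℝ V] {F : ℂ → V}
    (hF : Differentiable ℝ F) (a u z : ℂ) :
    dirDeriv u (fun y => F (a * y)) z = dirDeriv (a * u) F (a * z) := by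
  have h1 : HasFDerivAt (fun y : ℂ => a * y) ((ContinuousLinearMap.mul ℝ ℂ) a) z :=
    ((ContinuousLinearMap.mul ℝ ℂ) a).hasFDerivAt
  have h2 := ((hF (a * z)).hasFDerivAt.comp z h1).fderiv
  rw [dirDeriv]
  erw [h2]
  rfl

lemma dZ_comp_mul {F : ℂ → C3} (hF : Differentiable ℝ F) (a z : ℂ) :
    dZ (fun y => F (a * y)) z = a • dZ F (a * z) := by
  rw [dZ_eq, dZ_eq, dirDeriv_comp_mul hF, dirDeriv_comp_mul hF, dirDeriv_eq_coord F (a * 1),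
    dirDeriv_eq_coord F (a * Complex.I)]
  have ha := Complex.re_add_im a
  generalize hx : (a.re : ℂ) = x at *
  generalize hy : (a.im : ℂ) = y at *
  have e1 : ((a * 1).re : ℂ) = x := by rw [mul_one, hx]
  have e2 : ((a * 1).im : ℂ) = y := by rw [mul_one, hy]
  have e3 : ((a * Complex.I).re : ℂ) = -y := by simp [hy]
  have e4 : ((a * Complex.I).im : ℂ) = x := by simp [hx]
  rw [e1, e2, e3, e4]
  generalize a * z = w
  rw [← ha]
  match_scalars <;> ring_nf <;> simp <;> ring

lemma differentiable_of_dZbar_eq_zero {F : ℂ → ℂ} (hF : Differentiable ℝ F)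
    (h : ∀ z, dZbar F z = 0) : Differentiable ℂ F := fun z => by
  refine differentiableAt_complex_iff_differentiableAt_real.2 ⟨hF z, ?_⟩
  have e := h z
  rw [dZbar, smul_eq_mul, mul_eq_zero, or_iff_right (by norm_num)] at e
  simp only [smul_eq_mul] at e ⊢
  linear_combination (-Complex.I) * e + (fderiv ℝ F z Complex.I) * Complex.I_mul_I

/-! ### Change of the coordinate -/

lemma isConformalFrame_comp_mul {f : ℂ → C3} (hf : Differentiable ℝ f) {a : ℂ} (ha : a ≠ 0)
    (z u v : ℂ) : IsConformalFrame innerC3 (fun y => f (a * y)) z u v ↔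
      IsConformalFrame innerC3 f (a * z) (a * u) (a * v) := by
  have e := dirDeriv_comp_mul hf a
  simp only [dirDeriv] at e
  have hn : 0 < Complex.normSq a := Complex.normSq_pos.2 ha
  simp only [IsConformalFrame, e]
  have e2 : (a * u).re * (a * v).im - (a * u).im * (a * v).re =
      Complex.normSq a * (u.re * v.im - u.im * v.re) := by
    simp [Complex.normSq_apply]
    ring
  rw [e2, mul_pos_iff_of_pos_left hn]

lemma IsMinLegPlane.comp_mul {f : ℂ → C3} (h : IsMinLegPlane f) {a : ℂ} (ha : a ≠ 0) :
    IsMinLegPlane fun y => f (a * y) where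
  smooth := h.smooth.comp (contDiff_const.mul contDiff_id)
  norm_eq z := h.norm_eq _
  leg z u := by rw [dirDeriv_comp_mul h.diff, h.leg]
  immersed z u v huv := by
    have e := dirDeriv_comp_mul h.diff a
    have : dirDeriv u (fun y => f (a * y)) z = dirDeriv v (fun y => f (a * y)) z := huv
    rw [e, e] at this
    exact mul_left_cancel₀ ha (h.immersed _ this)
  minimal z u v hc := by
    have e := dirDeriv_comp_mul h.diff a
    rw [isConformalFrame_comp_mul h.diff ha] at hc
    obtain ⟨w, hw⟩ := h.minimal _ _ _ hc
    have e2 : ∀ u, dirDeriv u (dirDeriv u fun y => f (a * y)) z =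
        dirDeriv (a * u) (dirDeriv (a * u) f) (a * z) := fun u => by
      rw [dirDeriv_congr (e u), dirDeriv_comp_mul (h.diff_dir _)]
    refine ⟨a⁻¹ * w, ?_⟩
    change dirDeriv (a⁻¹ * w) (fun y => f (a * y)) z = tanS5 (f (a * z))
      (dirDeriv u (dirDeriv u fun y => f (a * y)) z + dirDeriv v (dirDeriv v fun y => f (a * y)) z)
    rw [e2, e2, e, mul_inv_cancel_left₀ ha]
    exact hw

lemma IsNormMinLeg.comp_mul {f : ℂ → C3} (h : IsNormMinLeg f) {a : ℂ} (ha : a ≠ 0) :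
    IsNormMinLeg fun y => f (a * y) where
  toIsMinLegPlane := h.toIsMinLegPlane.comp_mul ha
  phase z := by
    obtain ⟨r, hr, e⟩ := h.phase (a * z)
    have hn : 0 < Complex.normSq a := Complex.normSq_pos.2 ha
    refine ⟨Complex.normSq a * r, mul_pos hn hr, ?_⟩
    rw [dirDeriv_comp_mul h.diff, dirDeriv_comp_mul h.diff, det3_dirDeriv, e]
    have : ((a * 1).re * (a * Complex.I).im - (a * 1).im * (a * Complex.I).re) =
        Complex.normSq a := by simp [Complex.normSq_apply]
    rw [this]
    push_cast
    ring

/-! ### Lattice periodic functions -/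

section Periodic

variable (Λ : Submodule ℤ ℂ) [DiscreteTopology Λ] [IsZLattice ℝ Λ]

lemma exists_bounded_representatives : ∃ R : ℝ, ∀ z : ℂ, ∃ l ∈ Λ, ‖z + l‖ ≤ R := by
  have : Module.Free ℤ Λ := ZLattice.module_free ℝ Λ
  have : Module.Finite ℤ Λ := ZLattice.module_finite ℝ Λ
  let b := (Module.Free.chooseBasis ℤ Λ).ofZLatticeBasis ℝ Λ
  refine ⟨∑ i, ‖b i‖, fun z => ⟨-(ZSpan.floor b z : ℂ), neg_mem ?_, ?_⟩⟩
  · exact ((Module.Free.chooseBasis ℤ Λ).ofZLatticeBasis_span ℝ Λ).le (ZSpan.floor b z).2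
  · rw [← sub_eq_add_neg]
    exact ZSpan.norm_fract_le b z

lemma exists_forall_le_of_periodic {g : ℂ → ℝ} (hg : Continuous g)
    (hp : ∀ l ∈ Λ, ∀ z, g (z + l) = g z) : ∃ z₀, ∀ z, g z₀ ≤ g z := by
  obtain ⟨R, hR⟩ := exists_bounded_representatives Λ
  have hne : (Metric.closedBall (0 : ℂ) R).Nonempty := by
    obtain ⟨l, -, hl⟩ := hR 0
    exact ⟨0 + l, mem_closedBall_zero_iff.2 hl⟩
  obtain ⟨z₀, -, h⟩ := (isCompact_closedBall (0 : ℂ) R).exists_isMinOn hne hg.continuousOn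
  refine ⟨z₀, fun z => ?_⟩
  obtain ⟨l, hl, hz⟩ := hR z
  rw [← hp l hl z]
  exact h (mem_closedBall_zero_iff.2 hz)

/-- Compactness of a bounded set of representatives bounds g, and Liouville's theorem applies. -/
lemma eq_of_holomorphic_periodic {g : ℂ → ℂ} (hg : Differentiable ℂ g)
    (hp : ∀ l ∈ Λ, ∀ z, g (z + l) = g z) (z w : ℂ) : g z = g w := by
  refine hg.apply_eq_apply_of_bounded ?_ z w
  obtain ⟨z₀, h⟩ := exists_forall_le_of_periodic Λ (g := fun z => -‖g z‖)
    hg.continuous.norm.neg fun l hl z => by rw [hp l hl]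
  rw [isBounded_iff_forall_norm_le]
  exact ⟨‖g z₀‖, by rintro _ ⟨z, rfl⟩; simpa using h z⟩

end Periodic

/-! ### Logarithms and second derivatives at a minimum -/

lemma dirDeriv_log {g : ℂ → ℝ} (hg : Differentiable ℝ g) (h0 : ∀ z, g z ≠ 0) (u z : ℂ) :
    dirDeriv u (fun y => Real.log (g y)) z = (g z)⁻¹ * dirDeriv u g z := by
  have := ((hg z).hasFDerivAt.log (h0 z)).fderiv
  rw [dirDeriv, this]
  rfl

lemma dirDeriv_ofReal {g : ℂ → ℝ} (hg : Differentiable ℝ g) (u z : ℂ) :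
    dirDeriv u (fun y => (g y : ℂ)) z = dirDeriv u g z :=
  dirDeriv_clm Complex.ofRealCLM hg u z

lemma dZbar_log {g : ℂ → ℝ} (hg : Differentiable ℝ g) (h0 : ∀ z, g z ≠ 0) (z : ℂ) :
    dZbar (fun y => (Real.log (g y) : ℂ)) z = (g z : ℂ)⁻¹ * dZbar (fun y => (g y : ℂ)) z := by
  have hl : Differentiable ℝ fun y => Real.log (g y) := fun y => (hg y).log (h0 y)
  rw [dZbar_eq, dZbar_eq, dirDeriv_ofReal hl, dirDeriv_ofReal hl, dirDeriv_log hg h0,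
    dirDeriv_log hg h0, dirDeriv_ofReal hg, dirDeriv_ofReal hg]
  push_cast
  simp only [smul_eq_mul]
  ring

/-- A negative second derivative would make the minimum also a local maximum along the line. The
function would then be locally constant there, with second derivative 0. -/
lemma dirDeriv_dirDeriv_nonneg {g : ℂ → ℝ} (hg : ContDiff ℝ ∞ g) {z₀ : ℂ}
    (hm : ∀ z, g z₀ ≤ g z) (u : ℂ) : 0 ≤ dirDeriv u (dirDeriv u g) z₀ := by
  have hd : ∀ k : ℂ → ℝ, Differentiable ℝ k → ∀ t : ℝ,
      HasDerivAt (fun t : ℝ => k (z₀ + t * u)) (dirDeriv u k (z₀ + t * u)) t := by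
    intro k hk t
    have h1 : HasDerivAt (fun t : ℝ => z₀ + t * u) u t := by
      simpa using (((hasDerivAt_id t).ofReal_comp).mul_const u).const_add z₀
    exact (hk _).hasFDerivAt.comp_hasDerivAt t h1
  have e1 : deriv (fun t : ℝ => g (z₀ + t * u)) = fun t : ℝ => dirDeriv u g (z₀ + t * u) :=
    funext fun t => (hd g hg.differentiable_infty t).deriv
  have e2 : deriv (deriv fun t : ℝ => g (z₀ + t * u)) 0 = dirDeriv u (dirDeriv u g) z₀ := by
    rw [e1, (hd _ (hg.dirDeriv u).differentiable_infty 0).deriv]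
    simp
  have hmin : IsLocalMin (fun t : ℝ => g (z₀ + t * u)) 0 :=
    Filter.Eventually.of_forall fun t => by simpa using hm (z₀ + t * u)
  by_contra hneg
  push Not at hneg
  have hmax := isLocalMax_of_deriv_deriv_neg (e2 ▸ hneg) hmin.deriv_eq_zero
    (hd g hg.differentiable_infty 0).continuousAt
  have hc : (fun t : ℝ => g (z₀ + t * u)) =ᶠ[nhds 0] fun _ => g z₀ := by
    filter_upwards [hmin, hmax] with t h1 h2
    simp only [Complex.ofReal_zero, zero_mul, add_zero] at h1 h2
    exact le_antisymm h2 h1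
  have := hc.deriv.deriv_eq
  rw [e2] at this
  simp at this
  exact hneg.ne this

/-! ### Minimal Legendrian immersions in a conformal coordinate -/

lemma dirDeriv_eq_dZ (f : ℂ → C3) (w z : ℂ) :
    dirDeriv w f z = w • dZ f z + (starRingEnd ℂ) w • dZbar f z := by
  rw [dirDeriv_eq_coord, dZ_eq, dZbar_eq]
  have h1 := Complex.re_eq_add_conj w
  have h2 := Complex.im_eq_sub_conj w
  rw [h1, h2]
  match_scalars
  · ring
  · field_simp
    rw [Complex.I_sq]
    ring

lemma C3.inner_self_eq (x : C3) : inner ℂ x x = (‖x‖ : ℂ) ^ 2 := inner_self_eq_norm_sq_to_K x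

namespace IsMinLegPlane

variable {f : ℂ → C3} (h : IsMinLegPlane f)

include h

lemma diff_dZ : Differentiable ℝ (dZ f) := h.smooth.dZ.differentiable_infty

lemma diff_dZbar : Differentiable ℝ (dZbar f) := h.smooth.dZbar.differentiable_infty

lemma contDiff_sq : ContDiff ℝ ∞ fun z => inner ℂ (dZ f z) (dZ f z) :=
  contDiff_inner_C3 h.smooth.dZ h.smooth.dZ

lemma inner_dZ (z : ℂ) : inner ℂ (f z) (dZ f z) = 0 := by
  rw [dZ_eq, inner_smul_right, inner_sub_right, inner_smul_right, h.leg, h.leg]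
  simp

lemma inner_dZbar (z : ℂ) : inner ℂ (f z) (dZbar f z) = 0 := by
  rw [dZbar_eq, inner_smul_right, inner_add_right, inner_smul_right, h.leg, h.leg]
  simp

variable (hc : ∀ z, IsConformalFrame innerC3 f z 1 Complex.I)

include hc

lemma inner_dZbar_dZ (z : ℂ) : inner ℂ (dZbar f z) (dZ f z) = 0 := by
  obtain ⟨g1, g2, g3⟩ := h.gram_of_conformal (hc z)
  rw [dZbar_eq, dZ_eq]
  simp only [inner_smul_left, inner_smul_right, inner_sub_right, inner_add_left, g1, g2, g3,
    Complex.conj_I]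
  ring_nf
  simp

lemma inner_dZ_dZ (z : ℂ) :
    inner ℂ (dZ f z) (dZ f z) = 1 / 2 * inner ℂ (dirDeriv 1 f z) (dirDeriv 1 f z) := by
  rw [dZ_eq, inner_smul_left, inner_smul_right, (h.gram_isotropic (hc z)).1]
  simp only [map_div₀, map_one, map_ofNat]
  ring

lemma inner_dZbar_dZbar (z : ℂ) :
    inner ℂ (dZbar f z) (dZbar f z) = inner ℂ (dZ f z) (dZ f z) := by
  rw [h.inner_dZ_dZ hc, dZbar_eq, inner_smul_left, inner_smul_right,
    (h.gram_isotropic (hc z)).2.1]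
  simp only [map_div₀, map_one, map_ofNat]
  ring

lemma dZ_ne_zero (z : ℂ) : dZ f z ≠ 0 := by
  intro h0
  have e := h.inner_dZ_dZ hc z
  have := h.inner_pos (z := z) one_ne_zero
  rw [h0, inner_zero_left, h.inner_tangent] at e
  have : (innerC3 (dirDeriv 1 f z) (dirDeriv 1 f z) : ℂ) = 0 := by
    linear_combination -2 * e
  rw [Complex.ofReal_eq_zero] at this
  linarith

lemma norm_dZbar (z : ℂ) : ‖dZbar f z‖ = ‖dZ f z‖ := by
  have e := h.inner_dZbar_dZbar hc z
  rw [C3.inner_self_eq, C3.inner_self_eq] at e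
  have e' : ‖dZbar f z‖ ^ 2 = ‖dZ f z‖ ^ 2 := by exact_mod_cast e
  exact (sq_eq_sq₀ (norm_nonneg _) (norm_nonneg _)).1 e'

/-- Minimality leaves a tangential term f_w, and conformality removes it. -/
lemma dZ_dZbar (z : ℂ) : dZ (dZbar f) z = -(inner ℂ (dZ f z) (dZ f z) • f z) := by
  obtain ⟨w, hw⟩ := h.mean_curvature (hc z)
  have e : dZ (dZbar f) z = (1 / 4 : ℂ) • dirDeriv w f z -
      inner ℂ (dZ f z) (dZ f z) • f z := by
    rw [dZ_dZbar_eq h.smooth, hw, h.inner_dZ_dZ hc, h.inner_tangent, smul_sub, smul_smul]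
    congr 2
    ring
  -- The ∂̄-derivative of ⟨f_z̄, f_z⟩ = 0 reduces to ½ w̄ ⟨f_z, f_z⟩ = 0.
  have e1 := dZbar_congr (h.inner_dZbar_dZ hc) z
  rw [dZbar_inner h.diff_dZbar h.diff_dZ, dZbar_const, dZbar_dZ h.smooth, e, dirDeriv_eq_dZ] at e1
  have m0 : inner ℂ (dZbar f z) (f z) = 0 := inner_eq_zero_symm.1 (h.inner_dZbar z)
  simp only [inner_sub_left, inner_sub_right, inner_add_left, inner_add_right, inner_smul_left,
    inner_smul_right, h.inner_dZbar_dZ hc, h.inner_dZbar_dZbar hc, h.inner_dZ, m0, map_div₀,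
    map_one, map_ofNat] at e1
  have hw0 : (starRingEnd ℂ) w = 0 := by
    have hρ : inner ℂ (dZ f z) (dZ f z) ≠ 0 := inner_self_ne_zero.2 (h.dZ_ne_zero hc z)
    refine (mul_eq_zero.1 ?_).resolve_right hρ
    linear_combination 2 * e1
  rw [map_eq_zero] at hw0
  rw [e, hw0, dirDeriv_eq_dZ, map_zero, zero_smul, zero_smul, add_zero, smul_zero, zero_sub]

lemma dZbar_dZ_self (z : ℂ) : dZbar (dZ f) z = -(inner ℂ (dZ f z) (dZ f z) • f z) := by
  rw [dZbar_dZ h.smooth, h.dZ_dZbar hc]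

lemma inner_dZ_dZ_dZ (z : ℂ) : inner ℂ (f z) (dZ (dZ f) z) = 0 := by
  have e := dZ_congr h.inner_dZ z
  rwa [dZ_inner h.diff h.diff_dZ, dZ_const, h.inner_dZbar_dZ hc, add_zero] at e

lemma hopfDiff_eq (z : ℂ) : hopfDiff f z = -inner ℂ (dZbar f z) (dZ (dZ f) z) := by
  have e := dZ_congr (h.inner_dZ_dZ_dZ hc) z
  rw [dZ_inner h.diff h.smooth.dZ.dZ.differentiable_infty, dZ_const] at e
  exact eq_neg_of_add_eq_zero_left e

lemma dZbar_dZ_dZ (z : ℂ) : dZbar (dZ (dZ f)) z =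
    -(inner ℂ (dZ f z) (dZ f z) • dZ f z +
      dZ (fun y => inner ℂ (dZ f y) (dZ f y)) z • f z) := by
  rw [dZbar_dZ h.smooth.dZ, dZ_congr (h.dZbar_dZ_self hc), dZ_neg,
    dZ_smul h.contDiff_sq.differentiable_infty h.diff]

/-- In ∂̄⟨f_z̄, f_zz⟩ one factor becomes a multiple of f, the other a combination of f and f_z.
These are orthogonal to f_zz and f_z̄ respectively. -/
lemma dZbar_hopfDiff (z : ℂ) : dZbar (hopfDiff f) z = 0 := by
  rw [dZbar_congr (h.hopfDiff_eq hc), dZbar_neg,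
    dZbar_inner h.diff_dZbar h.smooth.dZ.dZ.differentiable_infty, h.dZbar_dZ_dZ hc,
    h.dZ_dZbar hc, inner_neg_left, inner_neg_right, inner_add_right, inner_smul_left,
    inner_smul_right, inner_smul_right, h.inner_dZbar_dZ hc, h.inner_dZ_dZ_dZ hc,
    inner_eq_zero_symm.1 (h.inner_dZbar z)]
  simp

lemma dZ_sq (z : ℂ) : dZ (fun y => inner ℂ (dZ f y) (dZ f y)) z =
    inner ℂ (dZ f z) (dZ (dZ f) z) := by
  rw [dZ_inner h.diff_dZ h.diff_dZ, h.dZbar_dZ_self hc, inner_neg_left, inner_smul_left,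
    h.inner_dZ, mul_zero, neg_zero, add_zero]

lemma dZbar_sq (z : ℂ) : dZbar (fun y => inner ℂ (dZ f y) (dZ f y)) z =
    inner ℂ (dZ (dZ f) z) (dZ f z) := by
  rw [dZbar_inner h.diff_dZ h.diff_dZ, h.dZbar_dZ_self hc, inner_neg_right, inner_smul_right,
    inner_eq_zero_symm.1 (h.inner_dZ z), mul_zero, neg_zero, zero_add]

end IsMinLegPlane

namespace IsNormMinLeg

variable {f : ℂ → C3} (h : IsNormMinLeg f)
  (hc : ∀ z, IsConformalFrame innerC3 f z 1 Complex.I)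

include h hc

lemma two_mul_norm_dZ (z : ℂ) :
    √(2 * innerC3 (dirDeriv 1 f z) (dirDeriv 1 f z)) = 2 * ‖dZ f z‖ := by
  rw [Real.sqrt_eq_iff_mul_self_eq (by have := h.inner_pos (z := z) one_ne_zero; positivity)
    (by positivity)]
  have e := h.inner_dZ_dZ hc z
  rw [C3.inner_self_eq, h.inner_tangent] at e
  have e' : ‖dZ f z‖ ^ 2 = 1 / 2 * innerC3 (dirDeriv 1 f z) (dirDeriv 1 f z) := by
    apply Complex.ofReal_injective
    push_cast
    exact e
  linear_combination (-4) * e'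

lemma colVec_lagFrame (z : ℂ) : colVec (lagFrame f z) 0 = f z ∧
    colVec (lagFrame f z) 1 = (‖dZ f z‖⁻¹ : ℂ) • dZ f z ∧
    colVec (lagFrame f z) 2 = -((‖dZ f z‖⁻¹ : ℂ) • dZbar f z) := by
  refine ⟨rfl, rfl, ?_⟩
  rw [← h.norm_dZbar hc]
  rfl

lemma lagFrame_mem (z : ℂ) : lagFrame f z ∈ Matrix.specialUnitaryGroup (Fin 3) ℂ := by
  have e := h.frame_mem (hc z)
  convert e using 1
  have e1 : unitM f 1 Complex.I z = (‖dZ f z‖⁻¹ : ℂ) • dZ f z := by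
    rw [unitM, h.two_mul_norm_dZ hc, dZ_eq, smul_smul]
    push_cast
    congr 1
    rw [mul_inv]
    ring
  have e2 : unitN f 1 Complex.I z = -((‖dZbar f z‖⁻¹ : ℂ) • dZbar f z) := by
    rw [unitN, h.two_mul_norm_dZ hc, h.norm_dZbar hc, dZbar_eq, smul_smul]
    push_cast
    congr 2
    rw [mul_inv]
    ring
  rw [e1, e2]
  rfl

/-- The second derivative `f_zz` in terms of the frame. -/
lemma dZ_dZ_eq (z : ℂ) : inner ℂ (dZ f z) (dZ f z) • dZ (dZ f) z =
    inner ℂ (dZ f z) (dZ (dZ f) z) • dZ f z - hopfDiff f z • dZbar f z := by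
  have e := unitary_expand (Matrix.mem_specialUnitaryGroup_iff.1 (h.lagFrame_mem hc z)).1
    (dZ (dZ f) z)
  obtain ⟨c0, c1, c2⟩ := h.colVec_lagFrame hc z
  have hn : (‖dZ f z‖ : ℂ) ≠ 0 := by simpa using h.dZ_ne_zero hc z
  rw [Fin.sum_univ_three, c0, c1, c2, h.inner_dZ_dZ_dZ hc, zero_smul, zero_add, inner_neg_left,
    inner_smul_left, inner_smul_left, map_inv₀, Complex.conj_ofReal] at e
  have hs : inner ℂ (dZ f z) (dZ f z) = (‖dZ f z‖ : ℂ) ^ 2 := C3.inner_self_eq _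
  rw [h.hopfDiff_eq hc, hs]
  generalize inner ℂ (dZ f z) (dZ (dZ f) z) = p at e ⊢
  generalize inner ℂ (dZbar f z) (dZ (dZ f) z) = q at e ⊢
  rw [e]
  match_scalars <;> field_simp

/-- The norm of the second derivative `f_zz`. -/
lemma inner_dZ_dZ_self (z : ℂ) :
    inner ℂ (dZ f z) (dZ f z) * inner ℂ (dZ (dZ f) z) (dZ (dZ f) z) =
      inner ℂ (dZ f z) (dZ (dZ f) z) * inner ℂ (dZ (dZ f) z) (dZ f z) +
        hopfDiff f z * (starRingEnd ℂ) (hopfDiff f z) := by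
  rw [← inner_smul_right, h.dZ_dZ_eq hc, inner_sub_right, inner_smul_right, inner_smul_right,
    h.hopfDiff_eq hc, map_neg, inner_conj_symm]
  ring

/-- The Tzitzeica equation. -/
lemma dZ_dZbar_log (z : ℂ) : dZ (dZbar fun y => (Real.log (‖dZ f y‖ ^ 2) : ℂ)) z =
    hopfDiff f z * (starRingEnd ℂ) (hopfDiff f z) / (‖dZ f z‖ : ℂ) ^ 4 - (‖dZ f z‖ : ℂ) ^ 2 := by
  have hs : ∀ y, inner ℂ (dZ f y) (dZ f y) = ((‖dZ f y‖ ^ 2 : ℝ) : ℂ) := fun y => by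
    rw [C3.inner_self_eq]
    push_cast
    rfl
  have hd : Differentiable ℝ fun y => ‖dZ f y‖ ^ 2 := fun y => (h.diff_dZ y).norm_sq ℂ
  have h0 : ∀ y, ‖dZ f y‖ ^ 2 ≠ 0 := fun y => pow_ne_zero 2 (norm_ne_zero_iff.2 (h.dZ_ne_zero hc y))
  set ρ : ℂ → ℂ := fun y => inner ℂ (dZ f y) (dZ f y) with hρ
  have hρ0 : ∀ y, ρ y ≠ 0 := fun y => inner_self_ne_zero.2 (h.dZ_ne_zero hc y)
  set β : ℂ → ℂ := dZbar fun y => (Real.log (‖dZ f y‖ ^ 2) : ℂ) with hβ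
  -- ρβ = ⟨f_zz, f_z⟩ is differentiated without a quotient. The terms |⟨f_z, f_zz⟩|² then cancel
  -- against those in |f_zz|².
  have hβρ : ∀ y, ρ y * β y = inner ℂ (dZ (dZ f) y) (dZ f y) := fun y => by
    rw [hβ, dZbar_log hd h0, ← dZbar_congr hs, h.dZbar_sq hc, ← hs, mul_inv_cancel_left₀ (hρ0 y)]
  have hβs : ContDiff ℝ ∞ β := by
    have : β = fun y => (ρ y)⁻¹ * inner ℂ (dZ (dZ f) y) (dZ f y) :=
      funext fun y => by rw [← hβρ, inv_mul_cancel_left₀ (hρ0 y)]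
    rw [this]
    exact (h.contDiff_sq.inv hρ0).mul (contDiff_inner_C3 h.smooth.dZ.dZ h.smooth.dZ)
  have e := dZ_congr hβρ z
  have e' := dZ_smul h.contDiff_sq.differentiable_infty hβs.differentiable_infty z
  simp only [smul_eq_mul] at e'
  rw [e', h.dZ_sq hc, dZ_inner h.smooth.dZ.dZ.differentiable_infty h.diff_dZ, h.dZbar_dZ_dZ hc,
    inner_neg_left, inner_add_left, inner_smul_left, inner_smul_left, h.inner_dZ, mul_zero,
    add_zero, hs z, Complex.conj_ofReal] at e
  have e2 := h.inner_dZ_dZ_self hc z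
  have e3 := hβρ z
  have e4 : ρ z = (‖dZ f z‖ : ℂ) ^ 2 := C3.inner_self_eq _
  have e5 : inner ℂ (dZ f z) (dZ f z) = ρ z := rfl
  rw [← hs z, e5] at e
  rw [e5] at e2
  have e6 : (‖dZ f z‖ : ℂ) ^ 4 = ρ z ^ 2 := by rw [e4]; ring
  rw [e6, ← e4, eq_sub_iff_add_eq, eq_div_iff (pow_ne_zero 2 (hρ0 z))]
  linear_combination ρ z * e + e2 - inner ℂ (dZ f z) (dZ (dZ f) z) * e3

end IsNormMinLeg

/-! ### The Toda frame -/

namespace IsNormMinLeg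

variable {f : ℂ → C3} (h : IsNormMinLeg f)
  (hc : ∀ z, IsConformalFrame innerC3 f z 1 Complex.I)

include h hc

lemma contDiff_norm_dZ : ContDiff ℝ ∞ fun y => ‖dZ f y‖ :=
  h.smooth.dZ.norm ℂ (h.dZ_ne_zero hc)

lemma norm_dZ_pos (z : ℂ) : 0 < ‖dZ f z‖ := norm_pos_iff.2 (h.dZ_ne_zero hc z)

lemma hopfDiff_const (Λ : Submodule ℤ ℂ) [DiscreteTopology Λ] [IsZLattice ℝ Λ]
    (hp : ∀ l ∈ Λ, ∀ z, hopfDiff f (z + l) = hopfDiff f z) (z w : ℂ) :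
    hopfDiff f z = hopfDiff f w :=
  eq_of_holomorphic_periodic Λ (differentiable_of_dZbar_eq_zero
    (contDiff_inner_C3 h.smooth h.smooth.dZ.dZ.dZ).differentiable_infty (h.dZbar_hopfDiff hc))
    hp z w

/-- With Q = 0 the Tzitzeica equation says ∂∂̄ log|f_z|² = -|f_z|² < 0, contradicting the minimum
that a periodic function attains. -/
lemma exists_hopfDiff_ne_zero (Λ : Submodule ℤ ℂ) [DiscreteTopology Λ] [IsZLattice ℝ Λ]
    (hp : ∀ l ∈ Λ, ∀ z, ‖dZ f (z + l)‖ = ‖dZ f z‖) : ∃ z, hopfDiff f z ≠ 0 := by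
  by_contra! hQ
  have hpos := h.norm_dZ_pos hc
  have hg : ContDiff ℝ ∞ fun y => Real.log (‖dZ f y‖ ^ 2) :=
    ((h.contDiff_norm_dZ hc).pow 2).log fun y => (pow_pos (hpos y) 2).ne'
  obtain ⟨z₀, hz⟩ := exists_forall_le_of_periodic Λ hg.continuous fun l hl z => by rw [hp l hl]
  have hgC : ContDiff ℝ ∞ fun y => (Real.log (‖dZ f y‖ ^ 2) : ℂ) :=
    Complex.ofRealCLM.contDiff.comp hg
  have e := h.dZ_dZbar_log hc z₀
  have e2 : ∀ u, dirDeriv u (dirDeriv u fun y => (Real.log (‖dZ f y‖ ^ 2) : ℂ)) z₀ =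
      ((dirDeriv u (dirDeriv u fun y => Real.log (‖dZ f y‖ ^ 2)) z₀ : ℝ) : ℂ) := fun u => by
    rw [dirDeriv_congr (dirDeriv_ofReal hg.differentiable_infty u),
      dirDeriv_ofReal (hg.dirDeriv u).differentiable_infty]
  rw [dZ_dZbar_eq hgC, hQ, e2, e2, zero_mul, zero_div, smul_eq_mul] at e
  have h1 := dirDeriv_dirDeriv_nonneg hg hz 1
  have h2 := dirDeriv_dirDeriv_nonneg hg hz Complex.I
  have h3 := pow_pos (hpos z₀) 2
  generalize dirDeriv 1 (dirDeriv 1 fun y => Real.log (‖dZ f y‖ ^ 2)) z₀ = a at e h1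
  generalize dirDeriv Complex.I (dirDeriv Complex.I fun y => Real.log (‖dZ f y‖ ^ 2)) z₀ = b at e h2
  have e' : 1 / 4 * (a + b) = 0 - ‖dZ f z₀‖ ^ 2 := by
    apply Complex.ofReal_injective
    push_cast
    exact e
  linarith

lemma contDiff_colVec_lagFrame (j : Fin 3) : ContDiff ℝ ∞ fun z => colVec (lagFrame f z) j := by
  have hs := h.contDiff_norm_dZ hc
  have hsC : ContDiff ℝ ∞ fun z => (‖dZ f z‖⁻¹ : ℂ) :=
    (Complex.ofRealCLM.contDiff.comp hs).inv fun z =>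
      Complex.ofReal_ne_zero.2 (h.norm_dZ_pos hc z).ne'
  fin_cases j
  · exact h.smooth
  · exact hsC.fun_smul h.smooth.dZ
  · change ContDiff ℝ ∞ fun z => colVec (lagFrame f z) 2
    rw [funext fun z => (h.colVec_lagFrame hc z).2.2]
    exact (hsC.fun_smul h.smooth.dZbar).neg

lemma dZ_inv_norm (z : ℂ) : dZ (fun y => (‖dZ f y‖ : ℂ)⁻¹) z =
    -((‖dZ f z‖ : ℂ)⁻¹ ^ 2 * dZ (fun y => (‖dZ f y‖ : ℂ)) z) := by
  have hs : ContDiff ℝ ∞ fun y => (‖dZ f y‖ : ℂ) :=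
    Complex.ofRealCLM.contDiff.comp (h.contDiff_norm_dZ hc)
  have hs0 : ∀ y, (‖dZ f y‖ : ℂ) ≠ 0 := fun y =>
    Complex.ofReal_ne_zero.2 (h.norm_dZ_pos hc y).ne'
  have hi : ContDiff ℝ ∞ fun y => (‖dZ f y‖ : ℂ)⁻¹ := hs.inv hs0
  have e := dZ_smul hs.differentiable_infty hi.differentiable_infty z
  rw [dZ_congr (fun y => by rw [smul_eq_mul, mul_inv_cancel₀ (hs0 y)]), dZ_const] at e
  simp only [smul_eq_mul] at e
  have := hs0 z
  field_simp at e ⊢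
  linear_combination -e

/-- The columns of the derivative of the frame. -/
lemma dZ_colVec_lagFrame (hQ : ∀ z, hopfDiff f z = 1) (z : ℂ) (j : Fin 3) :
    dZ (fun y => colVec (lagFrame f y) j) z = ∑ i,
      (!![0, 0, (‖dZ f z‖ : ℂ);
        (‖dZ f z‖ : ℂ), (‖dZ f z‖ : ℂ)⁻¹ * dZ (fun y => (‖dZ f y‖ : ℂ)) z, 0;
        0, (‖dZ f z‖ : ℂ)⁻¹ ^ 2, -((‖dZ f z‖ : ℂ)⁻¹ * dZ (fun y => (‖dZ f y‖ : ℂ)) z)] : Mat3) i j •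
        colVec (lagFrame f z) i := by
  obtain ⟨c0, c1, c2⟩ := h.colVec_lagFrame hc z
  have hs : ContDiff ℝ ∞ fun y => (‖dZ f y‖ : ℂ) :=
    Complex.ofRealCLM.contDiff.comp (h.contDiff_norm_dZ hc)
  have hs0 : ∀ y, (‖dZ f y‖ : ℂ) ≠ 0 := fun y =>
    Complex.ofReal_ne_zero.2 (h.norm_dZ_pos hc y).ne'
  have hi : ContDiff ℝ ∞ fun y => (‖dZ f y‖ : ℂ)⁻¹ := hs.inv hs0
  have hp : inner ℂ (dZ f z) (dZ (dZ f) z) =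
      2 * (‖dZ f z‖ : ℂ) * dZ (fun y => (‖dZ f y‖ : ℂ)) z := by
    rw [← h.dZ_sq hc, dZ_congr (fun y => (C3.inner_self_eq (dZ f y)).trans (sq _)),
      ← smul_eq_mul]
    have e := dZ_smul hs.differentiable_infty hs.differentiable_infty z
    simp only [smul_eq_mul] at e ⊢
    rw [e]
    ring
  have hdi := h.dZ_inv_norm hc z
  have hzz := h.dZ_dZ_eq hc z
  rw [hQ, one_smul, C3.inner_self_eq, hp] at hzz
  rw [Fin.sum_univ_three, c0, c1, c2]
  have h0 := hs0 z
  fin_cases j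
  · change dZ f z = _
    simp [smul_smul, h0]
  · change dZ (fun y => (‖dZ f y‖⁻¹ : ℂ) • dZ f y) z = _
    rw [dZ_smul hi.differentiable_infty h.diff_dZ, hdi]
    have e : dZ (dZ f) z = ((‖dZ f z‖ : ℂ)⁻¹ ^ 2) • ((‖dZ f z‖ : ℂ) ^ 2 • dZ (dZ f) z) := by
      rw [smul_smul, ← mul_pow, inv_mul_cancel₀ h0, one_pow, one_smul]
    rw [e, hzz]
    generalize dZ (fun y => (‖dZ f y‖ : ℂ)) z = p
    simp
    match_scalars <;> field_simp <;> ring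
  · change dZ (fun y => colVec (lagFrame f y) 2) z = _
    rw [dZ_congr (fun y => (h.colVec_lagFrame hc y).2.2), dZ_neg,
      dZ_smul hi.differentiable_infty h.diff_dZbar, hdi, h.dZ_dZbar hc, C3.inner_self_eq]
    generalize dZ (fun y => (‖dZ f y‖ : ℂ)) z = p
    simp
    match_scalars <;> field_simp
    rfl

/-- Q = 1 turns the entry (2,1) into |f_z|⁻² = s₂/s₁. The Tzitzeica equation is the Toda equation
for j = 1, its negative is j = 2, and j = 0 reads 0 = 0. -/
lemma isTodaFrame (hQ : ∀ z, hopfDiff f z = 1) :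
    IsTodaFrame (lagFrame f) ![fun _ => 1, fun z => ‖dZ f z‖, fun z => ‖dZ f z‖⁻¹] where
  mem := h.lagFrame_mem hc
  smooth i j := (h.contDiff_colVec_lagFrame hc j).coord i
  smooth_s j := by
    fin_cases j
    · exact contDiff_const
    · exact h.contDiff_norm_dZ hc
    · exact (h.contDiff_norm_dZ hc).inv fun z => (h.norm_dZ_pos hc z).ne'
  pos j z := by
    fin_cases j
    · exact one_pos
    · exact h.norm_dZ_pos hc z
    · exact inv_pos.2 (h.norm_dZ_pos hc z)
  frame_eq z := by
    have hm := (Matrix.mem_specialUnitaryGroup_iff.1 (h.lagFrame_mem hc z)).2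
    have hu : IsUnit (lagFrame f z).det := by rw [hm]; exact isUnit_one
    set A : Mat3 := !![0, 0, (‖dZ f z‖ : ℂ);
      (‖dZ f z‖ : ℂ), (‖dZ f z‖ : ℂ)⁻¹ * dZ (fun y => (‖dZ f y‖ : ℂ)) z, 0;
      0, (‖dZ f z‖ : ℂ)⁻¹ ^ 2, -((‖dZ f z‖ : ℂ)⁻¹ * dZ (fun y => (‖dZ f y‖ : ℂ)) z)] with hA
    have e : (Matrix.of fun i j => dZ (fun y => lagFrame f y i j) z) = lagFrame f z * A := by
      ext i j
      have e1 := dZ_coord (h.contDiff_colVec_lagFrame hc j).differentiable_infty i z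
      rw [h.dZ_colVec_lagFrame hc hQ, ← colVec_mul] at e1
      exact e1
    rw [e, Matrix.nonsing_inv_mul_cancel_left _ _ hu]
    have h0 : (‖dZ f z‖ : ℂ) ≠ 0 := Complex.ofReal_ne_zero.2 (h.norm_dZ_pos hc z).ne'
    ext i j
    fin_cases i <;> fin_cases j <;> simp [hA, h.dZ_inv_norm hc, dZ_const] <;>
      first | (ring; done) | field_simp
  toda_eq j z := by
    have hlog := h.dZ_dZbar_log hc z
    have h0 := (h.norm_dZ_pos hc z).ne'
    rw [hQ, map_one, one_mul] at hlog
    fin_cases j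
    · change dZ (dZbar fun y => (Real.log ((1 : ℝ) ^ 2) : ℂ)) z =
        ((‖dZ f z‖ ^ 2 / 1 ^ 2 - 1 ^ 2 / (‖dZ f z‖⁻¹) ^ 2 : ℝ) : ℂ)
      rw [dZ_congr (dZbar_const _), dZ_const]
      simp
    · change dZ (dZbar fun y => (Real.log (‖dZ f y‖ ^ 2) : ℂ)) z =
        (((‖dZ f z‖⁻¹) ^ 2 / ‖dZ f z‖ ^ 2 - ‖dZ f z‖ ^ 2 / 1 ^ 2 : ℝ) : ℂ)
      rw [hlog]
      push_cast
      field_simp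
    · change dZ (dZbar fun y => (Real.log ((‖dZ f y‖⁻¹) ^ 2) : ℂ)) z =
        ((1 ^ 2 / (‖dZ f z‖⁻¹) ^ 2 - (‖dZ f z‖⁻¹) ^ 2 / ‖dZ f z‖ ^ 2 : ℝ) : ℂ)
      have e : ∀ y, (Real.log ((‖dZ f y‖⁻¹) ^ 2) : ℂ) = -(Real.log (‖dZ f y‖ ^ 2) : ℂ) :=
        fun y => by rw [inv_pow, Real.log_inv, Complex.ofReal_neg]
      rw [dZ_congr (fun w => (dZbar_congr e w).trans (dZbar_neg _ w)), dZ_neg, hlog]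
      push_cast
      have : (‖dZ f z‖ : ℂ) ≠ 0 := Complex.ofReal_ne_zero.2 h0
      field_simp
      ring

end IsNormMinLeg

/-! ### Cubic characters -/

/-- χ embeds A/N in the cube roots of unity, a group of prime order. -/
lemma subsingleton_or_zmod_three {A : Type*} [AddCommGroup A] (N : Submodule ℤ A) (χ : A → ℂ)
    (h3 : ∀ a, χ a ^ 3 = 1) (hadd : ∀ a b, χ (a + b) = χ a * χ b) (hker : ∀ a, χ a = 1 ↔ a ∈ N) :
    Subsingleton (A ⧸ N) ∨ Nonempty ((A ⧸ N) ≃+ ZMod 3) := by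
  let χ' : A →+ Additive (rootsOfUnity 3 ℂ) :=
    AddMonoidHom.mk' (fun a => Additive.ofMul (rootsOfUnity.mkOfPowEq (χ a) (h3 a))) fun a b => by
      rw [← ofMul_mul]
      congr 1
      ext
      simp [hadd]
  have hk : χ'.toIntLinearMap.ker = N := by
    ext a
    rw [← hker, LinearMap.mem_ker]
    change Additive.ofMul (rootsOfUnity.mkOfPowEq (χ a) (h3 a)) = 0 ↔ _
    rw [← ofMul_one, Equiv.apply_eq_iff_eq, Subtype.ext_iff, Units.ext_iff]
    simp
  have hinj : Function.Injective (N.liftQ χ'.toIntLinearMap hk.ge) := by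
    rw [← LinearMap.ker_eq_bot]
    exact Submodule.ker_liftQ_eq_bot _ _ _ hk.le
  have hfin : Finite (Additive (rootsOfUnity 3 ℂ)) := inferInstanceAs (Finite (rootsOfUnity 3 ℂ))
  have hcard : Nat.card (Additive (rootsOfUnity 3 ℂ)) = 3 := by
    change Nat.card (rootsOfUnity 3 ℂ) = 3
    rw [Complex.card_rootsOfUnity]
  have hdvd := AddSubgroup.card_dvd_of_injective
    (N.liftQ χ'.toIntLinearMap hk.ge).toAddMonoidHom hinj
  rw [hcard] at hdvd
  rcases (Nat.dvd_prime Nat.prime_three).1 hdvd with h | h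
  · exact Or.inl (Nat.card_eq_one_iff_unique.1 h).1
  · right
    have : Fact (Nat.Prime 3) := ⟨Nat.prime_three⟩
    have hcyc : IsAddCyclic (A ⧸ N) := isAddCyclic_of_prime_card h
    have e := zmodAddCyclicAddEquiv hcyc
    rw [h] at e
    exact ⟨e.symm⟩

/-! ### Translations by periods -/

lemma dirDeriv_add_const {V : Type*} [NormedAddCommGroup V] [NormedSpace ℝ V] (F : ℂ → V)
    (l u z : ℂ) : dirDeriv u (fun y => F (y + l)) z = dirDeriv u F (z + l) := by
  rw [dirDeriv, fderiv_comp_add_right]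
  rfl

lemma dZ_add_const {V : Type*} [NormedAddCommGroup V] [NormedSpace ℂ V] [NormedSpace ℝ V]
    (F : ℂ → V) (l z : ℂ) : dZ (fun y => F (y + l)) z = dZ F (z + l) := by
  rw [dZ_eq, dZ_eq, dirDeriv_add_const, dirDeriv_add_const]

lemma dZ_of_translate {F : ℂ → C3} (hF : Differentiable ℝ F) {c l : ℂ}
    (h : ∀ z, F (z + l) = c • F z) (z : ℂ) : dZ F (z + l) = c • dZ F z := by
  rw [← dZ_add_const, dZ_congr h, dZ_const_smul hF]

lemma norm_dZ_of_translate {F : ℂ → C3} (hF : Differentiable ℝ F) {c l : ℂ} (hc : ‖c‖ = 1)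
    (h : ∀ z, F (z + l) = c • F z) (z : ℂ) : ‖dZ F (z + l)‖ = ‖dZ F z‖ := by
  rw [dZ_of_translate hF h, norm_smul, hc, one_mul]

/-- A unit factor cancels in the Hermitian product, so Q lives on ℂ/Λ even when f does not. -/
lemma hopfDiff_of_translate {F : ℂ → C3} (hF : ContDiff ℝ ∞ F) {c l : ℂ} (hc : ‖c‖ = 1)
    (h : ∀ z, F (z + l) = c • F z) (z : ℂ) : hopfDiff F (z + l) = hopfDiff F z := by
  have e := dZ_of_translate hF.dZ.dZ.differentiable_infty
    (dZ_of_translate hF.dZ.differentiable_infty (dZ_of_translate hF.differentiable_infty h)) z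
  rw [hopfDiff, e, h, inner_smul_left, inner_smul_right, ← mul_assoc, Complex.conj_mul', hc]
  simp [hopfDiff]

/-- Q is a cubic differential, so a cube root normalises it. -/
lemma hopfDiff_comp_mul {F : ℂ → C3} (hF : ContDiff ℝ ∞ F) (a z : ℂ) :
    hopfDiff (fun y => F (a * y)) z = a ^ 3 * hopfDiff F (a * z) := by
  have h1 : ∀ y, dZ (fun y => F (a * y)) y = a • dZ F (a * y) :=
    dZ_comp_mul hF.differentiable_infty a
  have hm : ∀ {G : ℂ → C3}, Differentiable ℝ G → Differentiable ℝ fun y => G (a * y) := fun hG =>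
    hG.comp (differentiable_id.const_mul a)
  have h2 : ∀ y, dZ (dZ fun y => F (a * y)) y = a ^ 2 • dZ (dZ F) (a * y) := fun y => by
    rw [dZ_congr h1, dZ_const_smul (hm hF.dZ.differentiable_infty),
      dZ_comp_mul hF.dZ.differentiable_infty, smul_smul, sq]
  rw [hopfDiff, dZ_congr h2, dZ_const_smul (hm hF.dZ.dZ.differentiable_infty),
    dZ_comp_mul hF.dZ.dZ.differentiable_infty, smul_smul, inner_smul_right, hopfDiff]
  ring

lemma isConformalFrame_mul {f : ℂ → C3} {z : ℂ} (hc : IsConformalFrame innerC3 f z 1 Complex.I)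
    {a : ℂ} (ha : a ≠ 0) : IsConformalFrame innerC3 f z (a * 1) (a * Complex.I) := by
  obtain ⟨h1, h2, -⟩ := hc
  have hn : 0 < Complex.normSq a := Complex.normSq_pos.2 ha
  have e1 := dirDeriv_eq_coord f (a * 1) z
  have e2 := dirDeriv_eq_coord f (a * Complex.I) z
  simp only [dirDeriv, mul_one, Complex.mul_re, Complex.mul_im, Complex.I_re, Complex.I_im,
    mul_zero, zero_sub, add_zero] at e1 e2
  have h2' := (innerC3_comm _ _).trans h2
  refine ⟨?_, ?_, ?_⟩
  · simp only [e1, e2, mul_one, innerC3_add_left, innerC3_add_right, innerC3_smul_left,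
      innerC3_smul_right, h1, h2, h2']
    ring
  · simp only [e1, e2, mul_one, innerC3_add_left, innerC3_add_right, innerC3_smul_left,
      innerC3_smul_right, h1, h2, h2']
    ring
  · have : (a * 1).re * (a * Complex.I).im - (a * 1).im * (a * Complex.I).re =
        Complex.normSq a := by simp [Complex.normSq_apply]
    rwa [this]

lemma isConformalFrame_comp {f : ℂ → C3} (hf : Differentiable ℝ f)
    (hc : ∀ z, IsConformalFrame innerC3 f z 1 Complex.I) {a : ℂ} (ha : a ≠ 0) (z : ℂ) :
    IsConformalFrame innerC3 (fun y => f (a * y)) z 1 Complex.I :=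
  (isConformalFrame_comp_mul hf ha z 1 Complex.I).2 (isConformalFrame_mul (hc _) ha)

namespace IsNormMinLeg

variable {f : ℂ → C3} (h : IsNormMinLeg f)

lemma isFrameAt_lagFrame (hc : ∀ z, IsConformalFrame innerC3 f z 1 Complex.I) {a : ℂ}
    (ha : a ≠ 0) (z : ℂ) : IsFrameAt (lagFrame (fun y => f (a * y)) z) (h.flPoint (a * z)) := by
  have hk := h.comp_mul ha
  have hcf := isConformalFrame_comp h.diff hc ha
  refine ⟨hk.lagFrame_mem hcf z, rfl, ?_⟩
  obtain ⟨c0, c1, -⟩ := hk.colVec_lagFrame hcf z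
  have hn : (‖dZ (fun y => f (a * y)) z‖ : ℂ) ≠ 0 :=
    Complex.ofReal_ne_zero.2 (hk.norm_dZ_pos hcf z).ne'
  rw [h.flPoint_W (isConformalFrame_mul (hc _) ha), ← dirDeriv_comp_mul h.diff,
    ← dirDeriv_comp_mul h.diff, c0, c1]
  generalize (‖dZ (fun y => f (a * y)) z‖ : ℂ) = s at hn
  rw [dZ_eq, smul_smul, Submodule.span_insert, Submodule.span_insert,
    Submodule.span_singleton_smul_eq
      (IsUnit.mk0 _ (mul_ne_zero (inv_ne_zero hn) (by norm_num)))]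

/-- A conformal minimal Legendrian plane over a torus has a Toda frame, in a suitable linear
coordinate. -/
theorem exists_toda_coordinate (hc : ∀ z, IsConformalFrame innerC3 f z 1 Complex.I)
    (Λ : Submodule ℤ ℂ) [DiscreteTopology Λ] [IsZLattice ℝ Λ]
    (hp : ∀ l ∈ Λ, ∃ c : ℂ, ‖c‖ = 1 ∧ ∀ z, f (z + l) = c • f z) :
    ∃ c : ℂ, c ≠ 0 ∧
      (∀ ζ, hopfDiff (fun y => f (c⁻¹ * y)) ζ = 1) ∧
      (∀ ζ, IsFrameAt (lagFrame (fun y => f (c⁻¹ * y)) ζ) (h.flPoint (c⁻¹ * ζ))) ∧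
      (∀ l ∈ Λ, ∀ ζ, ‖dZ (fun y => f (c⁻¹ * y)) (ζ + c * l)‖ = ‖dZ (fun y => f (c⁻¹ * y)) ζ‖) ∧
      IsTodaFrame (lagFrame (fun y => f (c⁻¹ * y)))
        ![fun _ => 1, fun ζ => ‖dZ (fun y => f (c⁻¹ * y)) ζ‖,
          fun ζ => ‖dZ (fun y => f (c⁻¹ * y)) ζ‖⁻¹] := by
  have hn : ∀ l ∈ Λ, ∀ z, ‖dZ f (z + l)‖ = ‖dZ f z‖ := fun l hl z => by
    obtain ⟨c, hc1, hcf⟩ := hp l hl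
    exact norm_dZ_of_translate h.diff hc1 hcf z
  have hQp : ∀ l ∈ Λ, ∀ z, hopfDiff f (z + l) = hopfDiff f z := fun l hl z => by
    obtain ⟨c, hc1, hcf⟩ := hp l hl
    exact hopfDiff_of_translate h.smooth hc1 hcf z
  obtain ⟨z₀, hz₀⟩ := h.exists_hopfDiff_ne_zero hc Λ hn
  -- In the coordinate ζ = cz the constant Q becomes c⁻³Q.
  obtain ⟨c, hc3⟩ := IsAlgClosed.exists_pow_nat_eq (hopfDiff f z₀) (n := 3) (by norm_num)
  have hc0 : c ≠ 0 := by
    rintro rfl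
    exact hz₀ (by rw [← hc3]; simp)
  have ha : c⁻¹ ≠ 0 := inv_ne_zero hc0
  have hk := h.comp_mul ha
  have hcf := isConformalFrame_comp h.diff hc ha
  have hQ : ∀ ζ, hopfDiff (fun y => f (c⁻¹ * y)) ζ = 1 := fun ζ => by
    rw [hopfDiff_comp_mul h.smooth, h.hopfDiff_const hc Λ hQp _ z₀, ← hc3, inv_pow,
      inv_mul_cancel₀ (pow_ne_zero 3 hc0)]
  refine ⟨c, hc0, hQ, h.isFrameAt_lagFrame hc ha, fun l hl ζ => ?_, hk.isTodaFrame hcf hQ⟩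
  rw [dZ_comp_mul h.diff, dZ_comp_mul h.diff, mul_add, inv_mul_cancel_left₀ hc0, norm_smul,
    norm_smul, hn l hl]

end IsNormMinLeg

/-! ### Descent to the torus -/

lemma projCP2_hopf (v : S5) (x : C3) (hx : x = v) : projCP2 (hopf v) x = x := by
  rw [hx, projCP2, Submodule.starProjection_eq_self_iff, hopf, Projectivization.submodule_mk]
  exact Submodule.mem_span_singleton_self _

lemma hopf_eq_of_projCP2 {p : CP2} {v : S5} (h : projCP2 p (v : C3) = v) : hopf v = p := by
  induction p using Projectivization.ind with
  | h w hw =>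
    rw [projCP2, Submodule.starProjection_eq_self_iff, Projectivization.submodule_mk,
      Submodule.mem_span_singleton] at h
    obtain ⟨a, ha⟩ := h
    rw [hopf, Projectivization.mk_eq_mk_iff']
    exact ⟨a, ha⟩

lemma FL2.eq_of {q q' : FL2} (hw : (q.w : C3) = q'.w) (hW : q.W = q'.W) : q = q' := by
  cases q
  cases q'
  cases Subtype.ext hw
  cases hW
  rfl

namespace IsNormMinLeg

variable {f : ℂ → C3} (h : IsNormMinLeg f)

lemma flPoint_add_period {l : ℂ} (hl : ∀ z, f (z + l) = f z) (z : ℂ) :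
    h.flPoint (z + l) = h.flPoint z := by
  have e : ∀ u, dirDeriv u f (z + l) = dirDeriv u f z := fun u => by
    rw [← dirDeriv_add_const, dirDeriv_congr hl]
  refine FL2.eq_of (hl z) ?_
  change Submodule.span ℂ {f (z + l), unitM f 1 (confDir f (z + l)) (z + l)} =
    Submodule.span ℂ {f z, unitM f 1 (confDir f z) z}
  simp only [unitM, confDir, e, hl]

include h in
/-- The Lagrangian angle restricts the holonomy to the cube roots of unity. -/
lemma pow_three_eq_one {c l : ℂ} (hc : ‖c‖ = 1) (hl : ∀ z, f (z + l) = c • f z) : c ^ 3 = 1 := by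
  have e : ∀ u, dirDeriv u f (0 + l) = c • dirDeriv u f 0 := fun u => by
    rw [← dirDeriv_add_const, dirDeriv_congr hl, dirDeriv_const_smul h.diff]
  obtain ⟨r, hr, h1⟩ := h.phase (0 + l)
  obtain ⟨r', hr', h2⟩ := h.phase 0
  rw [e, e, hl, det3_smul, h2, ← mul_assoc] at h1
  have h3 := mul_right_cancel₀ Complex.I_ne_zero h1
  have h4 : r' = r := by
    have := congrArg norm h3
    rwa [norm_mul, norm_pow, hc, one_pow, one_mul, Complex.norm_real, Complex.norm_real,
      Real.norm_of_nonneg hr.le, Real.norm_of_nonneg hr'.le] at this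
  rw [h4] at h3
  exact mul_eq_right₀ (Complex.ofReal_ne_zero.2 hr.ne') |>.1 h3

end IsNormMinLeg

/-- The group of periods of `f` in `Λ`. -/
def periods (Λ : Submodule ℤ ℂ) (f : ℂ → C3) : Submodule ℤ ℂ :=
  Λ ⊓ AddSubgroup.toIntSubmodule
    { carrier := {l | ∀ z, f (z + l) = f z}
      zero_mem' := fun z => by rw [add_zero]
      add_mem' := fun {a b} ha hb z => by rw [← add_assoc, hb, ha]
      neg_mem' := fun {a} ha z => by rw [← ha (z + -a), neg_add_cancel_right] }

lemma mem_periods {Λ : Submodule ℤ ℂ} {f : ℂ → C3} {l : ℂ} :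
    l ∈ periods Λ f ↔ l ∈ Λ ∧ ∀ z, f (z + l) = f z := Iff.rfl

lemma exists_out_eq {Λ : Submodule ℤ ℂ} (z : ℂ) :
    ∃ l ∈ Λ, (Submodule.Quotient.mk z : ℂ ⧸ Λ).out = z + l := by
  refine ⟨(Submodule.Quotient.mk z : ℂ ⧸ Λ).out - z, ?_, by ring⟩
  rw [← Submodule.Quotient.eq]
  exact Quotient.out_eq' _

/-- A Legendrian lift is horizontal. -/
lemma isHorizontalOn_of_legendrian {P : ℂ → C3 →L[ℂ] C3} (hP : ∀ z, IsLineProjection (P z))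
    (hs : ContDiff ℝ ∞ P) {g : ℂ → C3} (hg : ContDiff ℝ ∞ g) (h1 : ∀ z, ‖g z‖ = 1)
    (hPg : ∀ z, P z (g z) = g z) (hleg : ∀ z u, (inner ℂ (g z) (fderiv ℝ g z u)).im = 0) :
    IsHorizontalOn P Set.univ g := by
  intro z _
  refine ⟨hPg z, hg.differentiable_infty z, fun u => ?_⟩
  have e := dirDeriv_congr (fun z => inner_self_of_norm_eq_one (h1 z)) u z
  rw [dirDeriv_inner hg.differentiable_infty hg.differentiable_infty, dirDeriv_const,
    ← inner_conj_symm (dirDeriv u g z), Complex.add_conj, Complex.ofReal_eq_zero] at e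
  -- The real part vanishes because |g| = 1, the imaginary part because g is Legendrian.
  have h0 : inner ℂ (g z) (dirDeriv u g z) = 0 := by
    refine Complex.ext ?_ (hleg z u)
    rw [Complex.zero_re]
    linarith
  have e2 := dirDeriv_congr hPg u z
  rw [dirDeriv_apply_complex (hs.differentiable_infty z) (hg.differentiable_infty z),
    (hP z).apply_of_unit (hPg z) (h1 z), h0, zero_smul, zero_add] at e2
  exact e2.symm

lemma IsHorizontalOn.translate {P : ℂ → C3 →L[ℂ] C3} {f : ℂ → C3}
    (hf : IsHorizontalOn P Set.univ f) {l : ℂ} (hl : ∀ z, P (z + l) = P z) :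
    IsHorizontalOn P Set.univ fun z => f (z + l) := by
  intro z _
  obtain ⟨h1, h2, h3⟩ := hf (z + l) trivial
  refine ⟨by rw [← hl z, h1], (differentiableAt_comp_add_right l).2 h2, fun u => ?_⟩
  rw [dirDeriv_add_const, h3, ← dirDeriv_add_const P, dirDeriv_congr hl]

end

/-! ### Holonomy, the covering torus and the conclusion -/

theorem mainTheorem5 (Λ : Submodule ℤ ℂ) [DiscreteTopology Λ] [IsZLattice ℝ Λ]
    (φ : ℂ ⧸ Λ → CP2) (hφ : IsMinimalLagrangian φ) :
    ∃ (Λ' : Submodule ℤ ℂ) (hΛ : Λ' ≤ Λ) (ψ : ℂ ⧸ Λ' → FL2) (f : ℂ ⧸ Λ' → S5),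
      -- the covering group of `ℂ ⧸ Λ' → ℂ ⧸ Λ` is `1` or `ℤ/3`
      (Subsingleton (Λ ⧸ Λ'.submoduleOf Λ) ∨
        Nonempty ((Λ ⧸ Λ'.submoduleOf Λ) ≃+ ZMod 3)) ∧
      -- `ψ = (f, ℓ₀ ⊕ ℓ₁)` is a primitive lift of `φ`
      (∀ p, (ψ p).w = f p) ∧
      (∀ p, hopf (f p) = φ (Submodule.factor hΛ p)) ∧
      (∀ z u v, IsConformalFrame innerEnd (pullCP2 φ) z u v →
        (ψ (Submodule.Quotient.mk z)).W =
          Submodule.span ℂ {pullS5 f z,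
            fderiv ℝ (pullS5 f) z u - Complex.I • fderiv ℝ (pullS5 f) z v}) ∧
      IsPrimitive (IsConformalFrame innerEnd (pullCP2 φ)) ψ ∧
      -- `f` is minimal Legendrian, and determined by `φ` up to a constant
      IsMinimalLegendrian f ∧
      (∀ f' : ℂ ⧸ Λ' → S5, IsLegendrian f' →
        (∀ p, hopf (f' p) = φ (Submodule.factor hΛ p)) →
          ∃ c : ℂ, ‖c‖ = 1 ∧ ∀ p, (f' p : C3) = c • (f p : C3)) ∧
      -- the cone over `f` has constant phase, and a rotation makes it special Lagrangian
      IsSpecialLagrangianCone (Real.pi / 2) (coneMap f) ∧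
      IsSpecialLagrangianCone 0
        (fun r p => Complex.exp (-(Real.pi / 6) * Complex.I) • coneMap f r p) ∧
      -- in a conformal linear coordinate `ζ = c z` with `Q = 1` the frame is a Toda frame
      ((∀ z, IsConformalFrame innerEnd (pullCP2 φ) z 1 Complex.I) →
        ∃ c : ℂ, c ≠ 0 ∧
          (∀ ζ, hopfDiff (fun y => pullS5 f (c⁻¹ * y)) ζ = 1) ∧
          (∀ ζ, IsFrameAt (lagFrame (fun y => pullS5 f (c⁻¹ * y)) ζ)
            (ψ (Submodule.Quotient.mk (c⁻¹ * ζ)))) ∧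
          (∀ l ∈ Λ, ∀ ζ, ‖dZ (fun y => pullS5 f (c⁻¹ * y)) (ζ + c * l)‖ =
            ‖dZ (fun y => pullS5 f (c⁻¹ * y)) ζ‖) ∧
          IsTodaFrame (lagFrame (fun y => pullS5 f (c⁻¹ * y)))
            ![fun _ => 1, fun ζ => ‖dZ (fun y => pullS5 f (c⁻¹ * y)) ζ‖,
              fun ζ => ‖dZ (fun y => pullS5 f (c⁻¹ * y)) ζ‖⁻¹]) := by

  set P := pullCP2 φ with hPdef
  have hP : ∀ z, IsLineProjection (P z) := fun z => isLineProjection_projCP2 _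
  have hs : ContDiff ℝ ∞ P := hφ.smooth
  obtain ⟨f, hf, h⟩ := exists_normalized_lift hP hs hφ.immersed hφ.minimal hφ.lagrangian
  have hPl : ∀ l ∈ Λ, ∀ z, P (z + l) = P z := fun l hl z => by
    have : (Submodule.Quotient.mk (z + l) : ℂ ⧸ Λ) = Submodule.Quotient.mk z := by
      rw [Submodule.Quotient.eq]
      simpa using hl
    rw [hPdef, pullCP2, pullCP2, this]
  -- The translate of f by a period of P is again a parallel unit section; χ is the holonomy.
  have hχ : ∀ l : Λ, ∃ c : ℂ, ‖c‖ = 1 ∧ ∀ z, f (z + l) = c • f z := fun l => by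
    obtain ⟨c, hc, e⟩ := hf.eq_const_smul hP hs isOpen_univ isPreconnected_univ
      Set.univ_nonempty (hf.translate (hPl l l.2)) (fun z _ => h.norm_eq z)
      (fun z _ => h.norm_eq _)
    exact ⟨c, hc, fun z => e z trivial⟩
  choose χ hχ1 hχf using hχ
  have hf0 : ∀ z, f z ≠ 0 := fun z hz => by simpa [hz] using h.norm_eq z
  have hχ3 : ∀ l, χ l ^ 3 = 1 := fun l =>
    h.pow_three_eq_one (hχ1 l) (hχf l)
  have hχadd : ∀ a b, χ (a + b) = χ a * χ b := fun a b => by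
    refine smul_left_injective ℂ (hf0 0) ?_
    simp only
    rw [← hχf, mul_smul, ← hχf b, ← hχf a, Submodule.coe_add]
    congr 1
    ring
  set Λ' := periods Λ f with hΛ'
  have hle : Λ' ≤ Λ := inf_le_left
  have hker : ∀ l, χ l = 1 ↔ l ∈ Λ'.submoduleOf Λ := fun l => by
    change _ ↔ (l : ℂ) ∈ periods Λ f
    rw [mem_periods]
    refine ⟨fun e => ⟨l.2, fun z => by rw [hχf, e, one_smul]⟩, fun e => ?_⟩
    refine smul_left_injective ℂ (hf0 0) ?_
    simp only
    rw [← hχf, e.2, one_smul]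
  -- Any representative may be used, since Λ' consists of periods of f.
  let F : ℂ ⧸ Λ' → S5 := fun p => ⟨f p.out, by simpa using h.norm_eq _⟩
  let ψ : ℂ ⧸ Λ' → FL2 := fun p => h.flPoint p.out
  have hFz : ∀ z, pullS5 F z = f z := fun z => by
    obtain ⟨l, hl, e⟩ := exists_out_eq (Λ := Λ') z
    change f (Submodule.Quotient.mk z : ℂ ⧸ Λ').out = f z
    rw [e, (mem_periods.1 hl).2]
  have hF : pullS5 F = f := funext hFz
  have hψ : ∀ z, ψ (Submodule.Quotient.mk z) = h.flPoint z := fun z => by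
    obtain ⟨l, hl, e⟩ := exists_out_eq (Λ := Λ') z
    change h.flPoint (Submodule.Quotient.mk z : ℂ ⧸ Λ').out = _
    rw [e, h.flPoint_add_period (mem_periods.1 hl).2]
  have hψ' : pullFL2 ψ = fun z => (h.flPoint z).emb := funext fun z => by rw [pullFL2, hψ]
  have hcf : ∀ {z u v}, IsConformalFrame innerEnd P z u v → IsConformalFrame innerC3 f z u v :=
    fun {z u v} => (isConformalFrame_horizontal hP hs hf h.norm_eq z u v).1
  have hcone := h.isSpecialLagrangianCone hFz
  have hleg : IsLegendrian F := ⟨by rw [hF]; exact h.smooth, by rw [hF]; exact h.immersed,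
    fun z u => by
      rw [hF]
      change (inner ℂ (f z) (dirDeriv u f z)).im = 0
      rw [h.leg, Complex.zero_im]⟩
  refine ⟨Λ', hle, ψ, F, subsingleton_or_zmod_three _ χ hχ3 hχadd hker, fun p => rfl, fun p => ?_,
    fun z u v hc => ?_, ⟨?_, ?_, fun z u v hc => ?_⟩, ⟨hleg, ?_⟩, fun f' hf' hp => ?_, hcone, ?_,
    fun hc => ?_⟩
  · induction p using Submodule.Quotient.induction_on with
    | H z =>
      refine hopf_eq_of_projCP2 ?_
      change P z (pullS5 F z) = pullS5 F z
      rw [hFz, (hf z trivial).1]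
  · rw [hψ, hF]
    exact h.flPoint_W (hcf hc)
  · rw [hψ']
    exact h.contDiff_flPoint
  · rw [hψ']
    exact h.immersed_flPoint
  · rw [hψ, hψ']
    exact h.primitive_flPoint (hcf hc)
  · rw [hF]
    exact h.minimal
  · have hPf' : ∀ z, P z (pullS5 f' z) = pullS5 f' z := fun z => by
      have e : φ (Submodule.Quotient.mk z) = hopf (f' (Submodule.Quotient.mk z)) :=
        (hp (Submodule.Quotient.mk z)).symm
      rw [hPdef, pullCP2, e]
      exact projCP2_hopf _ _ rfl
    have h1' : ∀ z, ‖pullS5 f' z‖ = 1 := fun z => by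
      exact mem_sphere_zero_iff_norm.1 (f' (Submodule.Quotient.mk z)).2
    obtain ⟨c, hc, e⟩ := hf.eq_const_smul hP hs isOpen_univ isPreconnected_univ
      Set.univ_nonempty (isHorizontalOn_of_legendrian hP hs hf'.smooth h1' hPf' hf'.legendrian)
      (fun z _ => h.norm_eq z) (fun z _ => h1' z)
    refine ⟨c, hc, fun p => ?_⟩
    induction p using Submodule.Quotient.induction_on with
    | H z =>
      have e' := e z trivial
      rw [← hFz] at e'
      exact e'
  · have e := hcone.rotate (-(Real.pi / 6))
    have e1 : Real.pi / 2 + 3 * -(Real.pi / 6) = 0 := by ring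
    rw [e1] at e
    push_cast at e
    exact e
  · rw [hF]
    -- Applied with Λ rather than Λ': the holonomy has modulus 1, so the functions s_j already
    -- descend to the original torus.
    obtain ⟨c, h1, h2, h3, h4, h5⟩ := h.exists_toda_coordinate (fun z => hcf (hc z)) Λ
      fun l hl => ⟨χ ⟨l, hl⟩, hχ1 _, hχf ⟨l, hl⟩⟩
    exact ⟨c, h1, h2, fun ζ => by rw [hψ]; exact h3 ζ, h4, h5⟩
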